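/- **Setting.** Let $T=(V,E)$ be a finite tree, $|V|=n$. A *subtree* $S$ of $T$ is a non-empty connected set of vertices, and $P_{uv}$ is the path between $u$ and $v$. A *hub labeling* of $S$ assigns to each $u\in S$ a set $H_u\subseteq S$ such that $H_u\cap H_v\cap P_{uv}\neq\varnothing$ for all $u,v\in S$ (including $u=v$). Its $\mathrm{HL}_1$-cost is $\sum_{u\in S}|H_u|$, and $OPT_S$ is the minimum cost of a hub labeling of $S$. The *boundary* $\partial(S)$ is the set of vertices outside $S$ that have a neighbour in $S$. A vertex $r\in S$ is a *boundary-balanced separator* of $S$ if each connected component of $S-r$ has at most half of the total weight of $S$, where $u\in S$ has weight $|\{v\in\partial(S):uv\in E\}|$. **The dynamic program.** Let $k=4t$ with an integer $t\ge 1$. The dynamic program works on the subtrees $S$ with $|\partial(S)|\le k$. It puts $B[S]=1$ if $|S|=1$ and $B[S]=3$ if $|S|=2$; for $|S|\ge 3$, $$B[S]=\Bigl(1+\frac4k\Bigr)|S|+\min_{r\in S}\ \sum_{S''\text{ component of }S-r}B[S'']\quad\text{if }|\partial(S)|<k,$$ $$B[S]=\sum_{S''\text{ component of }S-r_0}B[S'']\quad\text{if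 }|\partial(S)|=k,$$ where $r_0$ is a boundary-balanced separator of $S$. It chooses a vertex $r_S\in S$: a minimizer in the first formula if $|S|\ge3$ and $|\partial(S)|<k$, the vertex $r_0$ if $|S|\ge3$ and $|\partial(S)|=k$, and any vertex of $S$ if $|S|\le2$. The labeling that it produces for $S$ is obtained by adding $r_S$ to $H_u$ for every $u\in S$ and continuing in the same way with each component of $S-r_S$. Let $ALG_S$ be the cost of this labeling, and $$C[S]=\max\Bigl\{0,\Bigl(|\partial(S)|-\frac{3k}4\Bigr)\cdot\frac{4|S|}k\Bigr\}.$$ **Theorem.** 1. For every finite tree $T$, every $k=4t$ with $t\ge1$, every way of breaking the ties, and every subtree $S$ with $|\partial(S)|\le k$, the labeling produced for $S$ is a hub labeling of $S$, and $$ALG_S\le B[S]+C[S],\qquad B[S]\le\Bigl(1+\frac4k\Bigr)OPT_S.$$ In particular, the labeling produced for $T$ is a hub labeling of cost at most $(1+\frac4k)\,OPT_T$. 2. There are one program of a random access machine (registers and arrays of natural numbers; addition, truncated subtraction, comparison, reading, writing and loop control at unit cost; no multiplication) and a constant $c$ such that, for every tree $T$ on $n$ vertices given by its adjacency matrix and every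 $k=4t$ with $t\ge1$, the program on input $(T,k)$ outputs the labeling of $T$ produced by the dynamic program with parameter $k$ (for some way of breaking the ties) in at most $\max(n,2)^{ck}$ steps. For every $\varepsilon\in(0,1)$ and $k=4\lceil1/\varepsilon\rceil$, its output is a hub labeling of $T$ of cost at most $(1+\frac4k)\,OPT_T\le(1+\varepsilon)\,OPT_T$, and it makes at most $\max(n,2)^{c/\varepsilon}=n^{O(1/\varepsilon)}$ steps. Thus the dynamic program is a polynomial-time approximation scheme for $\mathrm{HL}_1$ on trees. -/

import Mathlib

open Finset

universe u

section HubLabeling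

variable {V : Type u}

/-- `S` is the vertex set of a subtree (a non-empty connected part) of the tree `T`. -/
def IsSubtree (T : SimpleGraph V) (S : Finset V) : Prop :=
  (T.induce (S : Set V)).Connected

/-- `w` lies on a path of `T` between `u` and `v`; in a tree this says `w ∈ P_{uv}`. -/
def OnPath (T : SimpleGraph V) (u v w : V) : Prop :=
  ∃ p : T.Walk u v, p.IsPath ∧ w ∈ p.support

/-- `H` is a feasible hub labeling of the subtree of `T` with vertex set `S`. (For vertices of a
subtree the path `P_{uv}` is the same in the subtree and in `T`; the case `u = v` says
`u ∈ H u`.) -/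
def IsHubLabeling (T : SimpleGraph V) (S : Finset V) (H : V → Finset V) : Prop :=
  (∀ u ∈ S, H u ⊆ S) ∧
    ∀ u ∈ S, ∀ v ∈ S, ∃ w, w ∈ H u ∧ w ∈ H v ∧ OnPath T u v w

/-- The `ℓ₁`-cost of a labeling of `S`. -/
def labelCost (S : Finset V) (H : V → Finset V) : ℕ :=
  ∑ u ∈ S, (H u).card

/-- The optimal `ℓ₁`-cost of a hub labeling of the subtree `S`. -/
noncomputable def optCost (T : SimpleGraph V) (S : Finset V) : ℕ :=
  sInf {m : ℕ | ∃ H : V → Finset V, IsHubLabeling T S H ∧ labelCost S H = m}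

/-- The set over which `optCost` minimizes is not empty, so that the minimum is attained. -/
theorem exists_isHubLabeling (T : SimpleGraph V) (hT : T.IsTree) (S : Finset V) :
    ∃ H : V → Finset V, IsHubLabeling T S H ∧ labelCost S H = optCost T S := by
  have hne : {m : ℕ | ∃ H : V → Finset V, IsHubLabeling T S H ∧ labelCost S H = m}.Nonempty := by
    refine ⟨_, fun _ => S, ⟨fun _ _ => Finset.Subset.refl _, fun u hu v _ => ?_⟩, rfl⟩
    obtain ⟨p, hp⟩ := (hT.connected u v).exists_isPath
    exact ⟨u, hu, hu, p, hp, p.start_mem_support⟩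
  exact Nat.sInf_mem hne

open Classical in
/-- The connected component of `v` in the forest induced by `T` on `A`
(the empty set if `v ∉ A`). -/
noncomputable def component (T : SimpleGraph V) (A : Finset V) (v : V) : Finset V :=
  A.filter fun u => ∃ p : T.Walk u v, ∀ x ∈ p.support, x ∈ A

/-- The connected components of the forest induced by `T` on `A`. -/
noncomputable def components [DecidableEq V] (T : SimpleGraph V) (A : Finset V) : Finset (Finset V) :=
  A.image (component T A)

open Classical in
/-- The boundary `∂(S)`: the vertices outside `S` with a neighbour in `S`. -/
noncomputable def boundary [Fintype V] (T : SimpleGraph V) (S : Finset V) : Finset V :=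
  Finset.univ.filter fun v => v ∉ S ∧ ∃ u ∈ S, T.Adj u v

open Classical in
/-- The weight of `u`: the number of boundary vertices of `S` adjacent to `u`. -/
noncomputable def boundaryWeight [Fintype V] (T : SimpleGraph V) (S : Finset V) (u : V) : ℕ :=
  ((boundary T S).filter fun v => T.Adj u v).card

/-- `r` is a balanced separator vertex of the subtree `S` with vertex weights `w`: every component
of `S - r` has at most half of the total weight. -/
def IsBalancedSeparator [DecidableEq V] (T : SimpleGraph V) (S : Finset V) (w : V → ℕ)
    (r : V) : Prop :=
  r ∈ S ∧ ∀ D ∈ components T (S.erase r), 2 * ∑ u ∈ D, w u ≤ ∑ u ∈ S, w u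

open Classical in
theorem card_component_le (T : SimpleGraph V) (A : Finset V) (v : V) :
    (component T A v).card ≤ A.card :=
  Finset.card_le_card (Finset.filter_subset _ _)

theorem card_lt_of_mem_components [DecidableEq V] (T : SimpleGraph V) {S D : Finset V}
    {r : V} (hr : r ∈ S)
    (hD : D ∈ components T (S.erase r)) : D.card < S.card := by
  obtain ⟨v, _, rfl⟩ := Finset.mem_image.1 hD
  exact lt_of_le_of_lt (card_component_le T _ v) (Finset.card_erase_lt_of_mem hr)

/-- The table `B` of the dynamic program with parameter `k`. Here `root S` is the vertex that the
program removes from the subtree `S`; the recurrence uses it only when `|∂(S)| = k`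
(subtrees with a larger boundary are not entries of the table; their value is irrelevant). -/
noncomputable def tableB [Fintype V] [DecidableEq V] (T : SimpleGraph V) (k : ℕ)
    (root : Finset V → V) (S : Finset V) : ℝ :=
  if S.card = 1 then 1
  else if S.card = 2 then 3
  else if (boundary T S).card < k then
    if hS : S.Nonempty then
      (1 + 4 / (k : ℝ)) * (S.card : ℝ) +
        S.attach.inf' (Finset.attach_nonempty_iff.2 hS) fun r =>
          ∑ D ∈ (components T (S.erase r.1)).attach, tableB T k root D.1
    else 0
  else if hr : root S ∈ S then
    ∑ D ∈ (components T (S.erase (root S))).attach, tableB T k root D.1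
  else 0
termination_by S.card
decreasing_by
  · exact card_lt_of_mem_components T r.2 D.2
  · exact card_lt_of_mem_components T hr D.2

/-- The sum of the table entries of the connected components of `S - r`. -/
noncomputable def splitB [Fintype V] [DecidableEq V] (T : SimpleGraph V) (k : ℕ)
    (root : Finset V → V) (S : Finset V) (r : V) : ℝ :=
  ∑ D ∈ components T (S.erase r), tableB T k root D

/-- The recurrence for a subtree with boundary smaller than `k`. -/
theorem tableB_of_lt [Fintype V] [DecidableEq V] (T : SimpleGraph V) (k : ℕ)
    (root : Finset V → V) (S : Finset V)
    (hS : S.Nonempty) (h3 : 3 ≤ S.card) (hb : (boundary T S).card < k) :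
    tableB T k root S =
      (1 + 4 / (k : ℝ)) * (S.card : ℝ) + S.inf' hS (splitB T k root S) := by
  rw [tableB, if_neg (by omega), if_neg (by omega), if_pos hb, dif_pos hS]
  congr 1
  apply le_antisymm
  · refine Finset.le_inf' _ _ fun r hr => ?_
    refine (Finset.inf'_le _ (Finset.mem_attach S ⟨r, hr⟩)).trans (le_of_eq ?_)
    exact Finset.sum_attach (components T (S.erase r)) (tableB T k root)
  · refine Finset.le_inf' _ _ fun r _ => ?_
    refine (Finset.inf'_le _ r.2).trans (le_of_eq ?_)
    exact (Finset.sum_attach (components T (S.erase r.1)) (tableB T k root)).symm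

/-- The recurrence for a subtree with boundary of size exactly `k`. -/
theorem tableB_of_eq [Fintype V] [DecidableEq V] (T : SimpleGraph V) (k : ℕ)
    (root : Finset V → V) (S : Finset V)
    (hr : root S ∈ S) (h3 : 3 ≤ S.card) (hb : (boundary T S).card = k) :
    tableB T k root S = splitB T k root S (root S) := by
  rw [tableB, if_neg (by omega), if_neg (by omega), if_neg (by omega), dif_pos hr]
  exact Finset.sum_attach (components T (S.erase (root S))) (tableB T k root)

/-- The budget `C[S] = max {0, (|∂(S)| - 3k/4) · 4|S|/k}`. -/
noncomputable def budgetC [Fintype V] (T : SimpleGraph V) (k : ℕ) (S : Finset V) : ℝ :=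
  max 0 ((((boundary T S).card : ℝ) - 3 * (k : ℝ) / 4) * (4 * (S.card : ℝ) / (k : ℝ)))

/-- `root` records an execution of the dynamic program with parameter `k`, with any way of breaking
ties: the vertex `root S` removed from a subtree `S` with at least three vertices minimizes the
expression in the recurrence for `B[S]` if `|∂(S)| < k`, and is a balanced separator vertex
with respect to the boundary weights if `|∂(S)| = k`. -/
def IsDPRun [Fintype V] [DecidableEq V] (T : SimpleGraph V) (k : ℕ)
    (root : Finset V → V) : Prop :=
  ∀ S : Finset V, IsSubtree T S → root S ∈ S ∧
    (3 ≤ S.card →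
      ((boundary T S).card < k → ∀ r ∈ S, splitB T k root S (root S) ≤ splitB T k root S r) ∧
      ((boundary T S).card = k →
        IsBalancedSeparator T S (boundaryWeight T S) (root S)))

/-- The labeling of the subtree `S` obtained from the choices `root`: the vertex `r = root S`
becomes a hub of every vertex of `S`, and then each component of `S - r` is treated in the same
way. -/
noncomputable def dpLabeling [DecidableEq V] (T : SimpleGraph V) (root : Finset V → V)
    (S : Finset V) (u : V) : Finset V :=
  if h : root S ∈ S ∧ u ∈ S then
    insert (root S)
      (if u = root S then ∅ else dpLabeling T root (component T (S.erase (root S)) u) u)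
  else ∅
termination_by S.card
decreasing_by
  exact lt_of_le_of_lt (card_component_le T _ u) (Finset.card_erase_lt_of_mem h.1)

end HubLabeling

section MachineModel

/-- The memory of a random access machine: registers and arrays that hold natural numbers.
`arr a i` is the entry `i` of the array `a`. -/
structure Store where
  reg : ℕ → ℕ
  arr : ℕ → ℕ → ℕ

/-- Expressions. There is no multiplication, so that unit cost per operation is a standard
measure (within a polynomial of Turing machine time). -/
inductive Expr where
  | lit (m : ℕ)
  | reg (x : ℕ)
  | load (a : ℕ) (i : Expr)
  | add (e f : Expr)
  | sub (e f : Expr)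

namespace Expr

/-- The value of an expression; subtraction is truncated at `0`. -/
def eval : Expr → Store → ℕ
  | lit m, _ => m
  | reg x, σ => σ.reg x
  | load a i, σ => σ.arr a (i.eval σ)
  | add e f, σ => e.eval σ + f.eval σ
  | sub e f, σ => e.eval σ - f.eval σ

/-- The number of elementary operations in the evaluation of an expression. -/
def cost : Expr → ℕ
  | lit _ => 1
  | reg _ => 1
  | load _ i => i.cost + 1
  | add e f => e.cost + f.cost + 1
  | sub e f => e.cost + f.cost + 1

end Expr

/-- Programs of the random access machine. -/
inductive Cmd where
  /-- register `x` := `e` -/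
  | assign (x : ℕ) (e : Expr)
  /-- entry `i` of the array `a` := `e` -/
  | store (a : ℕ) (i e : Expr)
  | seq (p q : Cmd)
  /-- if `e ≤ f` then `p` else `q` -/
  | ifLe (e f : Expr) (p q : Cmd)
  /-- repeat `p` as many times as the value of `e` at the entry of the loop -/
  | loop (e : Expr) (p : Cmd)

namespace Cmd

/-- The memory after the execution of a program. -/
def exec : Cmd → Store → Store
  | assign x e, σ => { σ with reg := Function.update σ.reg x (e.eval σ) }
  | store a i e, σ =>
      { σ with arr := Function.update σ.arr a (Function.update (σ.arr a) (i.eval σ) (e.eval σ)) }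
  | seq p q, σ => q.exec (p.exec σ)
  | ifLe e f p q, σ => if e.eval σ ≤ f.eval σ then p.exec σ else q.exec σ
  | loop e p, σ => p.exec^[e.eval σ] σ

/-- The number of steps of the execution of a program. -/
def steps : Cmd → Store → ℕ
  | assign _ e, _ => e.cost + 1
  | store _ i e, _ => i.cost + e.cost + 1
  | seq p q, σ => p.steps σ + q.steps (p.exec σ)
  | ifLe e f p q, σ =>
      e.cost + f.cost + 1 + if e.eval σ ≤ f.eval σ then p.steps σ else q.steps σ
  | loop e p, σ =>
      e.cost + 1 + ∑ i ∈ Finset.range (e.eval σ), (p.steps (p.exec^[i] σ) + 1)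

end Cmd

open Classical in
/-- The input: register `0` holds the number `n` of vertices, register `1` the parameter `k`, and
array `0` the adjacency matrix of `T`, row by row. Everything else is `0`. -/
noncomputable def inputStore {n : ℕ} (T : SimpleGraph (Fin n)) (k : ℕ) : Store where
  reg x := if x = 0 then n else if x = 1 then k else 0
  arr a i :=
    if a = 0 ∧ ∃ u v : Fin n, i = u.1 * n + v.1 ∧ T.Adj u v then 1 else 0

/-- The output: array `1` holds the incidence matrix of the hub sets, row by row: `v` is a hub
of `u` if and only if the entry `(u, v)` is not `0`. -/
def outputLabeling (n : ℕ) (σ : Store) (u : Fin n) : Finset (Fin n) :=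
  Finset.univ.filter fun v => σ.arr 1 (u.1 * n + v.1) ≠ 0

end MachineModel

/-!
**The guarantee.** In a tree a vertex lies on the path between two others exactly if it lies
metrically between them (`onPath_iff_dist`), so that convexity, components and sides of edges
become arithmetic of distances. If a property of vertex sets never holds for two disjoint sets,
then some vertex of a subtree can be removed without leaving a component with the property
(`exists_forall_components_not`): otherwise, walking into the components with the property, one
would have to turn back over an edge, whose two sides are disjoint. This gives balanced separators
(`exists_isBalancedSeparator`). Applied to the sets that contain all hubs of one of their
vertices, it gives a vertex `r` such that every other vertex has a hub outside its component of
`S - r`; hence `|S| + ∑ OPT_D ≤ OPT_S`, the sum being over the components `D` of `S - r`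
(`exists_card_add_sum_optCost_le`). The bound `B ≤ (1 + 4 / k) OPT` follows by induction
(`tableB_le`). The cost of the produced labeling obeys `ALG_S = |S| + ∑ ALG_D`. A removal at a
boundary smaller than `k` raises the boundary by at most one, and the surplus `4 |S| / k` in the
recurrence pays for the growth of the budget `C`. A removal at a boundary of size `k = 4t` leaves
components with at most `2t + 1 ≤ 3t` boundary vertices, whose budget is `0`, so that `C[S] = |S|`
pays for the removed vertex (`labelCost_le`).

**The program.** Sets of vertices are stored as rows of indicator bits, and a set `S` addresses
its entry in the table by the number `∑ x ∈ S, 2 ^ x` (`mask`). The program computes all distances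
(`exec_bellmanFord`). It then lists the subtrees with at most `k` boundary vertices: such a
subtree arises from the whole tree by at most `k` steps, each of which removes a vertex and keeps
one side (`exists_filter_dist_eq`, `isFamily_of_rowsUpTo`), and all choices in these steps give at
most `n ^ O(k)` rows. The recurrence is evaluated on the rows in the order of their sizes, with
values multiplied by `k` so that they are integers (`exec_fillTable`). What is proved about the
final table is only that each entry satisfies the recurrence relative to the entries of smaller
subtrees (`Solved`); the removed vertices that it records then form a run of the dynamic program
(`isDPRun_rootOf`), and the output follows them from the whole tree down to each vertex
(`exec_writeOutput`).

The running time needs no reasoning about the contents of the memory: all loops are bounded by the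
registers `0`, `1` and `2`, which are not written inside of loops and hold at most `K ^ 3`, where
`K = max n 2 ^ k`. Hence the number of steps is at most `K` to a power that is read off from the
text of the program (`steps_le_pow`).
-/

section TreeGeometry

variable {V : Type u} {T : SimpleGraph V}

/-! ### Paths, convexity and components in a tree -/

/-- In a tree a vertex lies on the path between two vertices exactly if it lies metrically
between them. This turns every statement about paths into arithmetic of distances. -/
theorem onPath_iff_dist (hT : T.IsTree) {u v w : V} :
    OnPath T u v w ↔ T.dist u w + T.dist w v = T.dist u v := by
  classical
  constructor
  · rintro ⟨p, hp, hw⟩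
    obtain ⟨q, hq, hql⟩ := hT.connected.exists_path_of_dist u v
    obtain rfl : p = q := (hT.existsUnique_path u v).unique hp hq
    have h1 : (p.takeUntil w hw).length + (p.dropUntil w hw).length = p.length := by
      rw [← SimpleGraph.Walk.length_append, p.take_spec hw]
    have h2 := SimpleGraph.dist_le (p.takeUntil w hw)
    have h3 := SimpleGraph.dist_le (p.dropUntil w hw)
    have h4 := hT.connected.dist_triangle (u := u) (v := w) (w := v)
    omega
  · intro h
    obtain ⟨p, hp⟩ := hT.connected.exists_walk_length_eq_dist u w
    obtain ⟨q, hq⟩ := hT.connected.exists_walk_length_eq_dist w v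
    refine ⟨p.append q, SimpleGraph.Walk.isPath_of_length_eq_dist _ ?_, ?_⟩
    · rw [SimpleGraph.Walk.length_append, hp, hq, h]
    · simp

theorem OnPath.symm {u v w : V} (h : OnPath T u v w) : OnPath T v u w := by
  obtain ⟨p, hp, hw⟩ := h
  exact ⟨p.reverse, hp.reverse, by simpa using hw⟩

theorem onPath_left (hT : T.IsTree) (u v : V) : OnPath T u v u :=
  (onPath_iff_dist hT).2 (by simp)

/-- The path between two vertices is contained in every walk between them. -/
theorem OnPath.mem_support (hT : T.IsTree) {u v w : V} (h : OnPath T u v w) (p : T.Walk u v) :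
    w ∈ p.support := by
  classical
  obtain ⟨q, hq, hw⟩ := h
  have : q = p.bypass := (hT.existsUnique_path u v).unique hq p.bypass_isPath
  exact p.support_bypass_subset_support (this ▸ hw)

/-- A set of vertices is path-convex if it contains the path between any two of its vertices. -/
def PathConvex (T : SimpleGraph V) (S : Finset V) : Prop :=
  ∀ u ∈ S, ∀ v ∈ S, ∀ w, OnPath T u v w → w ∈ S

theorem isSubtree_iff (hT : T.IsTree) {S : Finset V} :
    IsSubtree T S ↔ S.Nonempty ∧ PathConvex T S := by
  constructor
  · intro h
    refine ⟨?_, fun u hu v hv w hw => ?_⟩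
    · obtain ⟨x⟩ := h.nonempty
      exact ⟨x.1, x.2⟩
    · obtain ⟨p⟩ := h.preconnected ⟨u, hu⟩ ⟨v, hv⟩
      have := hw.mem_support hT (p.map (SimpleGraph.Embedding.induce (S : Set V)).toHom)
      erw [SimpleGraph.Walk.support_map, List.mem_map] at this
      obtain ⟨x, -, rfl⟩ := this
      exact x.2
  · rintro ⟨⟨x, hx⟩, h⟩
    have : Nonempty ((S : Set V) : Type u) := ⟨⟨x, hx⟩⟩
    refine SimpleGraph.Connected.mk ?_
    rintro ⟨u, hu⟩ ⟨v, hv⟩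
    obtain ⟨p, hp⟩ := (hT.connected u v).exists_isPath
    exact ⟨p.induce _ fun w hw => h u hu v hv w ⟨p, hp, hw⟩⟩

theorem mem_component {A : Finset V} {v u : V} :
    u ∈ component T A v ↔ u ∈ A ∧ ∃ p : T.Walk u v, ∀ x ∈ p.support, x ∈ A := by
  simp [component]

theorem mem_component_iff_onPath (hT : T.IsTree) {A : Finset V} {v u : V} :
    u ∈ component T A v ↔ ∀ x, OnPath T u v x → x ∈ A := by
  rw [mem_component]
  constructor
  · rintro ⟨-, p, hp⟩ x hx
    exact hp x (hx.mem_support hT p)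
  · intro h
    obtain ⟨p, hp⟩ := (hT.connected u v).exists_isPath
    exact ⟨h u (onPath_left hT u v), p, fun x hx => h x ⟨p, hp, hx⟩⟩

theorem component_subset (A : Finset V) (v : V) : component T A v ⊆ A :=
  fun _ hu => (mem_component.1 hu).1

theorem mem_component_self {A : Finset V} {v : V} (hv : v ∈ A) : v ∈ component T A v :=
  mem_component.2 ⟨hv, .nil, by simpa using hv⟩

theorem component_eq_of_mem {A : Finset V} {u v : V} (h : u ∈ component T A v) :
    component T A u = component T A v := by
  obtain ⟨_, p, hp⟩ := mem_component.1 h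
  ext x
  rw [mem_component, mem_component]
  refine and_congr_right fun _ => ⟨?_, ?_⟩
  · rintro ⟨q, hq⟩
    refine ⟨q.append p, fun y hy => ?_⟩
    rcases (SimpleGraph.Walk.mem_support_append_iff _ _).1 hy with h | h
    exacts [hq y h, hp y h]
  · rintro ⟨q, hq⟩
    refine ⟨q.append p.reverse, fun y hy => ?_⟩
    rcases (SimpleGraph.Walk.mem_support_append_iff _ _).1 hy with h | h
    exacts [hq y h, hp y (by simpa using h)]

theorem pathConvex_component (hT : T.IsTree) (A : Finset V) (v : V) :
    PathConvex T (component T A v) := by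
  classical
  intro x hx y hy w hw
  obtain ⟨-, p, hp⟩ := mem_component.1 hx
  obtain ⟨-, q, hq⟩ := mem_component.1 hy
  have hpq : ∀ z ∈ (p.append q.reverse).support, z ∈ A := fun z hz => by
    rcases (SimpleGraph.Walk.mem_support_append_iff _ _).1 hz with h | h
    exacts [hp z h, hq z (by simpa using h)]
  have hws := hw.mem_support hT (p.append q.reverse)
  refine mem_component.2 ⟨hpq w hws, (((p.append q.reverse).takeUntil w hws).reverse.append p),
    fun z hz => ?_⟩
  rcases (SimpleGraph.Walk.mem_support_append_iff _ _).1 hz with h | h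
  · exact hpq z ((p.append q.reverse).support_takeUntil_subset_support hws (by simpa using h))
  · exact hp z h

theorem isSubtree_component (hT : T.IsTree) {A : Finset V} {v : V} (hv : v ∈ A) :
    IsSubtree T (component T A v) :=
  (isSubtree_iff hT).2 ⟨⟨v, mem_component_self hv⟩, pathConvex_component hT A v⟩

theorem isSubtree_univ [Fintype V] (hT : T.IsTree) : IsSubtree T univ :=
  (isSubtree_iff hT).2 ⟨by have := hT.connected.nonempty; exact univ_nonempty,
    fun _ _ _ _ _ _ => mem_univ _⟩

theorem dist_adj_cases (hT : T.IsTree) {u r : V} (h : T.Adj u r) (x : V) :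
    T.dist x r = T.dist x u + 1 ∨ T.dist x u = T.dist x r + 1 := by
  rcases hT.dist_eq_dist_add_one_of_adj x h with h | h <;> omega

section Components

variable [DecidableEq V]

theorem isSubtree_of_mem_components (hT : T.IsTree) {A D : Finset V}
    (hD : D ∈ components T A) : IsSubtree T D := by
  obtain ⟨v, hv, rfl⟩ := mem_image.1 hD
  exact isSubtree_component hT hv

theorem subset_of_mem_components {A D : Finset V} (hD : D ∈ components T A) : D ⊆ A := by
  obtain ⟨v, hv, rfl⟩ := mem_image.1 hD
  exact component_subset A v

theorem component_eq_of_mem_components {A D : Finset V} (hD : D ∈ components T A) {u : V}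
    (hu : u ∈ D) : component T A u = D := by
  obtain ⟨v, hv, rfl⟩ := mem_image.1 hD
  exact component_eq_of_mem hu

/-- A sum over a set is the sum over its components of the sums over each component. -/
theorem sum_components {M : Type*} [AddCommMonoid M] (A : Finset V) (f : V → M) :
    ∑ D ∈ components T A, ∑ x ∈ D, f x = ∑ x ∈ A, f x := by
  classical
  rw [← sum_fiberwise_of_maps_to (s := A) (t := components T A) (g := component T A)
    (fun x hx => mem_image_of_mem _ hx) f]
  refine sum_congr rfl fun D hD => sum_congr ?_ fun _ _ => rfl
  ext x
  rw [mem_filter]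
  refine ⟨fun hx => ⟨subset_of_mem_components hD hx, component_eq_of_mem_components hD hx⟩, ?_⟩
  rintro ⟨hx, rfl⟩
  exact mem_component_self hx

theorem sum_card_components (A : Finset V) : ∑ D ∈ components T A, D.card = A.card := by
  simpa using sum_components (T := T) A (fun _ => (1 : ℕ))

/-- The component of `u` in the subtree `S` without `r`, in terms of distances: it consists of the
vertices `x` for which `r` is not between `u` and `x`. -/
theorem component_erase_eq (hT : T.IsTree) {S : Finset V} (hS : PathConvex T S) {r u : V}
    (hu : u ∈ S) :
    component T (S.erase r) u =
      S.filter fun x => ¬ T.dist u r + T.dist r x = T.dist u x := by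
  ext x
  rw [mem_component_iff_onPath hT, mem_filter, ← onPath_iff_dist hT]
  constructor
  · intro h
    refine ⟨mem_of_mem_erase (h x (onPath_left hT x u)), fun hr => ?_⟩
    exact notMem_erase r S (h r hr.symm)
  · rintro ⟨hx, hr⟩ y hy
    exact mem_erase.2 ⟨fun h => hr (h ▸ hy.symm), hS x hx u hu y hy⟩

theorem mem_component_erase (hT : T.IsTree) {S : Finset V} (hS : PathConvex T S) {r u x : V}
    (hu : u ∈ S) :
    x ∈ component T (S.erase r) u ↔ x ∈ S ∧ ¬ OnPath T u x r := by
  rw [component_erase_eq hT hS hu, mem_filter, onPath_iff_dist hT]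

/-- Every component of `S - r` contains a neighbour of `r`: the second vertex of the path from `r`
to a vertex of the component. -/
theorem exists_adj_mem_component_erase (hT : T.IsTree) {S : Finset V} (hS : PathConvex T S)
    {r v : V} (hr : r ∈ S) (hv : v ∈ S.erase r) :
    ∃ u ∈ component T (S.erase r) v, T.Adj u r := by
  have hvS := mem_of_mem_erase hv
  obtain ⟨p, hp, hpl⟩ := hT.connected.exists_path_of_dist r v
  cases p with
  | nil => simp at hv
  | @cons _ u _ h q =>
    refine ⟨u, (mem_component_erase hT hS hvS).2 ⟨?_, ?_⟩, h.symm⟩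
    · exact hS r hr v hvS u ⟨_, hp, by simp⟩
    · intro hc
      have h1 := hc.symm.mem_support hT q
      rw [SimpleGraph.Walk.cons_isPath_iff] at hp
      exact hp.2 h1

/-- For adjacent `u` and `r`, the side of `u` after the removal of `r` and the side of `r` after the
removal of `u` are complementary. -/
theorem mem_component_erase_adj (hT : T.IsTree) {S : Finset V} (hS : PathConvex T S) {r u x : V}
    (hu : u ∈ S) (h : T.Adj u r) :
    x ∈ component T (S.erase r) u ↔ x ∈ S ∧ T.dist x r = T.dist x u + 1 := by
  rw [component_erase_eq hT hS hu, mem_filter]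
  refine and_congr_right fun _ => ?_
  have h1 := dist_adj_cases hT h x
  have h2 : T.dist u r = 1 := SimpleGraph.dist_eq_one_iff_adj.2 h
  rw [T.dist_comm (u := r), T.dist_comm (u := u) (v := x), h2]
  omega

/-- The components of `S - r` correspond to the neighbours of `r` in `S`. -/
theorem sum_components_erase (hT : T.IsTree) {S : Finset V} (hS : PathConvex T S) {r : V}
    (hr : r ∈ S) [DecidablePred (T.Adj r)] {M : Type*} [AddCommMonoid M] (f : Finset V → M) :
    ∑ D ∈ components T (S.erase r), f D =
      ∑ u ∈ S.filter (T.Adj r), f (component T (S.erase r) u) := by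
  symm
  refine sum_bij (fun u _ => component T (S.erase r) u) ?_ ?_ ?_ (fun _ _ => rfl)
  · intro u hu
    obtain ⟨hu, ha⟩ := mem_filter.1 hu
    exact mem_image_of_mem _ (mem_erase.2 ⟨ha.ne', hu⟩)
  · intro u hu v hv h
    obtain ⟨hu, hau⟩ := mem_filter.1 hu
    obtain ⟨hv, hav⟩ := mem_filter.1 hv
    have : v ∈ component T (S.erase r) u := by
      rw [h]; exact mem_component_self (mem_erase.2 ⟨hav.ne', hv⟩)
    have h2 := ((mem_component_erase_adj hT hS hu hau.symm).1 this).2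
    have h3 : T.dist v r = 1 := SimpleGraph.dist_eq_one_iff_adj.2 hav.symm
    have h4 : T.dist v u = 0 := by omega
    exact ((hT.connected v u).dist_eq_zero_iff.1 h4).symm
  · intro D hD
    obtain ⟨v, hv, rfl⟩ := mem_image.1 hD
    obtain ⟨u, hu, ha⟩ := exists_adj_mem_component_erase hT hS hr hv
    exact ⟨u, mem_filter.2 ⟨mem_of_mem_erase (component_subset _ _ hu), ha.symm⟩,
      component_eq_of_mem hu⟩

/-- If a property of vertex sets never holds for two disjoint sets, some vertex `r` of a subtree
leaves no component with the property: following the components with the property from vertex to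
vertex, one would have to turn back over an edge, and the two sides of an edge are disjoint. It
provides both centroids and the topmost vertex of an optimal labeling. -/
theorem exists_forall_components_not (hT : T.IsTree) {S : Finset V} (hS : IsSubtree T S)
    (Bad : Finset V → Prop) (hBad : ∀ D ⊆ S, ∀ D' ⊆ S, Bad D → Bad D' → ¬ Disjoint D D') :
    ∃ r ∈ S, ∀ D ∈ components T (S.erase r), ¬ Bad D := by
  by_contra! hcon
  obtain ⟨⟨r₀, hr₀⟩, hS⟩ := (isSubtree_iff hT).1 hS
  obtain ⟨D₀, hD₀, hB₀⟩ := hcon r₀ hr₀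
  -- Among all removed vertices, take a bad component of least cardinality.
  have hex : ∃ m, ∃ r ∈ S, ∃ D ∈ components T (S.erase r), Bad D ∧ D.card = m :=
    ⟨_, r₀, hr₀, D₀, hD₀, hB₀, rfl⟩
  classical
  obtain ⟨r, hr, D, hD, hB, hm⟩ := Nat.find_spec hex
  have hmin : ∀ r' ∈ S, ∀ D' ∈ components T (S.erase r'), Bad D' → D.card ≤ D'.card :=
    fun r' hr' D' hD' hB' => hm ▸ Nat.find_min' hex ⟨r', hr', D', hD', hB', rfl⟩
  obtain ⟨v, hv, rfl⟩ := mem_image.1 hD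
  obtain ⟨u, hu, hadj⟩ := exists_adj_mem_component_erase hT hS hr hv
  rw [← component_eq_of_mem hu] at hB hmin hu
  have huS := mem_of_mem_erase (component_subset _ _ hu)
  obtain ⟨D', hD', hB'⟩ := hcon u huS
  have hD'S : D' ⊆ S := (subset_of_mem_components hD').trans (erase_subset _ _)
  have hDS : component T (S.erase r) u ⊆ S := (component_subset _ _).trans (erase_subset _ _)
  by_cases hrD : r ∈ D'
  · rw [← component_eq_of_mem_components hD' hrD] at hB' hD'S
    refine hBad _ hDS _ hD'S hB hB' (disjoint_left.2 fun x hx hx' => ?_)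
    have h1 := ((mem_component_erase_adj hT hS huS hadj).1 hx).2
    have h2 := ((mem_component_erase_adj hT hS hr hadj.symm).1 hx').2
    omega
  · refine (hmin u huS D' hD' hB').not_gt (card_lt_card ?_)
    refine Finset.ssubset_iff_subset_ne.2 ⟨fun x hx => ?_, fun h => ?_⟩
    · have hxS := hD'S hx
      refine (mem_component_erase_adj hT hS huS hadj).2 ⟨hxS, ?_⟩
      rw [← component_eq_of_mem_components hD' hx, mem_component_erase hT hS hxS,
        onPath_iff_dist hT] at hrD
      have h2 : T.dist u r = 1 := SimpleGraph.dist_eq_one_iff_adj.2 hadj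
      have h3 : T.dist x u + T.dist u r = T.dist x r := not_not.1 fun h => hrD ⟨hr, h⟩
      omega
    · have := subset_of_mem_components hD' (h ▸ hu)
      exact notMem_erase _ _ this

/-- Every subtree with vertex weights has a balanced separator vertex. -/
theorem exists_isBalancedSeparator (hT : T.IsTree) {S : Finset V} (hS : IsSubtree T S)
    (w : V → ℕ) : ∃ r, IsBalancedSeparator T S w r := by
  obtain ⟨r, hr, h⟩ := exists_forall_components_not hT hS
    (fun D => ∑ u ∈ S, w u < 2 * ∑ u ∈ D, w u) fun D hD D' hD' h h' hdis => by
      have h1 := sum_le_sum_of_subset (f := w) (union_subset hD hD')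
      rw [sum_union hdis] at h1
      omega
  exact ⟨r, hr, fun D hD => not_lt.1 (h D hD)⟩

end Components

end TreeGeometry

section Guarantee

variable {V : Type u} {T : SimpleGraph V}

/-! ### Boundaries -/

theorem mem_component_of_adj {A : Finset V} {w u v : V} (hu : u ∈ component T A w)
    (h : T.Adj u v) (hv : v ∈ A) : v ∈ component T A w := by
  obtain ⟨_, p, hp⟩ := mem_component.1 hu
  refine mem_component.2 ⟨hv, .cons h.symm p, fun x hx => ?_⟩
  rw [SimpleGraph.Walk.support_cons, List.mem_cons] at hx
  rcases hx with rfl | hx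
  exacts [hv, hp x hx]

theorem mem_boundary [Fintype V] {S : Finset V} {v : V} :
    v ∈ boundary T S ↔ v ∉ S ∧ ∃ u ∈ S, T.Adj u v := by
  simp [boundary]

/-- A vertex outside a subtree has at most one neighbour in it. -/
theorem eq_of_adj_of_notMem (hT : T.IsTree) {S : Finset V} (hS : PathConvex T S) {u u' v : V}
    (hv : v ∉ S) (hu : u ∈ S) (hu' : u' ∈ S) (h : T.Adj u v) (h' : T.Adj u' v) : u = u' := by
  have h1 : T.dist u v = 1 := SimpleGraph.dist_eq_one_iff_adj.2 h
  have h2 : T.dist v u' = 1 := SimpleGraph.dist_eq_one_iff_adj.2 h'.symm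
  rcases dist_adj_cases hT h' u with h3 | h3
  · exact (hT.connected u u').dist_eq_zero_iff.1 (by omega)
  · exact absurd (hS u hu u' hu' v ((onPath_iff_dist hT).2 (by omega))) hv

theorem sum_boundaryWeight [Fintype V] (hT : T.IsTree) {S : Finset V} (hS : PathConvex T S) :
    ∑ u ∈ S, boundaryWeight T S u = (boundary T S).card := by
  classical
  have h1 : ∀ u, boundaryWeight T S u = ∑ v ∈ boundary T S, if T.Adj u v then 1 else 0 := by
    intro u
    rw [boundaryWeight, card_filter]
  simp_rw [h1]
  rw [sum_comm, card_eq_sum_ones]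
  refine sum_congr rfl fun v hv => ?_
  obtain ⟨hvS, u, hu, ha⟩ := mem_boundary.1 hv
  rw [← card_filter, card_eq_one]
  refine ⟨u, ?_⟩
  ext u'
  rw [mem_filter, mem_singleton]
  constructor
  · rintro ⟨hu', ha'⟩
    exact eq_of_adj_of_notMem hT hS hvS hu' hu ha' ha
  · rintro rfl
    exact ⟨hu, ha⟩

theorem eq_univ_of_boundary_eq_empty [Fintype V] (hT : T.IsTree) {S : Finset V}
    (hne : S.Nonempty) (h : boundary T S = ∅) : S = univ := by
  obtain ⟨u, hu⟩ := hne
  refine eq_univ_of_forall fun v => ?_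
  obtain ⟨p⟩ := hT.connected u v
  clear hT
  induction p with
  | nil => exact hu
  | @cons a b c hab p ih =>
    refine ih ?_
    by_contra hb
    have : b ∈ boundary T S := mem_boundary.2 ⟨hb, a, hu, hab⟩
    simp [h] at this

theorem boundary_univ [Fintype V] : boundary T univ = ∅ := by
  ext v
  simp [mem_boundary]

/-! ### Elementary properties of hub labelings -/

theorem optCost_le {S : Finset V} {H : V → Finset V} (h : IsHubLabeling T S H) :
    optCost T S ≤ labelCost S H :=
  Nat.sInf_le ⟨H, h, rfl⟩

theorem IsHubLabeling.self_mem (hT : T.IsTree) {S : Finset V} {H : V → Finset V}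
    (h : IsHubLabeling T S H) {u : V} (hu : u ∈ S) : u ∈ H u := by
  obtain ⟨w, h1, -, h3⟩ := h.2 u hu u hu
  rw [onPath_iff_dist hT, SimpleGraph.dist_self] at h3
  have hw : u = w := (hT.connected u w).dist_eq_zero_iff.1 (by omega)
  exact hw ▸ h1

theorem card_le_optCost (hT : T.IsTree) (S : Finset V) : S.card ≤ optCost T S := by
  obtain ⟨H, hH, hc⟩ := exists_isHubLabeling T hT S
  rw [← hc, labelCost, card_eq_sum_ones]
  exact sum_le_sum fun u hu => card_pos.2 ⟨u, hH.self_mem hT hu⟩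

section Split

/-! ### Boundaries of components -/

variable [DecidableEq V]

theorem boundary_subset_of_mem_components [Fintype V] {S D : Finset V} {r : V}
    (hD : D ∈ components T (S.erase r)) : boundary T D ⊆ insert r (boundary T S) := by
  intro v hv
  obtain ⟨hvD, u, hu, ha⟩ := mem_boundary.1 hv
  rw [mem_insert, or_iff_not_imp_left]
  intro hvr
  refine mem_boundary.2
    ⟨fun hvS => hvD ?_, u, mem_of_mem_erase (subset_of_mem_components hD hu), ha⟩
  have hc := component_eq_of_mem_components hD hu
  rw [← hc] at hu ⊢
  exact mem_component_of_adj hu ha (mem_erase.2 ⟨hvr, hvS⟩)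

theorem card_boundary_le_succ [Fintype V] {S D : Finset V} {r : V}
    (hD : D ∈ components T (S.erase r)) :
    (boundary T D).card ≤ (boundary T S).card + 1 :=
  (card_le_card (boundary_subset_of_mem_components hD)).trans (card_insert_le _ _)

theorem card_boundary_le_weight [Fintype V] {S D : Finset V} {r : V}
    (hD : D ∈ components T (S.erase r)) :
    (boundary T D).card ≤ ∑ u ∈ D, boundaryWeight T S u + 1 := by
  classical
  have hsub : boundary T D ⊆
      insert r (D.biUnion fun u => (boundary T S).filter fun v => T.Adj u v) := by
    intro v hv
    have h1 := boundary_subset_of_mem_components hD hv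
    obtain ⟨hvD, u, hu, ha⟩ := mem_boundary.1 hv
    rcases mem_insert.1 h1 with h1 | h1
    · exact mem_insert.2 (.inl h1)
    · exact mem_insert_of_mem (mem_biUnion.2 ⟨u, hu, mem_filter.2 ⟨h1, ha⟩⟩)
  refine (card_le_card hsub).trans ((card_insert_le _ _).trans ?_)
  refine Nat.add_le_add_right (card_biUnion_le.trans (sum_le_sum fun u _ => ?_)) 1
  rw [boundaryWeight]

/-- Halving the boundary weight of a subtree with `k = 4t` boundary vertices leaves components
with at most `2t + 1 ≤ 3t` boundary vertices. -/
theorem card_boundary_le_of_balanced [Fintype V] (hT : T.IsTree) {S D : Finset V} {r : V}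
    (hS : PathConvex T S) (hr : IsBalancedSeparator T S (boundaryWeight T S) r)
    (hD : D ∈ components T (S.erase r)) :
    2 * (boundary T D).card ≤ (boundary T S).card + 2 := by
  have h1 := hr.2 D hD
  have h2 := card_boundary_le_weight hD
  rw [sum_boundaryWeight hT hS] at h1
  omega

/-! ### The labeling of an elimination order -/

variable {root : Finset V → V}

theorem dpLabeling_of_mem {S : Finset V} (hr : root S ∈ S) {u : V} (hu : u ∈ S) :
    dpLabeling T root S u = insert (root S)
      (if u = root S then ∅ else dpLabeling T root (component T (S.erase (root S)) u) u) := by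
  rw [dpLabeling, dif_pos ⟨hr, hu⟩]

theorem dpLabeling_of_notMem {S : Finset V} {u : V} (hu : u ∉ S) :
    dpLabeling T root S u = ∅ := by
  rw [dpLabeling, dif_neg fun h => hu h.2]

theorem dpLabeling_root {S : Finset V} (hr : root S ∈ S) :
    dpLabeling T root S (root S) = {root S} := by
  rw [dpLabeling_of_mem hr hr, if_pos rfl]
  rfl

theorem dpLabeling_of_mem_components {S D : Finset V} (hr : root S ∈ S)
    (hD : D ∈ components T (S.erase (root S))) {u : V} (hu : u ∈ D) :
    dpLabeling T root S u = insert (root S) (dpLabeling T root D u) := by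
  have h1 := subset_of_mem_components hD hu
  rw [dpLabeling_of_mem hr (mem_of_mem_erase h1), if_neg (ne_of_mem_erase h1),
    component_eq_of_mem_components hD hu]

theorem isHubLabeling_dpLabeling (hT : T.IsTree) (hroot : ∀ S, IsSubtree T S → root S ∈ S)
    {S : Finset V} (hS : IsSubtree T S) : IsHubLabeling T S (dpLabeling T root S) := by
  induction hm : S.card using Nat.strong_induction_on generalizing S with
  | _ m ih =>
    subst hm
    have hr := hroot S hS
    have hc := ((isSubtree_iff hT).1 hS).2
    have key : ∀ D ∈ components T (S.erase (root S)),
        IsHubLabeling T D (dpLabeling T root D) := fun D hD =>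
      ih _ (card_lt_of_mem_components T hr hD) (isSubtree_of_mem_components hT hD) rfl
    have hcases : ∀ u ∈ S, u = root S ∨ ∃ D ∈ components T (S.erase (root S)), u ∈ D := by
      intro u hu
      rw [or_iff_not_imp_left]
      intro hne
      have hu' : u ∈ S.erase (root S) := mem_erase.2 ⟨hne, hu⟩
      exact ⟨_, mem_image_of_mem _ hu', mem_component_self hu'⟩
    have hmem : ∀ u ∈ S, root S ∈ dpLabeling T root S u := fun u hu => by
      rw [dpLabeling_of_mem hr hu]; exact mem_insert_self _ _
    refine ⟨fun u hu => ?_, fun u hu v hv => ?_⟩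
    · rcases hcases u hu with rfl | ⟨D, hD, huD⟩
      · rw [dpLabeling_root hr]; exact singleton_subset_iff.2 hr
      · rw [dpLabeling_of_mem_components hr hD huD]
        exact insert_subset hr (((key D hD).1 u huD).trans
          ((subset_of_mem_components hD).trans (erase_subset _ _)))
    · by_cases hp : OnPath T u v (root S)
      · exact ⟨root S, hmem u hu, hmem v hv, hp⟩
      · rcases hcases u hu with rfl | ⟨D, hD, huD⟩
        · exact absurd (onPath_left hT _ v) hp
        · have hvD : v ∈ D := by
            rw [← component_eq_of_mem_components hD huD]
            exact (mem_component_erase hT hc hu).2 ⟨hv, hp⟩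
          obtain ⟨w, h1, h2, h3⟩ := (key D hD).2 u huD v hvD
          rw [dpLabeling_of_mem_components hr hD huD, dpLabeling_of_mem_components hr hD hvD]
          exact ⟨w, mem_insert_of_mem h1, mem_insert_of_mem h2, h3⟩

theorem sum_erase_components {M : Type*} [AddCommMonoid M] {S : Finset V} {r : V} (hr : r ∈ S)
    (f : V → M) :
    f r + ∑ D ∈ components T (S.erase r), ∑ u ∈ D, f u = ∑ u ∈ S, f u := by
  rw [sum_components, add_sum_erase S f hr]

/-- The cost recursion: the removed vertex is charged once to every vertex of the subtree. -/
theorem labelCost_dpLabeling (hT : T.IsTree) (hroot : ∀ S, IsSubtree T S → root S ∈ S)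
    {S : Finset V} (hS : IsSubtree T S) :
    labelCost S (dpLabeling T root S) =
      S.card + ∑ D ∈ components T (S.erase (root S)), labelCost D (dpLabeling T root D) := by
  have hr := hroot S hS
  have h1 : ∀ D ∈ components T (S.erase (root S)),
      ∑ u ∈ D, (dpLabeling T root S u).card = D.card + labelCost D (dpLabeling T root D) := by
    intro D hD
    rw [labelCost, card_eq_sum_ones, ← sum_add_distrib]
    refine sum_congr rfl fun u hu => ?_
    rw [dpLabeling_of_mem_components hr hD hu, card_insert_of_notMem, add_comm]
    intro hmem
    have h2 := (isHubLabeling_dpLabeling hT hroot (isSubtree_of_mem_components hT hD)).1 u hu hmem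
    exact notMem_erase _ _ (subset_of_mem_components hD h2)
  rw [labelCost, ← sum_erase_components (T := T) hr, sum_congr rfl h1, sum_add_distrib,
    sum_card_components, dpLabeling_root hr, card_singleton, ← add_assoc]
  have := card_erase_add_one hr
  omega

/-! ### Lower bounds for the optimum -/

theorem IsHubLabeling.restrict {S D : Finset V} {H : V → Finset V}
    (h : IsHubLabeling T S H) (hDS : D ⊆ S) (hD : PathConvex T D) :
    IsHubLabeling T D fun u => H u ∩ D := by
  refine ⟨fun u _ => inter_subset_right, fun u hu v hv => ?_⟩
  obtain ⟨w, h1, h2, h3⟩ := h.2 u (hDS hu) v (hDS hv)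
  have := hD u hu v hv w h3
  exact ⟨w, mem_inter.2 ⟨h1, this⟩, mem_inter.2 ⟨h2, this⟩, h3⟩

theorem sum_optCost_le (hT : T.IsTree) {S : Finset V} {r : V} :
    ∑ D ∈ components T (S.erase r), optCost T D ≤ optCost T S := by
  obtain ⟨H, hH, hc⟩ := exists_isHubLabeling T hT S
  calc ∑ D ∈ components T (S.erase r), optCost T D
      ≤ ∑ D ∈ components T (S.erase r), ∑ u ∈ D, (H u ∩ D).card :=
        sum_le_sum fun D hD => optCost_le <|
          hH.restrict ((subset_of_mem_components hD).trans (erase_subset _ _))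
            ((isSubtree_iff hT).1 (isSubtree_of_mem_components hT hD)).2
    _ ≤ ∑ D ∈ components T (S.erase r), ∑ u ∈ D, (H u).card :=
        sum_le_sum fun D _ => sum_le_sum fun u _ => card_le_card inter_subset_left
    _ = ∑ u ∈ S.erase r, (H u).card := sum_components _ _
    _ ≤ ∑ u ∈ S, (H u).card := sum_le_sum_of_subset (erase_subset _ _)
    _ = optCost T S := hc

/-- An optimal labeling admits a topmost vertex `r`: every vertex `u ≠ r` has a hub outside its
component of `S - r`. Otherwise two disjoint components would contain all hubs of some vertex
each, and these two vertices would have no common hub. Charging that hub to `r` gives the lower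
bound by which the recurrence is compared with the optimum. -/
theorem exists_card_add_sum_optCost_le (hT : T.IsTree) {S : Finset V} (hS : IsSubtree T S) :
    ∃ r ∈ S, S.card + ∑ D ∈ components T (S.erase r), optCost T D ≤ optCost T S := by
  obtain ⟨H, hH, hc⟩ := exists_isHubLabeling T hT S
  obtain ⟨r, hr, h⟩ := exists_forall_components_not hT hS (fun D => ∃ u ∈ D, H u ⊆ D) <| by
    rintro D hD D' hD' ⟨u, hu, huD⟩ ⟨v, hv, hvD⟩ hdis
    obtain ⟨w, h1, h2, -⟩ := hH.2 u (hD hu) v (hD' hv)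
    exact disjoint_left.1 hdis (huD h1) (hvD h2)
  refine ⟨r, hr, ?_⟩
  have h1 : ∀ D ∈ components T (S.erase r), D.card + optCost T D ≤ ∑ u ∈ D, (H u).card := by
    intro D hD
    have h2 : optCost T D ≤ ∑ u ∈ D, (H u ∩ D).card := optCost_le <|
      hH.restrict ((subset_of_mem_components hD).trans (erase_subset _ _))
        ((isSubtree_iff hT).1 (isSubtree_of_mem_components hT hD)).2
    refine (Nat.add_le_add_left h2 _).trans ?_
    rw [card_eq_sum_ones, ← sum_add_distrib]
    refine sum_le_sum fun u hu => ?_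
    have h3 : H u ∩ D ⊂ H u :=
      Finset.ssubset_iff_subset_ne.2 ⟨inter_subset_left, fun he =>
        h D hD ⟨u, hu, inter_eq_left.1 he⟩⟩
    have := card_lt_card h3
    omega
  have h2 := sum_le_sum h1
  rw [sum_add_distrib, sum_card_components] at h2
  rw [← hc, labelCost, ← sum_erase_components (T := T) hr]
  have h3 := card_pos.2 ⟨r, hH.self_mem hT hr⟩
  have h4 := card_erase_add_one hr
  omega

theorem three_le_optCost (hT : T.IsTree) {S : Finset V} (h : S.card = 2) :
    3 ≤ optCost T S := by
  obtain ⟨a, b, hab, rfl⟩ := card_eq_two.1 h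
  obtain ⟨H, hH, hc⟩ := exists_isHubLabeling T hT {a, b}
  have ha := hH.self_mem hT (u := a) (by simp)
  have hb := hH.self_mem hT (u := b) (by simp)
  obtain ⟨w, h1, h2, -⟩ := hH.2 a (by simp) b (by simp)
  rw [← hc, labelCost, sum_pair hab]
  have h3 : 1 ≤ (H a).card := card_pos.2 ⟨_, ha⟩
  have h4 : 1 ≤ (H b).card := card_pos.2 ⟨_, hb⟩
  by_cases hwa : w = a
  · have : 1 < (H b).card := one_lt_card.2 ⟨w, h2, b, hb, by rw [hwa]; exact hab⟩
    omega
  · have : 1 < (H a).card := one_lt_card.2 ⟨w, h1, a, ha, hwa⟩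
    omega

/-! ### The guarantee of the dynamic program -/

variable [Fintype V] {k : ℕ}

theorem tableB_of_card_eq_one {S : Finset V} (h : S.card = 1) : tableB T k root S = 1 := by
  rw [tableB, if_pos h]

theorem tableB_of_card_eq_two {S : Finset V} (h : S.card = 2) : tableB T k root S = 3 := by
  rw [tableB, if_neg (by omega), if_pos h]

theorem tableB_eq_splitB_root (hrun : IsDPRun T k root) {S : Finset V} (hS : IsSubtree T S)
    (h3 : 3 ≤ S.card) (hb : (boundary T S).card < k) :
    tableB T k root S = (1 + 4 / (k : ℝ)) * S.card + splitB T k root S (root S) := by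
  obtain ⟨hr, h⟩ := hrun S hS
  rw [tableB_of_lt T k root S ⟨_, hr⟩ h3 hb]
  congr 1
  exact le_antisymm (inf'_le _ hr) (le_inf' _ _ ((h h3).1 hb))

theorem tableB_le (hT : T.IsTree) (hk : 2 ≤ k) (hrun : IsDPRun T k root) {S : Finset V}
    (hS : IsSubtree T S) (hb : (boundary T S).card ≤ k) :
    tableB T k root S ≤ (1 + 4 / (k : ℝ)) * optCost T S := by
  induction hm : S.card using Nat.strong_induction_on generalizing S with
  | _ m ih =>
    subst hm
    obtain ⟨hr, h⟩ := hrun S hS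
    have hone : (1 : ℝ) ≤ 1 + 4 / (k : ℝ) := by
      have : (0 : ℝ) ≤ 4 / (k : ℝ) := by positivity
      linarith
    have hpos : 0 < S.card := card_pos.2 ⟨_, hr⟩
    have hle : ∀ r ∈ S, (∀ D ∈ components T (S.erase r), (boundary T D).card ≤ k) →
        splitB T k root S r ≤
          (1 + 4 / (k : ℝ)) * ((∑ D ∈ components T (S.erase r), optCost T D : ℕ) : ℝ) := by
      intro r hr hD
      rw [splitB, Nat.cast_sum, mul_sum]
      exact sum_le_sum fun D hD' => ih _ (card_lt_of_mem_components T hr hD')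
        (isSubtree_of_mem_components hT hD') (hD D hD') rfl
    rcases (by omega : S.card = 1 ∨ S.card = 2 ∨ 3 ≤ S.card) with h1 | h2 | h3
    · rw [tableB_of_card_eq_one h1]
      have h4 : (1 : ℝ) ≤ optCost T S := by
        exact_mod_cast h1 ▸ card_le_optCost hT S
      nlinarith
    · rw [tableB_of_card_eq_two h2]
      have h4 : (3 : ℝ) ≤ optCost T S := by exact_mod_cast three_le_optCost hT h2
      nlinarith
    · rcases hb.lt_or_eq with hlt | heq
      · obtain ⟨r, hrS, hopt⟩ := exists_card_add_sum_optCost_le hT hS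
        rw [tableB_eq_splitB_root hrun hS h3 hlt]
        have h5 := (h h3).1 hlt r hrS
        have h6 := hle r hrS fun D hD => (card_boundary_le_succ hD).trans hlt
        have h7 : (S.card : ℝ) + ((∑ D ∈ components T (S.erase r), optCost T D : ℕ) : ℝ) ≤
            optCost T S := by exact_mod_cast hopt
        nlinarith
      · rw [tableB_of_eq T k root S hr h3 heq]
        refine (hle _ hr fun D hD => ?_).trans ?_
        · have := card_boundary_le_of_balanced hT ((isSubtree_iff hT).1 hS).2
            ((h h3).2 heq) hD
          omega
        · have : ((∑ D ∈ components T (S.erase (root S)), optCost T D : ℕ) : ℝ) ≤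
            optCost T S := by exact_mod_cast sum_optCost_le hT
          nlinarith

theorem labelCost_le (hT : T.IsTree) {t : ℕ} (ht : 1 ≤ t) (hkt : k = 4 * t)
    (hrun : IsDPRun T k root) {S : Finset V}
    (hS : IsSubtree T S) (hb : (boundary T S).card ≤ k) :
    (labelCost S (dpLabeling T root S) : ℝ) ≤ tableB T k root S + budgetC T k S := by
  have hroot : ∀ S, IsSubtree T S → root S ∈ S := fun S hS => (hrun S hS).1
  have hk0 : (0 : ℝ) < k := by exact_mod_cast (by omega : 0 < k)
  have hkt' : (k : ℝ) = 4 * t := by exact_mod_cast hkt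
  have ht' : (1 : ℝ) ≤ t := by exact_mod_cast ht
  induction hm : S.card using Nat.strong_induction_on generalizing S with
  | _ m ih =>
    subst hm
    obtain ⟨hr, h⟩ := hrun S hS
    have hpos : 0 < S.card := card_pos.2 ⟨_, hr⟩
    have hsum : (∑ D ∈ components T (S.erase (root S)), D.card) + 1 = S.card := by
      rw [sum_card_components, card_erase_add_one hr]
    -- Single vertices are treated without the induction hypothesis: as components of a two-vertex
    -- subtree, they may have more than `k` boundary vertices.
    have hsmall : ∀ D, IsSubtree T D → D.card = 1 → labelCost D (dpLabeling T root D) = 1 := by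
      intro D hD h1
      obtain ⟨x, rfl⟩ := card_eq_one.1 h1
      have hx : root {x} = x := mem_singleton.1 (hroot _ hD)
      have h2 := dpLabeling_root (T := T) (hroot _ hD)
      rw [hx] at h2
      rw [labelCost, sum_singleton, h2, card_singleton]
    rw [labelCost_dpLabeling hT hroot hS]
    have hle : (∀ D ∈ components T (S.erase (root S)), (boundary T D).card ≤ k) →
        ((∑ D ∈ components T (S.erase (root S)), labelCost D (dpLabeling T root D) : ℕ) : ℝ) ≤
          splitB T k root S (root S) +
            ∑ D ∈ components T (S.erase (root S)), budgetC T k D := by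
      intro hD
      rw [splitB, Nat.cast_sum, ← sum_add_distrib]
      exact sum_le_sum fun D hD' => ih _ (card_lt_of_mem_components T hr hD')
        (isSubtree_of_mem_components hT hD') (hD D hD') rfl
    have hC : 0 ≤ budgetC T k S := le_max_left _ _
    have hsumR : ((∑ D ∈ components T (S.erase (root S)), (D.card : ℝ))) + 1 = S.card := by
      exact_mod_cast hsum
    push_cast
    rcases (by omega : S.card = 1 ∨ S.card = 2 ∨ 3 ≤ S.card) with h1 | h2 | h3
    · rw [tableB_of_card_eq_one h1]
      have h4 := hsmall S hS h1
      rw [labelCost_dpLabeling hT hroot hS] at h4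
      have h5 : ((S.card : ℝ) + ∑ D ∈ components T (S.erase (root S)),
        (labelCost D (dpLabeling T root D) : ℝ)) = 1 := by exact_mod_cast h4
      linarith
    · rw [tableB_of_card_eq_two h2]
      have h4 : ∑ D ∈ components T (S.erase (root S)), labelCost D (dpLabeling T root D) =
          ∑ D ∈ components T (S.erase (root S)), D.card := by
        refine sum_congr rfl fun D hD => ?_
        have h5 := card_lt_of_mem_components T hr hD
        have h6 := isSubtree_of_mem_components hT hD
        have h7 : 0 < D.card := card_pos.2 ((isSubtree_iff hT).1 h6).1
        rw [hsmall D h6 (by omega)]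
        omega
      have h5 : ∑ D ∈ components T (S.erase (root S)),
          (labelCost D (dpLabeling T root D) : ℝ) =
          ∑ D ∈ components T (S.erase (root S)), (D.card : ℝ) := by exact_mod_cast h4
      rw [h5]
      have h6 : (S.card : ℝ) = 2 := by exact_mod_cast h2
      linarith
    · rcases hb.lt_or_eq with hlt | heq
      · rw [tableB_eq_splitB_root hrun hS h3 hlt]
        have h5 := hle fun D hD => (card_boundary_le_succ hD).trans hlt
        push_cast at h5
        -- The budget per vertex of a component exceeds that of `S` by at most `4 / k`.
        set g : ℝ := max 0 (((boundary T S).card : ℝ) - 3 * k / 4) with hg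
        have hg0 : 0 ≤ g := le_max_left _ _
        have hCS : budgetC T k S = g * (4 * S.card / k) := by
          rw [budgetC, hg, max_mul_of_nonneg _ _ (by positivity), zero_mul]
        have hCD : ∀ D ∈ components T (S.erase (root S)),
            budgetC T k D ≤ (g + 1) * (4 / k) * D.card := by
          intro D hD
          have h8 : ((boundary T D).card : ℝ) ≤ (boundary T S).card + 1 := by
            exact_mod_cast card_boundary_le_succ hD
          have h9 : ((boundary T S).card : ℝ) - 3 * k / 4 ≤ g := le_max_right _ _
          have h10 : (g + 1) * (4 / (k : ℝ)) * D.card = (g + 1) * (4 * D.card / k) := by ring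
          rw [budgetC, h10]
          refine max_le (by positivity) (mul_le_mul_of_nonneg_right (by linarith) (by positivity))
        have h6 := sum_le_sum hCD
        rw [← mul_sum] at h6
        have h7 : (g + 1) * (4 / (k : ℝ)) *
            ∑ D ∈ components T (S.erase (root S)), (D.card : ℝ) ≤
            (g + 1) * (4 / (k : ℝ)) * S.card :=
          mul_le_mul_of_nonneg_left (by linarith) (by positivity)
        have h8 : (g + 1) * (4 / (k : ℝ)) * S.card =
          g * (4 * S.card / k) + 4 / (k : ℝ) * S.card := by ring
        rw [hCS]
        linarith
      · rw [tableB_of_eq T k root S hr h3 heq]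
        have hbal : ∀ D ∈ components T (S.erase (root S)), (boundary T D).card ≤ 3 * t := by
          intro D hD
          have := card_boundary_le_of_balanced hT ((isSubtree_iff hT).1 hS).2
            ((h h3).2 heq) hD
          omega
        have h5 := hle fun D hD => (hbal D hD).trans (by omega)
        push_cast at h5
        have h6 : ∑ D ∈ components T (S.erase (root S)), budgetC T k D = 0 := by
          refine sum_eq_zero fun D hD => max_eq_left ?_
          have : ((boundary T D).card : ℝ) ≤ 3 * t := by exact_mod_cast hbal D hD
          exact mul_nonpos_of_nonpos_of_nonneg (by linarith) (by positivity)
        have h7 : (S.card : ℝ) ≤ budgetC T k S := by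
          refine le_max_of_le_right (le_of_eq ?_)
          rw [heq]
          field_simp
          ring
        linarith

theorem dp_guarantee_univ (hT : T.IsTree) {t : ℕ} (ht : 1 ≤ t) (hkt : k = 4 * t)
    (hrun : IsDPRun T k root) :
    IsHubLabeling T univ (dpLabeling T root univ) ∧
      (labelCost univ (dpLabeling T root univ) : ℝ) ≤
        (1 + 4 / (k : ℝ)) * (optCost T univ : ℝ) := by
  have hS := isSubtree_univ hT
  refine ⟨isHubLabeling_dpLabeling hT (fun S hS => (hrun S hS).1) hS, ?_⟩
  have hb : (boundary T (univ : Finset V)).card ≤ k := by simp [boundary_univ]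
  have h1 := labelCost_le hT ht hkt hrun hS hb
  have h2 := tableB_le hT (by omega) hrun hS hb
  have h3 : budgetC T k univ = 0 := by
    refine max_eq_left (mul_nonpos_of_nonpos_of_nonneg ?_ (by positivity))
    rw [boundary_univ, card_empty]
    have : (0 : ℝ) ≤ k := by positivity
    push_cast
    linarith
  linarith

end Split

end Guarantee

/-! ### Execution and running time of machine programs -/

namespace Store

/-- The memory after writing `v` to register `x`. -/
def setReg (σ : Store) (x v : ℕ) : Store := { σ with reg := Function.update σ.reg x v }

/-- The memory after writing `v` to entry `i` of the array `a`. -/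
def setArr (σ : Store) (a i v : ℕ) : Store :=
  { σ with arr := Function.update σ.arr a (Function.update (σ.arr a) i v) }

@[simp]
theorem setReg_reg (σ : Store) (x v y : ℕ) :
    (σ.setReg x v).reg y = if y = x then v else σ.reg y := by
  simp [setReg, Function.update_apply]

@[simp]
theorem setReg_arr (σ : Store) (x v : ℕ) : (σ.setReg x v).arr = σ.arr := rfl

@[simp]
theorem setArr_reg (σ : Store) (a i v : ℕ) : (σ.setArr a i v).reg = σ.reg := rfl

@[simp]
theorem setArr_arr (σ : Store) (a i v b j : ℕ) :
    (σ.setArr a i v).arr b j = if b = a ∧ j = i then v else σ.arr b j := by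
  by_cases h : b = a
  · subst h
    simp [setArr, Function.update_apply]
  · simp [setArr, h]

theorem setReg_setReg_of_ne (σ : Store) {x y : ℕ} (h : x ≠ y) (v w : ℕ) :
    (σ.setReg x v).setReg y w = (σ.setReg y w).setReg x v := by
  simp only [setReg, Function.update_comm h]

theorem setReg_setReg_same (σ : Store) (x v w : ℕ) :
    (σ.setReg x v).setReg x w = σ.setReg x w := by
  simp only [setReg, Function.update_idem]

theorem setReg_self (σ : Store) (x : ℕ) : σ.setReg x (σ.reg x) = σ := by
  simp only [setReg, Function.update_eq_self]

end Store

namespace Expr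

/-- The expression does not read register `x`. -/
def ignores (x : ℕ) : Expr → Bool
  | lit _ => true
  | reg y => y != x
  | load _ i => i.ignores x
  | add e f => e.ignores x && f.ignores x
  | sub e f => e.ignores x && f.ignores x

theorem eval_setReg_of_ignores {x : ℕ} (σ : Store) (v : ℕ) {e : Expr} (h : e.ignores x = true) :
    e.eval (σ.setReg x v) = e.eval σ := by
  induction e with
  | lit m => rfl
  | reg y => simp only [ignores, bne_iff_ne, ne_eq] at h; simp [eval, h]
  | load a i ih => simp only [ignores] at h; simp [eval, ih h]
  | add e f ihe ihf => simp only [ignores, Bool.and_eq_true] at h; simp [eval, ihe h.1, ihf h.2]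
  | sub e f ihe ihf => simp only [ignores, Bool.and_eq_true] at h; simp [eval, ihe h.1, ihf h.2]

end Expr

namespace Cmd

@[simp]
theorem exec_assign (x : ℕ) (e : Expr) (σ : Store) :
    (assign x e).exec σ = σ.setReg x (e.eval σ) := rfl

@[simp]
theorem exec_store (a : ℕ) (i e : Expr) (σ : Store) :
    (store a i e).exec σ = σ.setArr a (i.eval σ) (e.eval σ) := rfl

@[simp]
theorem exec_seq (p q : Cmd) (σ : Store) : (seq p q).exec σ = q.exec (p.exec σ) := rfl

@[simp]
theorem exec_ifLe (e f : Expr) (p q : Cmd) (σ : Store) :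
    (ifLe e f p q).exec σ = if e.eval σ ≤ f.eval σ then p.exec σ else q.exec σ := rfl

/-- The program does not write register `x`. -/
def keepsReg (x : ℕ) : Cmd → Bool
  | assign y _ => y != x
  | store _ _ _ => true
  | seq p q => p.keepsReg x && q.keepsReg x
  | ifLe _ _ p q => p.keepsReg x && q.keepsReg x
  | loop _ p => p.keepsReg x

/-- The program does not write the array `a`. -/
def keepsArr (a : ℕ) : Cmd → Bool
  | assign _ _ => true
  | store b _ _ => b != a
  | seq p q => p.keepsArr a && q.keepsArr a
  | ifLe _ _ p q => p.keepsArr a && q.keepsArr a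
  | loop _ p => p.keepsArr a

theorem exec_loop_induct_aux {e : Expr} {p : Cmd} {σ : Store} (I : ℕ → Store → Prop) (h0 : I 0 σ)
    (hs : ∀ i < e.eval σ, ∀ τ, I i τ → I (i + 1) (p.exec τ)) :
    I (e.eval σ) ((loop e p).exec σ) := by
  have : ∀ i ≤ e.eval σ, I i (p.exec^[i] σ) := by
    intro i
    induction i with
    | zero => exact fun _ => h0
    | succ i ih =>
      intro hi
      rw [Function.iterate_succ_apply']
      exact hs i (by omega) _ (ih (by omega))
  exact this _ le_rfl

theorem exec_reg_of_keepsReg {x : ℕ} {c : Cmd} (h : c.keepsReg x = true) (σ : Store) :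
    (c.exec σ).reg x = σ.reg x := by
  induction c generalizing σ with
  | assign y e =>
    simp only [keepsReg, bne_iff_ne, ne_eq] at h
    simp [Ne.symm h]
  | store a i e => rfl
  | seq p q ihp ihq =>
    simp only [keepsReg, Bool.and_eq_true] at h
    simp [ihp h.1, ihq h.2]
  | ifLe e f p q ihp ihq =>
    simp only [keepsReg, Bool.and_eq_true] at h
    simp only [exec_ifLe]
    split_ifs
    exacts [ihp h.1 σ, ihq h.2 σ]
  | loop e p ih =>
    exact exec_loop_induct_aux (fun _ τ => τ.reg x = σ.reg x) rfl fun i _ τ hτ => by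
      rw [ih h, hτ]

theorem exec_arr_of_keepsArr {a : ℕ} {c : Cmd} (h : c.keepsArr a = true) (σ : Store) :
    (c.exec σ).arr a = σ.arr a := by
  induction c generalizing σ with
  | assign y e => rfl
  | store b i e =>
    simp only [keepsArr, bne_iff_ne, ne_eq] at h
    funext j
    simp [Ne.symm h]
  | seq p q ihp ihq =>
    simp only [keepsArr, Bool.and_eq_true] at h
    simp [ihp h.1, ihq h.2]
  | ifLe e f p q ihp ihq =>
    simp only [keepsArr, Bool.and_eq_true] at h
    simp only [exec_ifLe]
    split_ifs
    exacts [ihp h.1 σ, ihq h.2 σ]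
  | loop e p ih =>
    exact exec_loop_induct_aux (fun _ τ => τ.arr a = σ.arr a) rfl fun i _ τ hτ => by
      rw [ih h, hτ]

/-- Induction over a loop. The induction step may use that whatever the body of the loop does not
write still has the value from before the loop. -/
theorem exec_loop_induct {e : Expr} {p : Cmd} {σ : Store} (I : ℕ → Store → Prop) (h0 : I 0 σ)
    (hs : ∀ i < e.eval σ, ∀ τ, I i τ → (∀ y, p.keepsReg y = true → τ.reg y = σ.reg y) →
      (∀ a, p.keepsArr a = true → τ.arr a = σ.arr a) → I (i + 1) (p.exec τ)) :
    I (e.eval σ) ((loop e p).exec σ) := by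
  refine (exec_loop_induct_aux (fun i τ => I i τ ∧
    (∀ y, p.keepsReg y = true → τ.reg y = σ.reg y) ∧
    ∀ a, p.keepsArr a = true → τ.arr a = σ.arr a) ⟨h0, fun _ _ => rfl, fun _ _ => rfl⟩
    fun i hi τ ⟨h1, h2, h3⟩ => ⟨hs i hi τ h1 h2 h3, fun y hy => ?_, fun a ha => ?_⟩).1
  · rw [exec_reg_of_keepsReg hy, h2 y hy]
  · rw [exec_arr_of_keepsArr ha, h3 a ha]

/-- The program never writes the registers `0`, `1` and `2`, and these registers bound all of its
loops. Their values being fixed, the running time can be read off from the nesting of the loops. -/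
def boundedLoops : Cmd → Bool
  | assign x _ => decide (3 ≤ x)
  | store _ _ _ => true
  | seq p q => p.boundedLoops && q.boundedLoops
  | ifLe _ _ p q => p.boundedLoops && q.boundedLoops
  | loop (.reg x) p => decide (x < 3) && p.boundedLoops
  | loop _ _ => false

/-- If the loops are bounded by registers of value at most `K ^ 3`, the program makes at most
`K ^ timeExponent` steps. -/
def timeExponent : Cmd → ℕ
  | assign _ e => e.cost + 1
  | store _ i e => i.cost + e.cost + 1
  | seq p q => max p.timeExponent q.timeExponent + 1
  | ifLe e f p q => e.cost + f.cost + 1 + max p.timeExponent q.timeExponent + 1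
  | loop _ p => p.timeExponent + 5

theorem keepsReg_of_boundedLoops {c : Cmd} (h : c.boundedLoops = true) {x : ℕ} (hx : x < 3) :
    c.keepsReg x = true := by
  induction c with
  | assign y e =>
    simp only [boundedLoops, decide_eq_true_eq] at h
    simp only [keepsReg, bne_iff_ne, ne_eq]
    omega
  | store a i e => rfl
  | seq p q ihp ihq =>
    simp only [boundedLoops, Bool.and_eq_true] at h
    simp [keepsReg, ihp h.1, ihq h.2]
  | ifLe e f p q ihp ihq =>
    simp only [boundedLoops, Bool.and_eq_true] at h
    simp [keepsReg, ihp h.1, ihq h.2]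
  | loop e p ih =>
    cases e <;> simp only [boundedLoops, Bool.and_eq_true, reduceCtorEq] at h
    exact ih h.2

theorem steps_le_pow {c : Cmd} (h : c.boundedLoops = true) {K : ℕ} (hK : 2 ≤ K) {σ : Store}
    (hσ : ∀ x < 3, σ.reg x ≤ K ^ 3) : c.steps σ ≤ K ^ c.timeExponent := by
  have hlt : ∀ m, m ≤ K ^ m := fun m => (Nat.lt_pow_self (by omega)).le
  have hdouble : ∀ m, K ^ m + K ^ m ≤ K ^ (m + 1) := fun m => by
    rw [pow_succ]; nlinarith [pow_pos (by omega : 0 < K) m]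
  have hmono : ∀ {a b : ℕ}, a ≤ b → K ^ a ≤ K ^ b := fun h => Nat.pow_le_pow_right (by omega) h
  induction c generalizing σ with
  | assign y e => exact hlt _
  | store a i e => exact hlt _
  | seq p q ihp ihq =>
    simp only [boundedLoops, Bool.and_eq_true] at h
    have h1 := ihp h.1 hσ
    have h2 := ihq h.2 (σ := p.exec σ) fun x hx => by
      rw [exec_reg_of_keepsReg (keepsReg_of_boundedLoops h.1 hx)]; exact hσ x hx
    exact (Nat.add_le_add (h1.trans (hmono (le_max_left _ _)))
      (h2.trans (hmono (le_max_right _ _)))).trans (hdouble _)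
  | ifLe e f p q ihp ihq =>
    simp only [boundedLoops, Bool.and_eq_true] at h
    have h1 : (if e.eval σ ≤ f.eval σ then p.steps σ else q.steps σ) ≤
        K ^ (e.cost + f.cost + 1 + max p.timeExponent q.timeExponent) := by
      split_ifs
      · exact (ihp h.1 hσ).trans (hmono (by omega))
      · exact (ihq h.2 hσ).trans (hmono (by omega))
    exact (Nat.add_le_add ((hlt _).trans (hmono (by omega))) h1).trans (hdouble _)
  | loop e p ih =>
    cases e with
    | reg x =>
      simp only [boundedLoops, Bool.and_eq_true, decide_eq_true_eq] at h
      obtain ⟨hx, hp⟩ := h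
      have h1 : ∀ i ∈ range (σ.reg x), p.steps (p.exec^[i] σ) + 1 ≤ K ^ (p.timeExponent + 1) := by
        intro i _
        have h2 : ∀ y < 3, (p.exec^[i] σ).reg y = σ.reg y := by
          intro y hy
          induction i with
          | zero => rfl
          | succ i ih' =>
            rw [Function.iterate_succ_apply',
              exec_reg_of_keepsReg (keepsReg_of_boundedLoops hp hy),
              ih' (mem_range.2 (by have := mem_range.1 ‹_›; omega))]
        have h3 := ih hp (σ := p.exec^[i] σ) fun y hy => by rw [h2 y hy]; exact hσ y hy
        have := hdouble p.timeExponent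
        have := Nat.one_le_pow p.timeExponent K (by omega)
        omega
      have h2 : ∑ i ∈ range (σ.reg x), (p.steps (p.exec^[i] σ) + 1) ≤
          K ^ 3 * K ^ (p.timeExponent + 1) := by
        refine (sum_le_sum h1).trans ?_
        rw [sum_const, card_range, smul_eq_mul]
        exact Nat.mul_le_mul_right _ (hσ x hx)
      rw [← pow_add] at h2
      have h3 : 2 ≤ K ^ (3 + (p.timeExponent + 1)) :=
        hK.trans (by simpa using hmono (by omega : 1 ≤ 3 + (p.timeExponent + 1)))
      have h4 := hdouble (3 + (p.timeExponent + 1))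
      have h5 : 3 + (p.timeExponent + 1) + 1 = p.timeExponent + 5 := by omega
      rw [h5] at h4
      change 1 + 1 + ∑ i ∈ range (σ.reg x), (p.steps (p.exec^[i] σ) + 1) ≤ K ^ (p.timeExponent + 5)
      omega
    | _ => simp [boundedLoops] at h

/-- The program that does nothing. -/
def skip : Cmd := assign 3 (.reg 3)

@[simp]
theorem exec_skip (σ : Store) : skip.exec σ = σ := by
  simp [skip, Expr.eval, Store.setReg_self]

/-- Run `p` if the value of `e` is not `0`. -/
def whenPos (e : Expr) (p : Cmd) : Cmd := ifLe (.lit 1) e p skip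

@[simp]
theorem exec_whenPos (e : Expr) (p : Cmd) (σ : Store) :
    (whenPos e p).exec σ = if 1 ≤ e.eval σ then p.exec σ else σ := by
  simp [whenPos, Expr.eval]

/-- Run `p` for the values `0, …, n - 1` of register `x`, where `n` is the value of
register `0`. -/
def forVertices (x : ℕ) (p : Cmd) : Cmd :=
  seq (assign x (.lit 0)) (loop (.reg 0) (seq p (assign x (.add (.reg x) (.lit 1)))))

theorem keepsArr_forVertices (a x : ℕ) (p : Cmd) :
    (forVertices x p).keepsArr a = p.keepsArr a := by
  simp [forVertices, keepsArr]

theorem exec_forVertices_induct {x : ℕ} {p : Cmd} {σ : Store} (hx : x ≠ 0)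
    (hp : p.keepsReg x = true) (I : ℕ → Store → Prop) (h0 : I 0 (σ.setReg x 0))
    (hs : ∀ i < σ.reg 0, ∀ τ, I i τ → τ.reg x = i →
      (∀ y, y ≠ x → p.keepsReg y = true → τ.reg y = σ.reg y) →
      (∀ a, p.keepsArr a = true → τ.arr a = σ.arr a) → I (i + 1) ((p.exec τ).setReg x (i + 1))) :
    I (σ.reg 0) ((forVertices x p).exec σ) := by
  have h := exec_loop_induct (e := .reg 0) (p := seq p (assign x (.add (.reg x) (.lit 1))))
    (σ := σ.setReg x 0) (fun i τ => I i τ ∧ τ.reg x = i) ⟨h0, by simp⟩ (by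
      rintro i hi τ ⟨h1, h2⟩ hr ha
      have h3 : (p.exec τ).reg x = i := by rw [exec_reg_of_keepsReg hp, h2]
      simp only [Expr.eval, Store.setReg_reg, hx.symm, if_false] at hi
      have h4 := hs i hi τ h1 h2
        (fun y hy hk => by
          have := hr y (by simp [keepsReg, hk, hy.symm])
          simpa [hy] using this)
        (fun a hk => by simpa using ha a (by simp [keepsArr, hk]))
      simpa [Expr.eval, h3] using h4)
  simpa [forVertices, Expr.eval, hx.symm] using h.1

/-- Register `acc` becomes the sum of `e` over the vertices `x` for which `c` is not `0`. -/
def sumVertices (x acc : ℕ) (c e : Expr) : Cmd :=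
  seq (assign acc (.lit 0)) (forVertices x (whenPos c (assign acc (.add (.reg acc) e))))

theorem exec_sumVertices {x acc : ℕ} {c e : Expr} (hx : x ≠ 0) (ha : acc ≠ 0) (hxa : acc ≠ x)
    (hx3 : x ≠ 3) (hc : c.ignores acc = true) (he : e.ignores acc = true) (σ : Store) :
    (sumVertices x acc c e).exec σ =
      (σ.setReg acc (∑ i ∈ range (σ.reg 0),
        if 1 ≤ c.eval (σ.setReg x i) then e.eval (σ.setReg x i) else 0)).setReg x (σ.reg 0) := by
  have h := exec_forVertices_induct (x := x)
    (p := whenPos c (assign acc (.add (.reg acc) e))) (σ := σ.setReg acc 0) hx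
    (by simp [whenPos, keepsReg, skip, hxa, hx3.symm])
    (fun i τ => τ = (σ.setReg acc (∑ i ∈ range i,
        if 1 ≤ c.eval (σ.setReg x i) then e.eval (σ.setReg x i) else 0)).setReg x i)
    (by simp) (by
      rintro i - τ rfl - - -
      rw [sum_range_succ]
      have hc' : ∀ v, c.eval ((σ.setReg acc v).setReg x i) = c.eval (σ.setReg x i) := fun v => by
        rw [Store.setReg_setReg_of_ne _ hxa, Expr.eval_setReg_of_ignores _ _ hc]
      have he' : ∀ v, e.eval ((σ.setReg acc v).setReg x i) = e.eval (σ.setReg x i) := fun v => by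
        rw [Store.setReg_setReg_of_ne _ hxa, Expr.eval_setReg_of_ignores _ _ he]
      rw [exec_whenPos, hc']
      split_ifs with h
      · simp only [exec_assign, Expr.eval, he', Store.setReg_reg, hxa, if_true, if_false]
        rw [Store.setReg_setReg_of_ne _ hxa, Store.setReg_setReg_same,
          Store.setReg_setReg_of_ne _ hxa, Store.setReg_setReg_same,
          Store.setReg_setReg_of_ne _ hxa.symm]
      · rw [Store.setReg_setReg_same, add_zero])
  simpa [sumVertices, Expr.eval, ha.symm] using h

end Cmd

/-! ### Tables of multiples, powers and distances -/

namespace HubProgram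

open Cmd Expr

/-- The entry `(u, x)` of an `n × n` matrix that is stored row by row in the array `a`; array `2`
holds the multiples of `n`. -/
abbrev entry (a u x : ℕ) : Expr := .load a (.add (.load 2 (.reg u)) (.reg x))

open Classical in
/-- The input matrix together with the auxiliary tables: multiples of `n` (array `2`), powers of two
(array `3`), and the distances in `T` (array `4`). -/
structure HasTables {n : ℕ} (T : SimpleGraph (Fin n)) (σ : Store) : Prop where
  reg_zero : σ.reg 0 = n
  adj : ∀ u v : Fin n, σ.arr 0 (u * n + v) = if T.Adj u v then 1 else 0
  row : ∀ v : Fin n, σ.arr 2 v = v * n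
  pow : ∀ v : Fin n, σ.arr 3 v = 2 ^ (v : ℕ)
  dist : ∀ u v : Fin n, σ.arr 4 (u * n + v) = T.dist u v

theorem HasTables.congr {n : ℕ} {T : SimpleGraph (Fin n)} {σ τ : Store} (h : HasTables T σ)
    (h0 : τ.reg 0 = σ.reg 0) (ha : ∀ a ∈ [0, 2, 3, 4], τ.arr a = σ.arr a) : HasTables T τ where
  reg_zero := by rw [h0, h.reg_zero]
  adj := by rw [ha 0 (by simp)]; exact h.adj
  row := by rw [ha 2 (by simp)]; exact h.row
  pow := by rw [ha 3 (by simp)]; exact h.pow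
  dist := by rw [ha 4 (by simp)]; exact h.dist

theorem HasTables.setReg {n : ℕ} {T : SimpleGraph (Fin n)} {σ : Store} (h : HasTables T σ)
    {x : ℕ} (hx : 0 ≠ x) (v : ℕ) : HasTables T (σ.setReg x v) :=
  h.congr (by simp [hx]) (by simp)

theorem HasTables.exec {n : ℕ} {T : SimpleGraph (Fin n)} {σ : Store} (h : HasTables T σ)
    {c : Cmd} (hc : (c.keepsReg 0 && c.keepsArr 0 && c.keepsArr 2 && c.keepsArr 3 &&
      c.keepsArr 4) = true) : HasTables T (c.exec σ) := by
  simp only [Bool.and_eq_true] at hc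
  refine h.congr (exec_reg_of_keepsReg hc.1.1.1.1 σ) ?_
  simp [exec_arr_of_keepsArr hc.1.1.1.2, exec_arr_of_keepsArr hc.1.1.2,
    exec_arr_of_keepsArr hc.1.2, exec_arr_of_keepsArr hc.2]

theorem entry_inj {n u v x y : ℕ} (hx : x < n) (hy : y < n) :
    u * n + x = v * n + y ↔ u = v ∧ x = y := by
  constructor
  · intro h
    have h1 := congrArg (· / n) h
    have h2 := congrArg (· % n) h
    have hn : 0 < n := by omega
    simp only [mul_comm _ n, Nat.mul_add_div hn, Nat.div_eq_of_lt hx, Nat.div_eq_of_lt hy,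
      Nat.mul_add_mod, Nat.mod_eq_of_lt hx, Nat.mod_eq_of_lt hy] at h1 h2
    omega
  · rintro ⟨rfl, rfl⟩
    rfl

/-- The multiples of `n` and the powers of two. -/
def basicTables : Cmd :=
  .seq (.assign 10 (.lit 0)) <| .seq (.assign 11 (.lit 1)) <| forVertices 13 <|
    .seq (.store 2 (.reg 13) (.reg 10)) <| .seq (.store 3 (.reg 13) (.reg 11)) <|
    .seq (.assign 10 (.add (.reg 10) (.reg 0))) (.assign 11 (.add (.reg 11) (.reg 11)))

/-- All distances become `n`, those of a vertex to itself become `0`. -/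
def initDist : Cmd :=
  .seq (forVertices 12 <| forVertices 13 <|
      .store 4 (.add (.load 2 (.reg 12)) (.reg 13)) (.reg 0)) <|
    forVertices 12 <| .store 4 (.add (.load 2 (.reg 12)) (.reg 12)) (.lit 0)

/-- One relaxation: the distance from `u` to `y` is at most that to the neighbour `x` of `y`
plus `1`. The registers `12`, `13` and `14` hold `u`, `x` and `y`. -/
def relaxStep : Cmd :=
  whenPos (entry 0 13 14) <|
    .ifLe (.add (entry 4 12 13) (.lit 1)) (entry 4 12 14)
      (.store 4 (.add (.load 2 (.reg 12)) (.reg 14)) (.add (entry 4 12 13) (.lit 1))) skip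

/-- The Bellman–Ford algorithm from all vertices at once. -/
def bellmanFord : Cmd :=
  .loop (.reg 0) <| forVertices 12 <| forVertices 13 <| forVertices 14 relaxStep

theorem exec_basicTables {n : ℕ} {σ : Store} (hn : σ.reg 0 = n) :
    ∀ v < n, (basicTables.exec σ).arr 2 v = v * n ∧ (basicTables.exec σ).arr 3 v = 2 ^ v := by
  subst hn
  refine (exec_forVertices_induct (x := 13) (σ := (σ.setReg 10 0).setReg 11 1)
    (p := .seq (.store 2 (.reg 13) (.reg 10)) <| .seq (.store 3 (.reg 13) (.reg 11)) <|
      .seq (.assign 10 (.add (.reg 10) (.reg 0))) (.assign 11 (.add (.reg 11) (.reg 11))))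
    (by decide) (by decide)
    (fun i τ => τ.reg 0 = σ.reg 0 ∧ τ.reg 10 = i * σ.reg 0 ∧ τ.reg 11 = 2 ^ i ∧
      ∀ v < i, τ.arr 2 v = v * σ.reg 0 ∧ τ.arr 3 v = 2 ^ v) ?_ ?_).2.2.2
  · simp
  · rintro i hi τ ⟨h0, h1, h2, h3⟩ hx - -
    refine ⟨by simpa using h0, by simp [Expr.eval, h0, h1, Nat.succ_mul],
      by simp [Expr.eval, h2, pow_succ, mul_two], fun v hv => ?_⟩
    rcases eq_or_ne v i with rfl | hne
    · simp [Expr.eval, hx, h1, h2]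
    · simpa [Expr.eval, hx, hne] using h3 v (by omega)

section Dist

variable {n : ℕ} {T : SimpleGraph (Fin n)}

/-- The entries of array `4` are upper bounds of the distances, and they are exact up to
distance `m`. -/
def DistUpTo (T : SimpleGraph (Fin n)) (m : ℕ) (τ : Store) : Prop :=
  (∀ u x : Fin n, T.dist u x ≤ τ.arr 4 (u * n + x)) ∧
    ∀ u x : Fin n, T.dist u x ≤ m → τ.arr 4 (u * n + x) = T.dist u x

theorem dist_lt_card (hT : T.IsTree) (u x : Fin n) : T.dist u x < n := by
  obtain ⟨p, hp, hl⟩ := hT.connected.exists_path_of_dist u x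
  rw [← hl]
  simpa using hp.length_lt

theorem exec_initDist (hT : T.IsTree) {σ : Store} (hn : σ.reg 0 = n)
    (hrow : ∀ v < n, σ.arr 2 v = v * n) : DistUpTo T 0 (initDist.exec σ) := by
  subst hn
  set σ' := (forVertices 12 (forVertices 13
      (.store 4 (.add (.load 2 (.reg 12)) (.reg 13)) (.reg 0)))).exec σ with hσ'
  have hfill : ∀ u < σ.reg 0, ∀ x < σ.reg 0, σ'.arr 4 (u * σ.reg 0 + x) = σ.reg 0 := by
    refine exec_forVertices_induct (x := 12) (by decide) (by decide)
      (fun i τ => ∀ u < i, ∀ x < σ.reg 0, τ.arr 4 (u * σ.reg 0 + x) = σ.reg 0) (by simp) ?_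
    intro i hi τ hI hx hreg harr
    have h0 : τ.reg 0 = σ.reg 0 := hreg 0 (by decide) rfl
    have h2 : τ.arr 2 = σ.arr 2 := harr 2 rfl
    have := exec_forVertices_induct (x := 13) (σ := τ)
      (p := .store 4 (.add (.load 2 (.reg 12)) (.reg 13)) (.reg 0)) (by decide) (by decide)
      (fun j τ => (∀ u < i, ∀ x < σ.reg 0, τ.arr 4 (u * σ.reg 0 + x) = σ.reg 0) ∧
        ∀ x < j, τ.arr 4 (i * σ.reg 0 + x) = σ.reg 0) (by simpa using hI) (by
        rintro j hj τ' ⟨hJ1, hJ2⟩ hx' hreg' harr'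
        have h12 : τ'.reg 12 = i := by rw [hreg' 12 (by decide) rfl, hx]
        have h0' : τ'.reg 0 = σ.reg 0 := by rw [hreg' 0 (by decide) rfl, h0]
        have h2' : τ'.arr 2 = σ.arr 2 := by rw [harr' 2 rfl, h2]
        simp only [exec_store, Expr.eval, Store.setReg_arr, Store.setArr_arr, true_and, h0', h2',
          h12, hx', hrow i hi]
        refine ⟨fun u hu x hx => ?_, fun x hx => ?_⟩
        · rw [hJ1 u hu x hx, ite_self]
        · split_ifs with h
          · rfl
          · exact hJ2 x (by omega))
    rw [h0] at this
    intro u hu y hy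
    rw [Store.setReg_arr]
    rcases Nat.lt_succ_iff_lt_or_eq.1 hu with hu | rfl
    exacts [this.1 u hu y hy, this.2 y hy]
  have h0 : σ'.reg 0 = σ.reg 0 := exec_reg_of_keepsReg (by decide) σ
  have h2 : σ'.arr 2 = σ.arr 2 := exec_arr_of_keepsArr (by decide) σ
  have key := exec_forVertices_induct (x := 12) (σ := σ')
    (p := .store 4 (.add (.load 2 (.reg 12)) (.reg 12)) (.lit 0)) (by decide) (by decide)
    (fun i τ => (∀ u x : Fin (σ.reg 0), T.dist u x ≤ τ.arr 4 (u * σ.reg 0 + x)) ∧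
      ∀ u < i, τ.arr 4 (u * σ.reg 0 + u) = 0)
    (by
      refine ⟨fun u x => ?_, by simp⟩
      rw [Store.setReg_arr, hfill u u.2 x x.2]
      exact (dist_lt_card hT u x).le)
    (by
      rintro i hi τ ⟨h3, h4⟩ hx hreg harr
      have h2' : τ.arr 2 = σ.arr 2 := by rw [harr 2 rfl, h2]
      rw [h0] at hi
      simp only [exec_store, Expr.eval, Store.setReg_arr, Store.setArr_arr, true_and, h2', hx,
        hrow i hi]
      refine ⟨fun u x => ?_, fun u hu => ?_⟩
      · split_ifs with h
        · rw [entry_inj x.2 hi] at h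
          rw [Fin.ext (h.1.trans h.2.symm), SimpleGraph.dist_self]
        · exact h3 u x
      · split_ifs with h
        · rfl
        · exact h4 u (lt_of_le_of_ne (by omega) fun he => h (by rw [he])))
  rw [h0] at key
  refine ⟨key.1, fun u x hux => ?_⟩
  have : u = x := (hT.connected u x).dist_eq_zero_iff.1 (by omega)
  subst this
  rw [SimpleGraph.dist_self]
  exact key.2 u u.2

/-- What is left unchanged by the relaxations. -/
structure RelaxContext (T : SimpleGraph (Fin n)) (τ : Store) : Prop where
  reg_zero : τ.reg 0 = n
  adj : ∀ u v : Fin n, 1 ≤ τ.arr 0 (u * n + v) ↔ T.Adj u v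
  row : ∀ v < n, τ.arr 2 v = v * n

theorem exec_relaxStep (hT : T.IsTree) {m : ℕ} {τ : Store} (hc : RelaxContext T τ)
    (hd : DistUpTo T m τ) {u x y : Fin n} (hu : τ.reg 12 = u) (hx : τ.reg 13 = x)
    (hy : τ.reg 14 = y) :
    DistUpTo T m (relaxStep.exec τ) ∧
      (∀ i, (relaxStep.exec τ).arr 4 i ≤ τ.arr 4 i) ∧
      (T.Adj x y → T.dist u x = m → (relaxStep.exec τ).arr 4 (u * n + y) ≤ m + 1) := by
  have h1 := hc.adj x y
  by_cases ha : T.Adj x y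
  swap
  · have : relaxStep.exec τ = τ := by
      simp [relaxStep, Expr.eval, hx, hy, hc.row x x.2, mt h1.1 ha]
    rw [this]
    exact ⟨hd, fun _ => le_rfl, fun h => absurd h ha⟩
  · have he : relaxStep.exec τ =
        if τ.arr 4 (u * n + x) + 1 ≤ τ.arr 4 (u * n + y) then
          τ.setArr 4 (u * n + y) (τ.arr 4 (u * n + x) + 1) else τ := by
      simp [relaxStep, Expr.eval, hu, hx, hy, hc.row x x.2, hc.row u u.2, h1.2 ha]
    have hle : ∀ i, (relaxStep.exec τ).arr 4 i ≤ τ.arr 4 i := by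
      intro i
      rw [he]
      split_ifs with h
      · rw [Store.setArr_arr]
        split_ifs with h'
        · rw [h'.2]; exact h
        · exact le_rfl
      · exact le_rfl
    have hge : ∀ a b : Fin n, T.dist a b ≤ (relaxStep.exec τ).arr 4 (a * n + b) := by
      intro a b
      rw [he]
      split_ifs with h
      · rw [Store.setArr_arr]
        split_ifs with h'
        · rw [entry_inj b.2 y.2] at h'
          have h3 := hd.1 u x
          rw [Fin.ext h'.2.1, Fin.ext h'.2.2]
          have h4 := hT.connected.dist_triangle (u := u) (v := x) (w := y)
          rw [SimpleGraph.dist_eq_one_iff_adj.2 ha] at h4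
          omega
        · exact hd.1 a b
      · exact hd.1 a b
    refine ⟨⟨hge, fun a b hab => le_antisymm ((hle _).trans (hd.2 a b hab).le) (hge a b)⟩, hle,
      fun _ hm => ?_⟩
    have h3 := hd.2 u x hm.le
    rw [he]
    split_ifs with h
    · simp [h3, hm]
    · omega

/-- Round `m + 1` of the relaxations finds the vertices at distance `m + 1`: the last but one vertex
of a shortest path has distance `m`. -/
theorem exec_relaxRound (hT : T.IsTree) {m : ℕ} {σ : Store} (hc : RelaxContext T σ)
    (hd : DistUpTo T m σ) :
    DistUpTo T (m + 1) ((forVertices 12 (forVertices 13 (forVertices 14 relaxStep))).exec σ) := by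
  -- `P i j l` says that the triples before `(i, j, l)` have been treated.
  let P : ℕ → ℕ → ℕ → Store → Prop := fun i j l τ => DistUpTo T m τ ∧
    ∀ u x y : Fin n, ((u : ℕ) < i ∨ (u : ℕ) = i ∧ ((x : ℕ) < j ∨ (x : ℕ) = j ∧ (y : ℕ) < l)) →
      T.Adj x y → T.dist u x = m → τ.arr 4 (u * n + y) ≤ m + 1
  have hctx : ∀ τ : Store, τ.reg 0 = σ.reg 0 → (∀ a, a ≠ 4 → τ.arr a = σ.arr a) →
      RelaxContext T τ := fun τ h0 ha =>
    ⟨h0.trans hc.reg_zero, by rw [ha 0 (by decide)]; exact hc.adj,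
      by rw [ha 2 (by decide)]; exact hc.row⟩
  have key : P n 0 0 ((forVertices 12 (forVertices 13 (forVertices 14 relaxStep))).exec σ) := by
    have := exec_forVertices_induct (x := 12) (σ := σ)
      (p := forVertices 13 (forVertices 14 relaxStep)) (by decide) (by decide)
      (fun i τ => P i 0 0 τ) ⟨hd, by simp⟩ (by
      intro i hi τ hP hx hreg harr
      have h0 := hreg 0 (by decide) rfl
      have := exec_forVertices_induct (x := 13) (σ := τ)
        (p := forVertices 14 relaxStep) (by decide) (by decide)
        (fun j τ => P i j 0 τ) (by simpa [P, DistUpTo] using hP) (by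
        intro j hj τ' hP' hx' hreg' harr'
        have h0' := (hreg' 0 (by decide) rfl).trans h0
        have := exec_forVertices_induct (x := 14) (σ := τ')
          (p := relaxStep) (by decide) (by decide)
          (fun l τ => P i j l τ) (by simpa [P, DistUpTo] using hP') (by
          intro l hl τ'' hP'' hx'' hreg'' harr''
          have h0'' := (hreg'' 0 (by decide) rfl).trans h0'
          rw [h0, hc.reg_zero] at hj
          rw [h0', hc.reg_zero] at hl
          rw [hc.reg_zero] at hi
          have hc'' := hctx τ'' h0'' fun a ha => by
            have hk : relaxStep.keepsArr a = true := by
              simpa [relaxStep, keepsArr, whenPos, skip] using Ne.symm ha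
            rw [harr'' a hk, harr' a (by rwa [keepsArr_forVertices]),
              harr a (by rwa [keepsArr_forVertices, keepsArr_forVertices])]
          have h3 := exec_relaxStep hT hc'' hP''.1 (u := ⟨i, hi⟩) (x := ⟨j, hj⟩) (y := ⟨l, hl⟩)
            ((hreg'' 12 (by decide) rfl).trans ((hreg' 12 (by decide) rfl).trans hx))
            ((hreg'' 13 (by decide) rfl).trans hx') hx''
          refine ⟨h3.1, fun u x y huxy ha hm => ?_⟩
          by_cases hnew : (u : ℕ) = i ∧ (x : ℕ) = j ∧ (y : ℕ) = l
          · obtain ⟨h4, h5, h6⟩ := hnew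
            obtain rfl : u = ⟨i, hi⟩ := Fin.ext h4
            obtain rfl : x = ⟨j, hj⟩ := Fin.ext h5
            obtain rfl : y = ⟨l, hl⟩ := Fin.ext h6
            exact h3.2.2 ha hm
          · exact (h3.2.1 _).trans (hP''.2 u x y (by omega) ha hm))
        rw [h0', hc.reg_zero] at this
        refine ⟨this.1, fun u x y huxy => this.2 u x y ?_⟩
        have := y.2
        omega)
      rw [h0, hc.reg_zero] at this
      refine ⟨this.1, fun u x y huxy => this.2 u x y ?_⟩
      have := x.2
      omega)
    rwa [hc.reg_zero] at this
  refine ⟨key.1.1, fun u y huy => ?_⟩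
  rcases Nat.lt_succ_iff_lt_or_eq.1 (Nat.lt_succ_of_le huy) with h | h
  · exact key.1.2 u y (by omega)
  · obtain ⟨p, hp⟩ := hT.connected.exists_walk_length_eq_dist y u
    cases p with
    | nil => rw [SimpleGraph.dist_self] at h; omega
    | @cons _ x _ ha q =>
      rw [SimpleGraph.Walk.length_cons, T.dist_comm] at hp
      have h1 := SimpleGraph.dist_le q
      rw [T.dist_comm] at h1
      have h2 := hT.connected.dist_triangle (u := u) (v := x) (w := y)
      rw [SimpleGraph.dist_eq_one_iff_adj.2 ha.symm] at h2
      have h3 := key.2 u x y (.inl u.2) ha.symm (by omega)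
      exact le_antisymm (h3.trans h.ge) (key.1.1 u y)

theorem exec_bellmanFord (hT : T.IsTree) {σ : Store} (hc : RelaxContext T σ)
    (hd : DistUpTo T 0 σ) (u x : Fin n) :
    (bellmanFord.exec σ).arr 4 (u * n + x) = T.dist u x := by
  have := exec_loop_induct (e := .reg 0) (σ := σ)
    (p := forVertices 12 <| forVertices 13 <| forVertices 14 relaxStep)
    (fun m τ => DistUpTo T m τ) hd fun m hm τ hτ hreg harr => exec_relaxRound hT
      ⟨(hreg 0 (by decide)).trans hc.reg_zero, by rw [harr 0 (by decide)]; exact hc.adj,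
        by rw [harr 2 (by decide)]; exact hc.row⟩ hτ
  refine this.2 u x ?_
  rw [Expr.eval, hc.reg_zero]
  exact (dist_lt_card hT u x).le

/-- The computation of all auxiliary tables. -/
def setup : Cmd := .seq basicTables (.seq initDist bellmanFord)

theorem hasTables_setup (hT : T.IsTree) (k : ℕ) : HasTables T (setup.exec (inputStore T k)) := by
  classical
  set σ := inputStore T k with hσ
  have h0 : σ.reg 0 = n := rfl
  have hadj : ∀ u v : Fin n, σ.arr 0 (u * n + v) = if T.Adj u v then 1 else 0 := by
    intro u v
    simp only [hσ, inputStore, true_and]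
    refine if_congr ⟨?_, fun h => ⟨u, v, rfl, h⟩⟩ rfl rfl
    rintro ⟨u', v', h, ha⟩
    rw [entry_inj v.2 v'.2] at h
    rwa [Fin.ext h.1, Fin.ext h.2]
  have h1 := exec_basicTables h0
  have h10 : (basicTables.exec σ).reg 0 = n := exec_reg_of_keepsReg (by decide) σ
  have h2 := exec_initDist hT h10 fun v hv => (h1 v hv).1
  have hf : ∀ a ∈ [2, 3], (initDist.exec (basicTables.exec σ)).arr a = (basicTables.exec σ).arr a :=
    fun a ha => by
      fin_cases ha <;> exact exec_arr_of_keepsArr (by decide) _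
  have hf0 : (initDist.exec (basicTables.exec σ)).arr 0 = σ.arr 0 := by
    rw [exec_arr_of_keepsArr (by decide), exec_arr_of_keepsArr (by decide)]
  have hc : RelaxContext T (initDist.exec (basicTables.exec σ)) :=
    ⟨(exec_reg_of_keepsReg (by decide) _).trans h10,
      fun u v => by rw [hf0, hadj]; split_ifs with h <;> simp [h],
      fun v hv => by rw [hf 2 (by simp)]; exact (h1 v hv).1⟩
  refine ⟨exec_reg_of_keepsReg (by decide) σ, ?_, fun v => ?_, fun v => ?_,
    exec_bellmanFord hT hc h2⟩
  · rw [exec_arr_of_keepsArr (by decide)]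
    exact hadj
  · simp only [setup, exec_seq]
    rw [exec_arr_of_keepsArr (by decide), hf 2 (by simp)]
    exact (h1 v v.2).1
  · simp only [setup, exec_seq]
    rw [exec_arr_of_keepsArr (by decide), hf 3 (by simp)]
    exact (h1 v v.2).2

end Dist

end HubProgram

/-! ### The family of subtrees with small boundary -/

namespace HubProgram

open Cmd Expr

/-- The number of rows of the table of subtrees that come from at most `j` removals: the root row
and, for every earlier row, one row for every pair of vertices. -/
def familySize (n : ℕ) : ℕ → ℕ
  | 0 => 1
  | j + 1 => familySize n j * n * n + 1

theorem familySize_le {n M : ℕ} (hM : 2 ≤ M) (hn : n ≤ M) (j : ℕ) :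
    familySize n j ≤ (M ^ j) ^ 3 := by
  induction j with
  | zero => simp [familySize]
  | succ j ih =>
    have h1 : familySize n j * n * n ≤ (M ^ j) ^ 3 * M * M :=
      Nat.mul_le_mul (Nat.mul_le_mul ih hn) hn
    have h2 : 1 ≤ (M ^ j) ^ 3 := Nat.one_le_pow _ _ (Nat.pow_pos (by omega))
    have h3 : (M ^ (j + 1)) ^ 3 = (M ^ j) ^ 3 * M * M * M := by ring
    rw [familySize, h3]
    have h4 : 1 ≤ (M ^ j) ^ 3 * M * M :=
      Nat.one_le_iff_ne_zero.2 (by positivity)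
    nlinarith

/-- Register `10` becomes `familySize n k`. -/
def countRows : Cmd :=
  .seq (.assign 10 (.lit 1)) <| .loop (.reg 1) <|
    .seq (sumVertices 13 11 (.lit 1) (.reg 10)) <|
    .seq (sumVertices 13 14 (.lit 1) (.reg 11)) <| .assign 10 (.add (.reg 14) (.lit 1))

theorem exec_countRows {n k : ℕ} {σ : Store} (hn : σ.reg 0 = n) (hk : σ.reg 1 = k) :
    (countRows.exec σ).reg 10 = familySize n k := by
  have := exec_loop_induct (e := .reg 1) (σ := σ.setReg 10 1)
    (p := .seq (sumVertices 13 11 (.lit 1) (.reg 10)) <|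
      .seq (sumVertices 13 14 (.lit 1) (.reg 11)) <| .assign 10 (.add (.reg 14) (.lit 1)))
    (fun j τ => τ.reg 10 = familySize n j) (by simp [familySize]) (by
      intro j _ τ hτ hreg _
      have h0 : τ.reg 0 = n := by rw [hreg 0 (by decide)]; simpa using hn
      simp only [exec_seq, exec_assign]
      rw [exec_sumVertices (by decide) (by decide) (by decide) (by decide) rfl rfl,
        exec_sumVertices (by decide) (by decide) (by decide) (by decide) rfl rfl]
      simp [Expr.eval, h0, hτ, familySize]
      ring)
  simpa [countRows, Expr.eval, hk] using this

/-- The entry `x` of the row at `q` is copied from the row at `p`, and it is erased if `r` lies on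
the path from `u` to `x`. The registers `12`, `13`, `15`, `16`, `17` hold `u`, `x`, `p`, `q`,
`r`. -/
def splitEntry : Cmd :=
  .ifLe (.add (entry 4 12 17) (entry 4 17 13)) (entry 4 12 13)
    (.store 5 (.add (.reg 16) (.reg 13)) (.lit 0))
    (.store 5 (.add (.reg 16) (.reg 13)) (.load 5 (.add (.reg 15) (.reg 13))))

/-- The rows of array `5` become the subtrees that arise from the tree by repeatedly removing a
vertex `r` and keeping the component of a vertex `u`; row `0` is the whole tree, and the pair
`(r, u)` turns row `i` into row `(i * n + r) * n + u + 1`. -/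
def generate : Cmd :=
  .seq (forVertices 13 (.store 5 (.reg 13) (.lit 1))) <|
  .seq (.assign 15 (.lit 0)) <| .seq (.assign 16 (.reg 0)) <|
  .loop (.reg 2) <| .seq
    (forVertices 17 <| forVertices 12 <|
      .seq (forVertices 13 splitEntry) (.assign 16 (.add (.reg 16) (.reg 0))))
    (.assign 15 (.add (.reg 15) (.reg 0)))

section Rows

variable {n : ℕ} {T : SimpleGraph (Fin n)}

theorem exec_splitEntry {τ : Store} (ht : HasTables T τ) {r u x : Fin n} (hr : τ.reg 17 = r)
    (hu : τ.reg 12 = u) (hx : τ.reg 13 = x) :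
    splitEntry.exec τ = τ.setArr 5 (τ.reg 16 + x)
      (if T.dist u r + T.dist r x ≤ T.dist u x then 0 else τ.arr 5 (τ.reg 15 + x)) := by
  simp only [splitEntry, exec_ifLe, exec_store, Expr.eval, hr, hu, hx, ht.row, ht.dist]
  split_ifs <;> rfl

theorem exec_splitRow {σ : Store} (ht : HasTables T σ) {r u : Fin n} (hr : σ.reg 17 = r)
    (hu : σ.reg 12 = u) {p q : ℕ} (hp : σ.reg 15 = p) (hq : σ.reg 16 = q) (hpq : p + n ≤ q) :
    (∀ j < q, ((forVertices 13 splitEntry).exec σ).arr 5 j = σ.arr 5 j) ∧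
    ∀ x : Fin n, ((forVertices 13 splitEntry).exec σ).arr 5 (q + x) =
      if T.dist u r + T.dist r x ≤ T.dist u x then 0 else σ.arr 5 (p + x) := by
  have := exec_forVertices_induct (x := 13) (σ := σ) (p := splitEntry) (by decide) (by decide)
    (fun i τ => (∀ j < q, τ.arr 5 j = σ.arr 5 j) ∧ ∀ x : Fin n, (x : ℕ) < i →
      τ.arr 5 (q + x) =
        if T.dist u r + T.dist r x ≤ T.dist u x then 0 else σ.arr 5 (p + x)) (by simp) (by
      rintro i hi τ ⟨h1, h2⟩ hx hreg harr
      rw [ht.reg_zero] at hi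
      have ht' : HasTables T τ := ht.congr (hreg 0 (by decide) rfl) fun a ha => by
        fin_cases ha <;> exact harr _ (by decide)
      have h15 := (hreg 15 (by decide) rfl).trans hp
      have h16 := (hreg 16 (by decide) rfl).trans hq
      rw [exec_splitEntry ht' (x := ⟨i, hi⟩) ((hreg 17 (by decide) rfl).trans hr)
        ((hreg 12 (by decide) rfl).trans hu) hx, h15, h16]
      simp only [Store.setReg_arr, Store.setArr_arr, true_and]
      refine ⟨fun j hj => ?_, fun x hxi => ?_⟩
      · rw [if_neg (by omega), h1 j hj]
      · by_cases hxe : (x : ℕ) = i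
        · obtain rfl : x = ⟨i, hi⟩ := Fin.ext hxe
          rw [if_pos rfl, h1 _ (show p + i < q by omega)]
        · rw [if_neg (by omega), h2 x (by omega)])
  rw [ht.reg_zero] at this
  exact ⟨this.1, fun x => this.2 x x.2⟩

/-- The rows created from the first `m` triples of a row and two vertices. -/
def RowsUpTo (T : SimpleGraph (Fin n)) (m : ℕ) (τ : Store) : Prop :=
  (∀ x : Fin n, τ.arr 5 x = 1) ∧ ∀ (i : ℕ) (r u x : Fin n), (i * n + r) * n + u < m →
    τ.arr 5 (((i * n + r) * n + u + 1) * n + x) =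
      if T.dist u r + T.dist r x ≤ T.dist u x then 0 else τ.arr 5 (i * n + x)

theorem exec_nextRow {σ : Store} (ht : HasTables T σ) {i : ℕ} {r u : Fin n}
    (hr : σ.reg 17 = r) (hu : σ.reg 12 = u) (hp : σ.reg 15 = i * n)
    (hq : σ.reg 16 = ((i * n + r) * n + u + 1) * n) (h : RowsUpTo T ((i * n + r) * n + u) σ) :
    RowsUpTo T ((i * n + r) * n + u + 1) ((forVertices 13 splitEntry).exec σ) := by
  have hn : 0 < n := r.pos
  have hle : ∀ i r u : ℕ, i ≤ (i * n + r) * n + u := fun i r u =>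
    ((Nat.le_mul_of_pos_right i hn).trans (Nat.le_add_right _ r)).trans
      ((Nat.le_mul_of_pos_right _ hn).trans (Nat.le_add_right _ u))
  have hpq : i * n + n ≤ ((i * n + r) * n + u + 1) * n := by
    rw [← Nat.succ_mul]
    exact Nat.mul_le_mul_right n (Nat.succ_le_succ (hle i r u))
  obtain ⟨h1, h2⟩ := exec_splitRow ht hr hu hp hq hpq
  have hlt : ∀ m < (i * n + r) * n + u + 1, ∀ x : Fin n,
      m * n + x < ((i * n + r) * n + u + 1) * n := fun m hm x => by
    have := Nat.mul_le_mul_right n hm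
    rw [Nat.succ_mul] at this
    have := x.2
    omega
  refine ⟨fun x => ?_, fun i' r' u' x hlt' => ?_⟩
  · have := hlt 0 (by omega) x
    rw [zero_mul, zero_add] at this
    rw [h1 x this, h.1]
  · rw [h1 (i' * n + x) (hlt i' ((hle i' r' u').trans_lt hlt') x)]
    rcases Nat.lt_succ_iff_lt_or_eq.1 hlt' with hlt' | heq
    · rw [h1 _ (hlt _ (by omega) x), h.2 i' r' u' x hlt']
    · rw [entry_inj u'.2 u.2, entry_inj r'.2 r.2] at heq
      obtain ⟨⟨rfl, h3⟩, h4⟩ := heq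
      obtain rfl : r' = r := Fin.ext h3
      obtain rfl : u' = u := Fin.ext h4
      exact h2 x

theorem RowsUpTo.congr {m : ℕ} {σ τ : Store} (h : RowsUpTo T m σ) (ha : τ.arr 5 = σ.arr 5) :
    RowsUpTo T m τ := by
  rw [RowsUpTo, ha]
  exact h

theorem exec_generate {σ : Store} (ht : HasTables T σ) :
    RowsUpTo T (σ.reg 2 * n * n) (generate.exec σ) := by
  have h1 := exec_forVertices_induct (x := 13) (σ := σ) (p := .store 5 (.reg 13) (.lit 1))
    (by decide) (by decide) (fun i τ => ∀ x < i, τ.arr 5 x = 1) (by simp) (by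
      intro i hi τ h hx _ _ x hxi
      by_cases hxe : x = i
      · simp [Expr.eval, hxe, hx]
      · simpa [Expr.eval, hxe, hx] using h x (by omega))
  rw [ht.reg_zero] at h1
  have ht1 : HasTables T ((forVertices 13 (.store 5 (.reg 13) (.lit 1))).exec σ) :=
    ht.exec (by decide)
  have hr2 : ((forVertices 13 (.store 5 (.reg 13) (.lit 1))).exec σ).reg 2 = σ.reg 2 :=
    exec_reg_of_keepsReg (by decide) σ
  simp only [generate, exec_seq]
  set σ₁ := (forVertices 13 (.store 5 (.reg 13) (.lit 1))).exec σ
  simp only [exec_assign, Expr.eval]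
  have h2 := exec_loop_induct (e := .reg 2) (σ := (σ₁.setReg 15 0).setReg 16 n)
    (p := .seq
      (forVertices 17 <| forVertices 12 <|
        .seq (forVertices 13 splitEntry) (.assign 16 (.add (.reg 16) (.reg 0))))
      (.assign 15 (.add (.reg 15) (.reg 0))))
    (fun i τ => RowsUpTo T (i * n * n) τ ∧ τ.reg 15 = i * n ∧ τ.reg 16 = (i * n * n + 1) * n)
    ⟨⟨fun x => h1 x x.2, by simp⟩, by simp, by simp⟩ (by
    rintro i - τ ⟨hR, h15, h16⟩ hreg harr
    have htτ : HasTables T τ := ht1.congr ((hreg 0 (by decide)).trans (by simp)) fun a ha => by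
      fin_cases ha <;> exact harr _ (by decide)
    have h3 := exec_forVertices_induct (x := 17) (σ := τ)
      (p := forVertices 12 <|
        .seq (forVertices 13 splitEntry) (.assign 16 (.add (.reg 16) (.reg 0))))
      (by decide) (by decide)
      (fun r τ => RowsUpTo T ((i * n + r) * n) τ ∧ τ.reg 16 = ((i * n + r) * n + 1) * n)
      ⟨hR, by simpa using h16⟩ (by
      rintro r hr τ' ⟨hR', h16'⟩ hx' hreg' harr'
      rw [htτ.reg_zero] at hr
      have ht' : HasTables T τ' := htτ.congr (hreg' 0 (by decide) rfl) fun a ha => by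
        fin_cases ha <;> exact harr' _ (by decide)
      have h15' := (hreg' 15 (by decide) rfl).trans h15
      have h4 := exec_forVertices_induct (x := 12) (σ := τ')
        (p := .seq (forVertices 13 splitEntry) (.assign 16 (.add (.reg 16) (.reg 0))))
        (by decide) (by decide)
        (fun u τ => RowsUpTo T ((i * n + r) * n + u) τ ∧
          τ.reg 16 = ((i * n + r) * n + u + 1) * n)
        ⟨hR', by simpa using h16'⟩ (by
        rintro u hu τ'' ⟨hR'', h16''⟩ hx'' hreg'' harr''
        rw [ht'.reg_zero] at hu
        have ht'' : HasTables T τ'' := ht'.congr (hreg'' 0 (by decide) rfl) fun a ha => by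
          fin_cases ha <;> exact harr'' _ (by decide)
        have h5 := exec_nextRow ht'' (r := ⟨r, hr⟩) (u := ⟨u, hu⟩)
          ((hreg'' 17 (by decide) rfl).trans hx') hx''
          ((hreg'' 15 (by decide) rfl).trans h15') h16'' hR''
        refine ⟨h5.congr rfl, ?_⟩
        have h6 : ((forVertices 13 splitEntry).exec τ'').reg 16 = τ''.reg 16 :=
          exec_reg_of_keepsReg (by decide) _
        have h7 : ((forVertices 13 splitEntry).exec τ'').reg 0 = τ''.reg 0 :=
          exec_reg_of_keepsReg (by decide) _
        simp [Expr.eval, h6, h7, h16'', ht''.reg_zero]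
        ring)
      rw [ht'.reg_zero] at h4
      have h8 : (i * n + r) * n + n = (i * n + (r + 1)) * n := by ring
      rw [h8] at h4
      exact ⟨h4.1.congr rfl, by simpa using h4.2⟩)
    rw [htτ.reg_zero] at h3
    have h9 : (i * n + n) * n = (i + 1) * n * n := by ring
    rw [h9] at h3
    set τ₁ := (forVertices 17 (forVertices 12
      (.seq (forVertices 13 splitEntry) (.assign 16 (.add (.reg 16) (.reg 0)))))).exec τ with hτ₁
    have h10 : τ₁.reg 15 = τ.reg 15 := exec_reg_of_keepsReg (by decide) _
    have h11 : τ₁.reg 0 = τ.reg 0 := exec_reg_of_keepsReg (by decide) _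
    refine ⟨h3.1.congr rfl, ?_, ?_⟩
    · simp only [exec_seq, ← hτ₁]
      simp [Expr.eval, h10, h11, h15, htτ.reg_zero, Nat.succ_mul]
    · simp only [exec_seq, ← hτ₁]
      simpa [Expr.eval] using h3.2)
  simpa [Expr.eval, hr2, ht1.reg_zero] using h2.1

end Rows

end HubProgram

section Sides

variable {V : Type u} {T : SimpleGraph V} [Fintype V] [DecidableEq V]

theorem filter_dist_eq_inter (hT : T.IsTree) (S : Finset V) (r u : V) :
    (S.filter fun x => ¬ T.dist u r + T.dist r x = T.dist u x) =
      S ∩ component T (univ.erase r) u := by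
  rw [component_erase_eq hT (S := univ) (fun _ _ _ _ _ _ => mem_univ _) (mem_univ u)]
  ext x
  simp

/-- Removing one more vertex from a subtree and keeping one side adds at most one boundary
vertex. -/
theorem isSubtree_filter_dist (hT : T.IsTree) {S : Finset V} (hS : IsSubtree T S) (r u : V) :
    (S.filter fun x => ¬ T.dist u r + T.dist r x = T.dist u x) = ∅ ∨
      IsSubtree T (S.filter fun x => ¬ T.dist u r + T.dist r x = T.dist u x) ∧
        (boundary T (S.filter fun x => ¬ T.dist u r + T.dist r x = T.dist u x)).card ≤
          (boundary T S).card + 1 := by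
  rw [filter_dist_eq_inter hT]
  rcases (S ∩ component T (univ.erase r) u).eq_empty_or_nonempty with h | h
  · exact .inl h
  · refine .inr ⟨(isSubtree_iff hT).2 ⟨h, fun x hx y hy w hw => ?_⟩, ?_⟩
    · rw [mem_inter] at hx hy ⊢
      exact ⟨((isSubtree_iff hT).1 hS).2 x hx.1 y hy.1 w hw,
        pathConvex_component hT _ _ x hx.2 y hy.2 w hw⟩
    · have hsub : boundary T (S ∩ component T (univ.erase r) u) ⊆ insert r (boundary T S) := by
        intro v hv
        obtain ⟨hvA, w, hw, ha⟩ := mem_boundary.1 hv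
        rw [mem_inter] at hvA hw
        rw [mem_insert, or_iff_not_imp_left]
        refine fun hne => mem_boundary.2 ⟨fun hvS => hvA ⟨hvS, ?_⟩, w, hw.1, ha⟩
        exact mem_component_of_adj hw.2 ha (mem_erase.2 ⟨hne, mem_univ v⟩)
      exact (card_le_card hsub).trans (card_insert_le _ _)

/-- Conversely, every subtree with a non-empty boundary is one side of a subtree with a smaller
boundary. -/
theorem exists_filter_dist_eq (hT : T.IsTree) {S : Finset V} (hS : IsSubtree T S)
    (hb : (boundary T S).Nonempty) :
    ∃ S', IsSubtree T S' ∧ (boundary T S').card < (boundary T S).card ∧ ∃ r u,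
      S = S'.filter fun x => ¬ T.dist u r + T.dist r x = T.dist u x := by
  obtain ⟨⟨u, hu⟩, hc⟩ := (isSubtree_iff hT).1 hS
  obtain ⟨r, hr⟩ := hb
  have hmemA : ∀ {x}, x ∈ univ \ (boundary T S).erase r ↔ (x ∈ boundary T S → x = r) := by
    intro x
    rw [mem_sdiff, mem_erase]
    constructor
    · exact fun h hx => not_not.1 fun hne => h.2 ⟨hne, hx⟩
    · exact fun h => ⟨mem_univ x, fun hx => hx.1 (h hx.2)⟩
  have hSA : ∀ x ∈ S, x ∈ univ \ (boundary T S).erase r := fun x hx =>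
    hmemA.2 fun hx' => absurd hx (mem_boundary.1 hx').1
  refine ⟨component T (univ \ (boundary T S).erase r) u, isSubtree_component hT (hSA u hu),
    ?_, r, u, ?_⟩
  · refine (card_le_card (t := (boundary T S).erase r) fun v hv => ?_).trans_lt
      (card_erase_lt_of_mem hr)
    obtain ⟨hvD, w, hw, ha⟩ := mem_boundary.1 hv
    by_contra hcon
    exact hvD (mem_component_of_adj hw ha (mem_sdiff.2 ⟨mem_univ v, hcon⟩))
  · ext y
    rw [mem_filter, ← onPath_iff_dist hT, mem_component_iff_onPath hT]
    constructor
    · intro hy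
      exact ⟨fun x hx => hSA x (hc y hy u hu x hx),
        fun hyr => (mem_boundary.1 hr).1 (hc u hu y hy r hyr)⟩
    · rintro ⟨h1, h2⟩
      -- The path from `u` to `y` cannot leave `S`: it would pass a boundary vertex.
      obtain ⟨p, hp⟩ := (hT.connected u y).exists_isPath
      have havoid : ∀ x ∈ p.support, x ∉ boundary T S := by
        intro x hx hxb
        have hon : OnPath T u y x := ⟨p, hp, hx⟩
        have := hmemA.1 (h1 x hon.symm) hxb
        exact h2 (this ▸ hon)
      clear h1 h2 hp
      induction p with
      | nil => exact hu
      | @cons a b c hab p ih =>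
        refine ih (not_not.1 fun hb => ?_) fun x hx => havoid x (by simp [hx])
        exact havoid b (by simp) (mem_boundary.2 ⟨hb, a, hu, hab⟩)

end Sides

namespace HubProgram

variable {n : ℕ} {T : SimpleGraph (Fin n)}

theorem familySize_mono (hn : 0 < n) : Monotone (familySize n) := by
  refine monotone_nat_of_le_succ fun j => ?_
  rw [familySize]
  exact ((Nat.le_mul_of_pos_right _ hn).trans (Nat.le_mul_of_pos_right _ hn)).trans
    (Nat.le_succ _)

/-- The vertex set whose indicator function is the row `j` of the array `5`. -/
def rowSet (n : ℕ) (σ : Store) (j : ℕ) : Finset (Fin n) :=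
  univ.filter fun x => σ.arr 5 (j * n + x) ≠ 0

/-- The rows `j < N` of the array `5` are indicator functions, of the empty set or of subtrees with
at most `k` boundary vertices, and all such subtrees occur. -/
structure IsFamily (T : SimpleGraph (Fin n)) (k N : ℕ) (σ : Store) : Prop where
  indicator : ∀ j < N, ∀ x : Fin n, σ.arr 5 (j * n + x) = if x ∈ rowSet n σ j then 1 else 0
  sound : ∀ j < N, rowSet n σ j = ∅ ∨
    IsSubtree T (rowSet n σ j) ∧ (boundary T (rowSet n σ j)).card ≤ k
  complete : ∀ S, IsSubtree T S → (boundary T S).card ≤ k → ∃ j < N, rowSet n σ j = S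

theorem rowSet_succ (hT : T.IsTree) {N : ℕ} {σ : Store} (h : RowsUpTo T (N * n * n) σ) {i : ℕ}
    (hi : i < N) (r u : Fin n) :
    rowSet n σ ((i * n + r) * n + u + 1) =
      (rowSet n σ i).filter fun x => ¬ T.dist u r + T.dist r x = T.dist u x := by
  have hlt : (i * n + r) * n + u < N * n * n := by
    have h1 : i * n + r < N * n := by
      have := Nat.mul_le_mul_right n hi
      rw [Nat.succ_mul] at this
      have := r.2
      omega
    have := Nat.mul_le_mul_right n h1
    rw [Nat.succ_mul] at this
    have := u.2
    omega
  ext x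
  rw [mem_filter, rowSet, rowSet, mem_filter, mem_filter, h.2 i r u x hlt]
  have := hT.connected.dist_triangle (u := u) (v := r) (w := x)
  split_ifs with hd
  · simp only [mem_univ, ne_eq, not_true, and_false, true_and, false_iff, not_and, not_not]
    exact fun _ => le_antisymm hd this
  · simp only [mem_univ, ne_eq, true_and]
    exact ⟨fun h => ⟨h, fun he => hd he.le⟩, fun h => h.1⟩

theorem isFamily_of_rowsUpTo (hT : T.IsTree) {k : ℕ} {σ : Store}
    (h : RowsUpTo T (familySize n k * n * n) σ) : IsFamily T k (familySize n k) σ := by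
  have hn : 0 < n := by
    obtain ⟨x⟩ := hT.connected.nonempty
    exact x.pos
  have hmono := familySize_mono hn
  have h0 : rowSet n σ 0 = univ := by
    ext x
    simp [rowSet, h.1 x]
  -- Every row but the first one comes from an earlier row.
  have hsplit : ∀ m, ∀ j < familySize n (m + 1), j = 0 ∨
      ∃ i < familySize n m, ∃ r u : Fin n, j = (i * n + r) * n + u + 1 := by
    intro m j hj
    rcases j with _ | j
    · exact .inl rfl
    · refine .inr ⟨j / n / n, ?_, ⟨j / n % n, Nat.mod_lt _ hn⟩, ⟨j % n, Nat.mod_lt _ hn⟩, ?_⟩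
      · rw [familySize] at hj
        rw [Nat.div_lt_iff_lt_mul hn, Nat.div_lt_iff_lt_mul hn]
        omega
      · simp only
        rw [Nat.div_add_mod', Nat.div_add_mod']
  have hsound : ∀ m ≤ k, ∀ j < familySize n m,
      (∀ x : Fin n, σ.arr 5 (j * n + x) = if x ∈ rowSet n σ j then 1 else 0) ∧
      (rowSet n σ j = ∅ ∨ IsSubtree T (rowSet n σ j) ∧ (boundary T (rowSet n σ j)).card ≤ m) := by
    have hzero : (∀ x : Fin n, σ.arr 5 (0 * n + x) = if x ∈ rowSet n σ 0 then 1 else 0) := by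
      intro x
      rw [h0, zero_mul, zero_add, h.1 x, if_pos (mem_univ x)]
    have hzero' : IsSubtree T (rowSet n σ 0) ∧ (boundary T (rowSet n σ 0)).card = 0 := by
      rw [h0, boundary_univ]
      exact ⟨isSubtree_univ hT, card_empty⟩
    intro m
    induction m with
    | zero =>
      intro _ j hj
      obtain rfl : j = 0 := by simpa [familySize] using hj
      exact ⟨hzero, .inr ⟨hzero'.1, hzero'.2.le⟩⟩
    | succ m ih =>
      intro hm j hj
      rcases hsplit m j hj with rfl | ⟨i, hi, r, u, rfl⟩
      · exact ⟨hzero, .inr ⟨hzero'.1, hzero'.2.le.trans (Nat.zero_le _)⟩⟩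
      · have hik := hi.trans_le (hmono (by omega : m ≤ k))
        obtain ⟨h1, h2⟩ := ih (by omega) i hi
        have hrow := rowSet_succ hT h hik r u
        constructor
        · intro x
          by_cases hx : x ∈ rowSet n σ ((i * n + r) * n + u + 1)
          · rw [if_pos hx]
            have hx1 := hx
            rw [hrow, mem_filter] at hx1
            have hx2 := (mem_filter.1 hx).2
            have hlt : (i * n + r) * n + u < familySize n k * n * n := by
              have := hj.trans_le (hmono hm)
              have h3 := hmono hm
              rw [familySize] at hj h3
              have h4 := hmono (by omega : m ≤ k)
              have h5 := Nat.mul_le_mul_right n (Nat.mul_le_mul_right n h4)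
              omega
            rw [h.2 i r u x hlt] at hx2 ⊢
            split_ifs at hx2 ⊢
            · exact absurd rfl hx2
            · rw [h1 x, if_pos hx1.1]
          · rw [if_neg hx]
            simpa [rowSet] using hx
        · rw [hrow]
          rcases h2 with h2 | ⟨h2, h3⟩
          · left; rw [h2]; rfl
          · refine (isSubtree_filter_dist hT h2 r u).imp_right fun h4 => ⟨h4.1, ?_⟩
            omega
  have hcomplete : ∀ m ≤ k, ∀ S, IsSubtree T S → (boundary T S).card ≤ m →
      ∃ j < familySize n m, rowSet n σ j = S := by
    have hpos : ∀ m, 0 < familySize n m := fun m => by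
      cases m <;> simp [familySize]
    intro m
    induction m with
    | zero =>
      intro _ S hS hb
      refine ⟨0, hpos _, ?_⟩
      rw [h0, eq_univ_of_boundary_eq_empty hT ((isSubtree_iff hT).1 hS).1
        (card_eq_zero.1 (by omega))]
    | succ m ih =>
      intro hm S hS hb
      rcases (boundary T S).eq_empty_or_nonempty with he | hne
      · refine ⟨0, hpos _, ?_⟩
        rw [h0, eq_univ_of_boundary_eq_empty hT ((isSubtree_iff hT).1 hS).1 he]
      · obtain ⟨S', hS', hlt, r, u, rfl⟩ := exists_filter_dist_eq hT hS hne
        obtain ⟨i, hi, rfl⟩ := ih (by omega) S' hS' (by omega)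
        refine ⟨(i * n + r) * n + u + 1, ?_,
          rowSet_succ hT h (hi.trans_le (hmono (by omega : m ≤ k))) r u⟩
        rw [familySize]
        have h1 : i * n + r + 1 ≤ familySize n m * n := by
          have := Nat.mul_le_mul_right n hi
          rw [Nat.succ_mul] at this
          have := r.2
          omega
        have := Nat.mul_le_mul_right n h1
        rw [Nat.succ_mul] at this
        have := u.2
        omega
  exact ⟨fun j hj => (hsound k le_rfl j hj).1, fun j hj => (hsound k le_rfl j hj).2,
    hcomplete k le_rfl⟩

end HubProgram

/-! ### The table of the dynamic program -/

namespace HubProgram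

open Cmd Expr

variable {n : ℕ} {T : SimpleGraph (Fin n)}

theorem exec_sumVertices_finset {x acc : ℕ} {c e : Expr} (hx : x ≠ 0) (ha : acc ≠ 0)
    (hxa : acc ≠ x) (hx3 : x ≠ 3) (hc : c.ignores acc = true) (he : e.ignores acc = true)
    {σ : Store} (hn : σ.reg 0 = n) (D : Finset (Fin n)) (f : Fin n → ℕ)
    (hD : ∀ i : Fin n, 1 ≤ c.eval (σ.setReg x i) ↔ i ∈ D)
    (hf : ∀ i ∈ D, e.eval (σ.setReg x i) = f i) :
    (sumVertices x acc c e).exec σ = (σ.setReg acc (∑ i ∈ D, f i)).setReg x n := by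
  rw [exec_sumVertices hx ha hxa hx3 hc he, hn, Finset.sum_range]
  congr 2
  rw [← sum_filter]
  refine sum_congr ?_ fun i hi => hf i ?_
  · ext i; simp [hD]
  · simpa [hD] using hi

/-- The number whose binary digits are the indicator function of `S`; it is the address of `S` in
the table of the dynamic program. -/
def mask (S : Finset (Fin n)) : ℕ := ∑ x ∈ S, 2 ^ (x : ℕ)

theorem mask_injective : Function.Injective (mask (n := n)) := by
  intro S S' h
  have h1 : ∀ S : Finset (Fin n), mask S = ∑ i ∈ S.map Fin.valEmbedding, 2 ^ i := fun S => by
    simp [mask]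
  rw [h1, h1] at h
  exact map_injective _ (geomSum_injective le_rfl h)

/-- Whether the vertex in register `x` belongs to the set whose row starts at the value of
register `15`. -/
abbrev mem (x : ℕ) : Expr := .load 5 (.add (.reg 15) (.reg x))

/-- Whether the vertex in register `13` belongs to the current set, and the vertex in register `17`
does not lie between the vertices in the registers `12` and `13`. -/
abbrev onSide : Expr :=
  .sub (.add (mem 13) (.sub (.lit 1) (.sub (.lit 1)
    (.sub (.add (entry 4 12 17) (entry 4 17 13)) (entry 4 12 13))))) (.lit 1)

/-- Array `8` receives, for every vertex, the number of its neighbours outside the current set. -/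
def computeWeights : Cmd :=
  forVertices 13 <| .seq
    (sumVertices 14 10 (.sub (.add (entry 0 13 14) (.sub (.lit 1) (mem 14))) (.lit 1)) (.lit 1))
    (.store 8 (.reg 13) (.reg 10))

/-- The contribution of the component of the vertex in register `12`, after the removal of the
vertex in register `17`: the table entry is added to register `26`, and register `27` counts the
components with more than half of `k` boundary edges. -/
def addSide : Cmd :=
  .seq (sumVertices 13 28 onSide (.load 3 (.reg 13))) <|
  .seq (sumVertices 13 29 onSide (.load 8 (.reg 13))) <|
  .seq (.assign 26 (.add (.reg 26) (.load 6 (.reg 28)))) <|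
  .ifLe (.add (.reg 1) (.lit 1)) (.add (.reg 29) (.reg 29))
    (.assign 27 (.add (.reg 27) (.lit 1))) skip

/-- The contributions of all components that remain after the removal of the vertex in
register `17`. -/
def evalRoot : Cmd :=
  .seq (.assign 26 (.lit 0)) <| .seq (.assign 27 (.lit 0)) <| forVertices 12 <|
    whenPos (.sub (.add (mem 12) (entry 0 17 12)) (.lit 1)) addSide

/-- Make the vertex in register `17` the current choice: register `22` records that there is one,
and the registers `23`, `24` and `25` hold its key, its value and the vertex. -/
def select : Cmd :=
  .seq (.assign 22 (.lit 1)) <| .seq (.assign 23 (.reg 30)) <|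
  .seq (.assign 24 (.reg 26)) (.assign 25 (.reg 17))

/-- Compare the vertex in register `17` with the current choice. The key (register `30`) is the
number of heavy components if the boundary (register `21`) has size `k`, and the sum of the table
entries otherwise. -/
def compareRoot : Cmd :=
  .seq evalRoot <|
  .seq (.ifLe (.reg 1) (.reg 21) (.assign 30 (.reg 27)) (.assign 30 (.reg 26))) <|
  .ifLe (.reg 22) (.lit 0) select
    (.ifLe (.add (.reg 30) (.lit 1)) (.reg 23) select skip)

/-- Find a vertex of the current set with the least key. -/
def searchRoot : Cmd :=
  .seq (.assign 22 (.lit 0)) <| forVertices 17 <| whenPos (mem 17) compareRoot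

/-- Write the entries of the current set, whose size is in register `19` and whose address is in
register `20`: `k` times the value of the recurrence to array `6`, and the removed vertex to
array `7`. -/
def writeEntry : Cmd :=
  .seq (sumVertices 13 31 (mem 13) (.add (.reg 1) (.lit 4))) <|
  .seq (.ifLe (.reg 19) (.lit 1) (.store 6 (.reg 20) (.reg 1)) <|
    .ifLe (.reg 19) (.lit 2) (.store 6 (.reg 20) (.add (.reg 1) (.add (.reg 1) (.reg 1)))) <|
    .ifLe (.reg 1) (.reg 21) (.store 6 (.reg 20) (.reg 24))
      (.store 6 (.reg 20) (.add (.reg 31) (.reg 24)))) <|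
  .store 7 (.reg 20) (.reg 25)

/-- The table entries of the current set. -/
def solveRow : Cmd :=
  .seq computeWeights <|
  .seq (sumVertices 13 20 (mem 13) (.load 3 (.reg 13))) <|
  .seq (sumVertices 13 21 (mem 13) (.load 8 (.reg 13))) <|
  .seq searchRoot writeEntry

/-- Treat the current set if its size is the value of register `18` plus `1`. -/
def processRow : Cmd :=
  .seq (sumVertices 13 19 (mem 13) (.lit 1)) <|
  .ifLe (.reg 19) (.reg 18) skip <|
  .ifLe (.add (.reg 18) (.lit 2)) (.reg 19) skip solveRow

/-- The dynamic program: the sets of the family are treated by increasing size. -/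
def fillTable : Cmd :=
  forVertices 18 <| .seq (.assign 15 (.lit 0)) <|
    .loop (.reg 2) <| .seq processRow (.assign 15 (.add (.reg 15) (.reg 0)))

/-- The tables are in place, and `S` is the current set. -/
structure AtRow (T : SimpleGraph (Fin n)) (k : ℕ) (S : Finset (Fin n)) (σ : Store) : Prop where
  tables : HasTables T σ
  reg_one : σ.reg 1 = k
  row : ∀ x : Fin n, σ.arr 5 (σ.reg 15 + x) = if x ∈ S then 1 else 0

theorem AtRow.congr {k : ℕ} {S : Finset (Fin n)} {σ τ : Store} (h : AtRow T k S σ)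
    (hr : ∀ x ∈ [0, 1, 15], τ.reg x = σ.reg x)
    (ha : ∀ a ∈ [0, 2, 3, 4, 5], τ.arr a = σ.arr a) : AtRow T k S τ where
  tables := h.tables.congr (hr 0 (by simp)) fun a h => ha a (by revert h; simp; tauto)
  reg_one := by rw [hr 1 (by simp), h.reg_one]
  row := by rw [hr 15 (by simp), ha 5 (by simp)]; exact h.row

theorem AtRow.setReg {k : ℕ} {S : Finset (Fin n)} {σ : Store} (h : AtRow T k S σ) {x : ℕ}
    (hx : x ∉ [0, 1, 15]) (v : ℕ) : AtRow T k S (σ.setReg x v) :=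
  h.congr (fun y hy => by
    rw [Store.setReg_reg, if_neg]
    rintro rfl
    exact hx hy) (by simp)

/-- The value of the recurrence in `k`-fold integral units, apart from the term for `S` itself. -/
noncomputable def rootValue (T : SimpleGraph (Fin n)) (β : Finset (Fin n) → ℕ)
    (S : Finset (Fin n)) (r : Fin n) : ℕ :=
  ∑ D ∈ components T (S.erase r), β D

/-- The number of components of `S - r` with more than `k / 2` boundary edges. -/
noncomputable def heavyCount (T : SimpleGraph (Fin n)) (k : ℕ) (S : Finset (Fin n))
    (r : Fin n) : ℕ :=
  ∑ D ∈ components T (S.erase r), if k + 1 ≤ 2 * ∑ x ∈ D, boundaryWeight T S x then 1 else 0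

theorem boundaryWeight_eq_card {S : Finset (Fin n)} {u : Fin n} [DecidablePred (T.Adj u)]
    (hu : u ∈ S) : boundaryWeight T S u = (univ.filter fun v => T.Adj u v ∧ v ∉ S).card := by
  classical
  rw [boundaryWeight]
  congr 1
  ext v
  simp only [mem_filter, mem_boundary, mem_univ, true_and]
  constructor
  · rintro ⟨⟨h1, -⟩, h2⟩
    exact ⟨h2, h1⟩
  · rintro ⟨h1, h2⟩
    exact ⟨⟨h2, u, hu, h1⟩, h1⟩

section Steps

variable {k : ℕ} {S : Finset (Fin n)}

theorem exec_computeWeights {σ : Store} (h : AtRow T k S σ) :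
    ∀ u ∈ S, (computeWeights.exec σ).arr 8 u = boundaryWeight T S u := by
  classical
  have := exec_forVertices_induct (x := 13) (σ := σ)
    (p := .seq
      (sumVertices 14 10 (.sub (.add (entry 0 13 14) (.sub (.lit 1) (mem 14))) (.lit 1)) (.lit 1))
      (.store 8 (.reg 13) (.reg 10))) (by decide) (by decide)
    (fun i τ => ∀ u ∈ S, (u : ℕ) < i → τ.arr 8 u = boundaryWeight T S u) (by simp) (by
      intro i hi τ hI hx hreg harr u hu hui
      rw [h.tables.reg_zero] at hi
      have hτ : AtRow T k S τ := h.congr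
        (fun y hy => by fin_cases hy <;> exact hreg _ (by decide) rfl)
        (fun a ha => by fin_cases ha <;> exact harr _ rfl)
      rw [exec_seq, exec_sumVertices_finset (by decide) (by decide) (by decide) (by decide) rfl rfl
        hτ.tables.reg_zero (univ.filter fun v => T.Adj ⟨i, hi⟩ v ∧ v ∉ S) (fun _ => 1)]
      · by_cases hue : (u : ℕ) = i
        · obtain rfl : u = ⟨i, hi⟩ := Fin.ext hue
          simp [Expr.eval, hx, boundaryWeight_eq_card hu]
        · simpa [Expr.eval, hx, hue] using hI u hu (by omega)
      · intro v
        have h1 := hτ.row v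
        have h2 := hτ.tables.row ⟨i, hi⟩
        have h3 := hτ.tables.adj ⟨i, hi⟩ v
        simp only at h2 h3
        simp only [Expr.eval, Store.setReg_reg, Store.setReg_arr, if_true, hx, h1, h2, h3,
          mem_filter, mem_univ, true_and, Nat.reduceEqDiff, if_false]
        split_ifs <;> simp_all
      · intro _ _
        rfl)
  rw [h.tables.reg_zero] at this
  exact fun u hu => this u hu u.2

theorem eval_onSide (hT : T.IsTree) (hS : PathConvex T S) {σ : Store} (h : AtRow T k S σ)
    {r u x : Fin n} (huS : u ∈ S) (hr : σ.reg 17 = r) (hu : σ.reg 12 = u) (hx : σ.reg 13 = x) :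
    1 ≤ onSide.eval σ ↔ x ∈ component T (S.erase r) u := by
  have h2 := hT.connected.dist_triangle (u := u) (v := r) (w := x)
  rw [component_erase_eq hT hS huS, mem_filter]
  simp only [Expr.eval, hr, hu, hx, h.row, h.tables.row, h.tables.dist]
  split_ifs with h3
  · simp only [h3, true_and]
    omega
  · simp only [h3, false_and, iff_false]
    omega

theorem exec_addSide (hT : T.IsTree) (hS : PathConvex T S) {σ : Store} (h : AtRow T k S σ)
    {w : Fin n → ℕ} (hw : ∀ x ∈ S, σ.arr 8 x = w x) {r u : Fin n} (hu : u ∈ S)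
    (hr : σ.reg 17 = r) (hu' : σ.reg 12 = u) :
    (addSide.exec σ).reg 26 = σ.reg 26 + σ.arr 6 (mask (component T (S.erase r) u)) ∧
      (addSide.exec σ).reg 27 = σ.reg 27 +
        if k + 1 ≤ 2 * ∑ x ∈ component T (S.erase r) u, w x then 1 else 0 := by
  have hsub : component T (S.erase r) u ⊆ S := (component_subset _ _).trans (erase_subset _ _)
  rw [addSide, exec_seq, exec_sumVertices_finset (by decide) (by decide) (by decide) (by decide)
    rfl rfl h.tables.reg_zero (component T (S.erase r) u) (fun x => 2 ^ (x : ℕ))]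
  · rw [exec_seq, exec_sumVertices_finset (by decide) (by decide) (by decide) (by decide)
      rfl rfl (by simp [h.tables.reg_zero]) (component T (S.erase r) u) w]
    · change (_ : ℕ) = _ + σ.arr 6 (∑ x ∈ component T (S.erase r) u, 2 ^ (x : ℕ)) ∧ _
      simp only [exec_seq, exec_assign, exec_ifLe, exec_skip, Expr.eval, Store.setReg_reg,
        Store.setReg_arr]
      have h1 := h.reg_one
      simp only [← two_mul]
      by_cases hk : k + 1 ≤ 2 * ∑ x ∈ component T (S.erase r) u, w x <;> simp [h1, hk]
    · intro x
      exact eval_onSide hT hS (((h.setReg (by decide) _).setReg (by decide) _).setReg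
        (by decide) _) hu (by simp [hr]) (by simp [hu']) (by simp)
    · intro x hx
      simp [Expr.eval, hw x (hsub hx)]
  · intro x
    exact eval_onSide hT hS (h.setReg (by decide) _) hu (by simp [hr]) (by simp [hu']) (by simp)
  · intro x _
    simp [Expr.eval, h.tables.pow]

theorem exec_evalRoot (hT : T.IsTree) (hS : PathConvex T S) {σ : Store} (h : AtRow T k S σ)
    (hw : ∀ x ∈ S, σ.arr 8 x = boundaryWeight T S x) {r : Fin n} (hrS : r ∈ S)
    (hr : σ.reg 17 = r) :
    (evalRoot.exec σ).reg 26 = rootValue T (fun D => σ.arr 6 (mask D)) S r ∧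
      (evalRoot.exec σ).reg 27 = heavyCount T k S r := by
  classical
  let g₁ : Fin n → ℕ := fun u => if u ∈ S ∧ T.Adj r u then
    σ.arr 6 (mask (component T (S.erase r) u)) else 0
  let g₂ : Fin n → ℕ := fun u => if u ∈ S ∧ T.Adj r u then
    if k + 1 ≤ 2 * ∑ x ∈ component T (S.erase r) u, boundaryWeight T S x then 1 else 0 else 0
  have hs : ∀ g : Fin n → ℕ, ∑ j ∈ range n, (if hj : j < n then g ⟨j, hj⟩ else 0) = ∑ u, g u := by
    intro g
    rw [Finset.sum_range]
    simp
  have := exec_forVertices_induct (x := 12) (σ := (σ.setReg 26 0).setReg 27 0)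
    (p := whenPos (.sub (.add (mem 12) (entry 0 17 12)) (.lit 1)) addSide) (by decide) (by decide)
    (fun i τ => τ.reg 26 = ∑ j ∈ range i, (if hj : j < n then g₁ ⟨j, hj⟩ else 0) ∧
      τ.reg 27 = ∑ j ∈ range i, (if hj : j < n then g₂ ⟨j, hj⟩ else 0)) (by simp) (by
      rintro i hi τ ⟨h1, h2⟩ hx hreg harr
      replace hi : i < n := by simpa [h.tables.reg_zero] using hi
      have hτ : AtRow T k S τ := h.congr
        (fun y hy => by
          fin_cases hy <;> exact (hreg _ (by decide) rfl).trans (by simp))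
        (fun a ha => by fin_cases ha <;> exact (harr _ rfl).trans (by simp))
      have hr' : τ.reg 17 = r := (hreg 17 (by decide) rfl).trans (by simpa using hr)
      have h8 : τ.arr 8 = σ.arr 8 := harr 8 rfl
      have h6 : τ.arr 6 = σ.arr 6 := harr 6 rfl
      have h3 := hτ.row ⟨i, hi⟩
      have h4 := hτ.tables.row r
      have h5 := hτ.tables.adj r ⟨i, hi⟩
      simp only at h3 h5
      have h7 : 1 ≤ (Expr.sub (.add (mem 12) (entry 0 17 12)) (.lit 1)).eval τ ↔
          (⟨i, hi⟩ : Fin n) ∈ S ∧ T.Adj r ⟨i, hi⟩ := by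
        simp only [Expr.eval, hr', hx, h3, h4, h5]
        split_ifs <;> simp_all
      rw [sum_range_succ, sum_range_succ, dif_pos hi, dif_pos hi, exec_whenPos]
      by_cases hc : (⟨i, hi⟩ : Fin n) ∈ S ∧ T.Adj r ⟨i, hi⟩
      · obtain ⟨h9, h10⟩ := exec_addSide hT hS hτ (w := boundaryWeight T S)
          (by rw [h8]; exact hw) hc.1 hr' (u := ⟨i, hi⟩) hx
        rw [if_pos (h7.2 hc)]
        simp only [Store.setReg_reg]
        rw [if_neg (by decide), if_neg (by decide), h9, h10, h1, h2, h6]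
        simp only [g₁, g₂, if_pos hc]
        exact ⟨trivial, trivial⟩
      · rw [if_neg (mt h7.1 hc)]
        simpa [g₁, g₂, hc] using ⟨h1, h2⟩)
  have h0 : ((σ.setReg 26 0).setReg 27 0).reg 0 = n := by simpa using h.tables.reg_zero
  rw [h0, hs, hs] at this
  rw [rootValue, heavyCount, sum_components_erase hT hS hrS, sum_components_erase hT hS hrS,
    sum_filter, sum_filter]
  simp only [g₁, g₂] at this
  have h1 : ∀ f : Fin n → ℕ, ∑ u, (if u ∈ S ∧ T.Adj r u then f u else 0) =
      ∑ u ∈ S, if T.Adj r u then f u else 0 := fun f => by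
    rw [← sum_filter, ← sum_filter]
    refine sum_congr ?_ fun _ _ => rfl
    ext u
    simp
  rw [h1, h1] at this
  exact this

end Steps

variable {k : ℕ} {S : Finset (Fin n)}

/-- The quantity that the chosen vertex minimizes, for a boundary of size `b`. -/
noncomputable def rootKey (T : SimpleGraph (Fin n)) (k b : ℕ) (β : Finset (Fin n) → ℕ)
    (S : Finset (Fin n)) (r : Fin n) : ℕ :=
  if k ≤ b then heavyCount T k S r else rootValue T β S r

/-- The entry of `S` in the table of the dynamic program that is stored in the array `6`. -/
def tableEntry (σ : Store) (S : Finset (Fin n)) : ℕ := σ.arr 6 (mask S)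

/-- The registers of the search hold a vertex of least key among the first `i` vertices. -/
def SearchUpTo (T : SimpleGraph (Fin n)) (k b : ℕ) (β : Finset (Fin n) → ℕ)
    (S : Finset (Fin n)) (i : ℕ) (τ : Store) : Prop :=
  (τ.reg 22 = 0 ∧ ∀ r ∈ S, ¬ (r : ℕ) < i) ∨
    (τ.reg 22 = 1 ∧ ∃ r ∈ S, τ.reg 25 = r ∧ τ.reg 24 = rootValue T β S r ∧
      τ.reg 23 = rootKey T k b β S r ∧
      ∀ r' ∈ S, (r' : ℕ) < i → rootKey T k b β S r ≤ rootKey T k b β S r')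

theorem exec_compareRoot (hT : T.IsTree) (hS : PathConvex T S) {σ : Store} (h : AtRow T k S σ)
    (hw : ∀ x ∈ S, σ.arr 8 x = boundaryWeight T S x) {r : Fin n} (hrS : r ∈ S)
    (hr : σ.reg 17 = r) (hI : SearchUpTo T k (σ.reg 21) (tableEntry σ) S r σ) :
    SearchUpTo T k (σ.reg 21) (tableEntry σ) S (r + 1) (compareRoot.exec σ) := by
  obtain ⟨h26, h27⟩ := exec_evalRoot hT hS h hw hrS hr
  have hf : ∀ y ∈ [1, 17, 21, 22, 23, 24, 25], (evalRoot.exec σ).reg y = σ.reg y := fun y hy => by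
    fin_cases hy <;> exact exec_reg_of_keepsReg (by decide) σ
  simp only [List.forall_mem_cons] at hf
  obtain ⟨f1, f17, f21, f22, f23, f24, f25, -⟩ := hf
  change _ = rootValue T (tableEntry σ) S r at h26
  simp only [compareRoot, exec_seq]
  set τ := evalRoot.exec σ
  have hkey : (Cmd.ifLe (.reg 1) (.reg 21) (.assign 30 (.reg 27))
      (.assign 30 (.reg 26))).exec τ = τ.setReg 30 (rootKey T k (σ.reg 21) (tableEntry σ) S r) := by
    simp only [exec_ifLe, exec_assign, Expr.eval, f1, f21, h.reg_one, h26, h27, rootKey]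
    split_ifs <;> rfl
  rw [hkey]
  have hsel : SearchUpTo T k (σ.reg 21) (tableEntry σ) S (r + 1)
      (select.exec (τ.setReg 30 (rootKey T k (σ.reg 21) (tableEntry σ) S r))) ↔
      ∀ r' ∈ S, (r' : ℕ) < r →
        rootKey T k (σ.reg 21) (tableEntry σ) S r ≤ rootKey T k (σ.reg 21) (tableEntry σ) S r' := by
    simp only [SearchUpTo, select, exec_seq, exec_assign, Expr.eval, Store.setReg_reg,
      Nat.reduceEqDiff, if_true, if_false, f17, hr, h26, one_ne_zero, false_and, true_and,
      false_or]
    constructor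
    · rintro ⟨r₁, h1, h2, h3, h4, h5⟩ r' hr' hlt
      rw [h4]
      exact h5 r' hr' (by omega)
    · intro h1
      refine ⟨r, hrS, rfl, rfl, rfl, fun r' hr' hlt => ?_⟩
      rcases Nat.lt_succ_iff_lt_or_eq.1 hlt with hlt | heq
      · exact h1 r' hr' hlt
      · rw [Fin.ext heq]
  simp only [exec_ifLe, exec_skip, Expr.eval, Store.setReg_reg, Nat.reduceEqDiff, if_true,
    if_false, f22, f23]
  rcases hI with ⟨h1, h2⟩ | ⟨h1, r₁, h2, h3, h4, h5, h6⟩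
  · rw [h1, if_pos le_rfl, hsel]
    exact fun r' hr' hlt => absurd hlt (h2 r' hr')
  · rw [h1, h5, if_neg (by omega)]
    split_ifs with hlt
    · rw [hsel]
      exact fun r' hr' hlt' => (Nat.le_of_succ_le hlt).trans (h6 r' hr' hlt')
    · refine .inr ⟨by simp [f22, h1], r₁, h2, by simp [f25, h3], by simp [f24, h4],
        by simp [f23, h5], fun r' hr' hlt' => ?_⟩
      rcases Nat.lt_succ_iff_lt_or_eq.1 hlt' with hlt' | heq
      · exact h6 r' hr' hlt'
      · rw [Fin.ext heq]
        omega

theorem exec_searchRoot (hT : T.IsTree) (hS : IsSubtree T S) {σ : Store} (h : AtRow T k S σ)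
    (hw : ∀ x ∈ S, σ.arr 8 x = boundaryWeight T S x) :
    ∃ r ∈ S, (searchRoot.exec σ).reg 25 = r ∧
      (searchRoot.exec σ).reg 24 = rootValue T (tableEntry σ) S r ∧
      ∀ r' ∈ S, rootKey T k (σ.reg 21) (tableEntry σ) S r ≤
        rootKey T k (σ.reg 21) (tableEntry σ) S r' := by
  obtain ⟨⟨x, hx⟩, hc⟩ := (isSubtree_iff hT).1 hS
  have := exec_forVertices_induct (x := 17) (σ := σ.setReg 22 0)
    (p := whenPos (mem 17) compareRoot) (by decide) (by decide)
    (fun i τ => SearchUpTo T k (σ.reg 21) (tableEntry σ) S i τ) (by simp [SearchUpTo]) (by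
      intro i hi τ hI hx hreg harr
      replace hi : i < n := by simpa [h.tables.reg_zero] using hi
      have hτ : AtRow T k S τ := h.congr
        (fun y hy => by
          fin_cases hy <;> exact (hreg _ (by decide) rfl).trans (by simp))
        (fun a ha => by fin_cases ha <;> exact (harr _ rfl).trans (by simp))
      have h8 : τ.arr 8 = σ.arr 8 := harr 8 rfl
      have h6 : tableEntry τ = tableEntry (n := n) σ := by
        funext D
        exact congrFun (harr 6 rfl) (mask D)
      have h21 : τ.reg 21 = σ.reg 21 := (hreg 21 (by decide) rfl).trans (by simp)
      have hreg' : ∀ {τ' : Store}, SearchUpTo T k (σ.reg 21) (tableEntry σ) S (i + 1) τ' →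
          SearchUpTo T k (σ.reg 21) (tableEntry σ) S (i + 1) (τ'.setReg 17 (i + 1)) := by
        intro τ' h'
        simpa [SearchUpTo] using h'
      refine hreg' ?_
      have h3 := hτ.row ⟨i, hi⟩
      simp only at h3
      simp only [exec_whenPos, Expr.eval, hx, h3]
      by_cases hiS : (⟨i, hi⟩ : Fin n) ∈ S
      · rw [if_pos hiS, if_pos le_rfl]
        have := exec_compareRoot hT hc hτ (by rw [h8]; exact hw) hiS hx
        rw [h21, h6] at this
        exact this hI
      · rw [if_neg hiS, if_neg (by decide)]
        have hne : ∀ r' ∈ S, (r' : ℕ) < i + 1 → (r' : ℕ) < i := fun r' hr' hlt =>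
          lt_of_le_of_ne (Nat.le_of_lt_succ hlt) fun he =>
            hiS ((Fin.ext he : r' = ⟨i, hi⟩) ▸ hr')
        rcases hI with ⟨h1, h2⟩ | ⟨h1, r₁, h2, h4, h5, h7, h9⟩
        · exact .inl ⟨h1, fun r' hr' hlt => h2 r' hr' (hne r' hr' hlt)⟩
        · exact .inr ⟨h1, r₁, h2, h4, h5, h7, fun r' hr' hlt => h9 r' hr' (hne r' hr' hlt)⟩)
  have h0 : (σ.setReg 22 0).reg 0 = n := by simpa using h.tables.reg_zero
  rw [h0] at this
  rcases this with ⟨-, h1⟩ | ⟨-, r, h1, h2, h3, -, h4⟩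
  · exact absurd x.2 (h1 x hx)
  · exact ⟨r, h1, h2, h3, fun r' hr' => h4 r' hr' r'.2⟩

/-- The entries of the subtree `S` in the arrays `6` and `7` satisfy the recurrence of the dynamic
program (in `k`-fold integral units), relative to the entries of the smaller subtrees. -/
def Solved (T : SimpleGraph (Fin n)) (k : ℕ) (σ : Store) (S : Finset (Fin n)) : Prop :=
  ∃ r ∈ S, σ.arr 7 (mask S) = r ∧
    (S.card = 1 → tableEntry σ S = k) ∧
    (S.card = 2 → tableEntry σ S = 3 * k) ∧
    (3 ≤ S.card →
      ((boundary T S).card < k →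
        (∀ r' ∈ S, rootValue T (tableEntry σ) S r ≤ rootValue T (tableEntry σ) S r') ∧
        tableEntry σ S = S.card * (k + 4) + rootValue T (tableEntry σ) S r) ∧
      ((boundary T S).card = k → IsBalancedSeparator T S (boundaryWeight T S) r ∧
        tableEntry σ S = rootValue T (tableEntry σ) S r))

theorem rootValue_congr {β β' : Finset (Fin n) → ℕ} {r : Fin n} (hr : r ∈ S)
    (h : ∀ D, D.card < S.card → β D = β' D) : rootValue T β S r = rootValue T β' S r :=
  sum_congr rfl fun D hD => h D (card_lt_of_mem_components T hr hD)

theorem Solved.congr {σ τ : Store} (h : Solved T k σ S)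
    (h7 : τ.arr 7 (mask S) = σ.arr 7 (mask S)) (h6 : tableEntry τ S = tableEntry σ S)
    (hlt : ∀ D : Finset (Fin n), D.card < S.card → tableEntry τ D = tableEntry σ D) :
    Solved T k τ S := by
  obtain ⟨r, hr, h1, h2, h3, h4⟩ := h
  refine ⟨r, hr, h7.trans h1, fun h => h6.trans (h2 h), fun h => h6.trans (h3 h), fun h => ?_⟩
  rw [h6, rootValue_congr hr hlt]
  refine ⟨fun hb => ⟨fun r' hr' => ?_, ((h4 h).1 hb).2⟩, (h4 h).2⟩
  rw [rootValue_congr hr' hlt]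
  exact ((h4 h).1 hb).1 r' hr'

/-- A vertex with the least number of heavy components is a balanced separator vertex, since
there is one without heavy components. -/
theorem isBalancedSeparator_of_heavyCount_le (hT : T.IsTree) (hS : IsSubtree T S)
    (hb : (boundary T S).card = k) {r : Fin n} (hr : r ∈ S)
    (hmin : ∀ r' ∈ S, heavyCount T k S r ≤ heavyCount T k S r') :
    IsBalancedSeparator T S (boundaryWeight T S) r := by
  have hsum := sum_boundaryWeight hT ((isSubtree_iff hT).1 hS).2
  rw [hb] at hsum
  obtain ⟨r₀, hr₀, h0⟩ := exists_isBalancedSeparator hT hS (boundaryWeight T S)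
  have hz : heavyCount T k S r₀ = 0 := by
    refine sum_eq_zero fun D hD => if_neg ?_
    have := h0 D hD
    omega
  have hz' : heavyCount T k S r = 0 := Nat.le_zero.1 (hz ▸ hmin r₀ hr₀)
  refine ⟨hr, fun D hD => ?_⟩
  have := (sum_eq_zero_iff.1 hz') D hD
  split_ifs at this with h
  omega

theorem exec_writeEntry {σ : Store} (h : AtRow T k S σ) :
    (∀ m, (writeEntry.exec σ).arr 7 m = if m = σ.reg 20 then σ.reg 25 else σ.arr 7 m) ∧
    ∀ m, (writeEntry.exec σ).arr 6 m = if m = σ.reg 20 then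
      if σ.reg 19 ≤ 1 then k else if σ.reg 19 ≤ 2 then 3 * k else
        if k ≤ σ.reg 21 then σ.reg 24 else S.card * (k + 4) + σ.reg 24 else σ.arr 6 m := by
  rw [writeEntry, exec_seq, exec_sumVertices_finset (by decide) (by decide) (by decide)
    (by decide) rfl rfl h.tables.reg_zero S (fun _ => k + 4)]
  · have h1 := h.reg_one
    simp only [exec_seq, exec_ifLe, exec_store, Expr.eval, Store.setReg_reg,
      Nat.reduceEqDiff, if_false, if_true, h1, sum_const, smul_eq_mul]
    constructor
    · intro m
      rw [Store.setArr_arr]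
      split_ifs <;> simp_all
    · intro m
      rw [Store.setArr_arr]
      split_ifs <;> simp_all
      omega
  · intro x
    have := h.row x
    simp only [Expr.eval, Store.setReg_reg, Store.setReg_arr, Nat.reduceEqDiff, if_true, if_false,
      this]
    split_ifs with hx <;> simp [hx]
  · intro x _
    simp [Expr.eval, h.reg_one]

theorem exec_solveRow (hT : T.IsTree) (hS : IsSubtree T S) {σ : Store} (h : AtRow T k S σ)
    (hsize : σ.reg 19 = S.card) :
    Solved T k (solveRow.exec σ) S ∧
      ∀ m ≠ mask S, (solveRow.exec σ).arr 6 m = σ.arr 6 m ∧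
        (solveRow.exec σ).arr 7 m = σ.arr 7 m := by
  have hc := ((isSubtree_iff hT).1 hS).2
  have hw := exec_computeWeights h
  have e1 : AtRow T k S (computeWeights.exec σ) := h.congr
    (fun y hy => by fin_cases hy <;> exact exec_reg_of_keepsReg (by decide) σ)
    (fun a ha => by fin_cases ha <;> exact exec_arr_of_keepsArr (by decide) σ)
  have f6 : (computeWeights.exec σ).arr 6 = σ.arr 6 := exec_arr_of_keepsArr (by decide) σ
  have f7 : (computeWeights.exec σ).arr 7 = σ.arr 7 := exec_arr_of_keepsArr (by decide) σ
  have f19 : (computeWeights.exec σ).reg 19 = S.card :=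
    (exec_reg_of_keepsReg (by decide) σ).trans hsize
  simp only [solveRow, exec_seq]
  set σ₁ := computeWeights.exec σ
  have hcond : ∀ {τ : Store}, AtRow T k S τ → ∀ x : Fin n,
      1 ≤ (mem 13).eval (τ.setReg 13 x) ↔ x ∈ S := by
    intro τ hτ x
    have := hτ.row x
    simp only [Expr.eval, Store.setReg_reg, Store.setReg_arr, Nat.reduceEqDiff, if_true, if_false,
      this]
    split_ifs with hx <;> simp [hx]
  rw [exec_sumVertices_finset (by decide) (by decide) (by decide) (by decide) rfl rfl
    e1.tables.reg_zero S (fun x => 2 ^ (x : ℕ)) (hcond e1)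
    (fun x _ => by simp [Expr.eval, e1.tables.pow])]
  change Solved T k (writeEntry.exec (searchRoot.exec ((sumVertices 13 21 (mem 13)
    (.load 8 (.reg 13))).exec ((σ₁.setReg 20 (mask S)).setReg 13 n)))) S ∧
    ∀ m ≠ mask S, (writeEntry.exec (searchRoot.exec ((sumVertices 13 21 (mem 13)
      (.load 8 (.reg 13))).exec ((σ₁.setReg 20 (mask S)).setReg 13 n)))).arr 6 m = σ.arr 6 m ∧
    (writeEntry.exec (searchRoot.exec ((sumVertices 13 21 (mem 13)
      (.load 8 (.reg 13))).exec ((σ₁.setReg 20 (mask S)).setReg 13 n)))).arr 7 m = σ.arr 7 m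
  have e2 : AtRow T k S ((σ₁.setReg 20 (mask S)).setReg 13 n) :=
    (e1.setReg (by decide) _).setReg (by decide) _
  rw [exec_sumVertices_finset (by decide) (by decide) (by decide) (by decide) rfl rfl
    e2.tables.reg_zero S (boundaryWeight T S) (hcond e2)
    (fun x hx => by simp [Expr.eval, hw x hx]), sum_boundaryWeight hT hc]
  set σ₂ := (((σ₁.setReg 20 (mask S)).setReg 13 n).setReg 21 (boundary T S).card).setReg 13 n
    with hσ₂
  have e3 : AtRow T k S σ₂ := (e2.setReg (by decide) _).setReg (by decide) _
  have hentry : tableEntry (n := n) σ₂ = tableEntry σ := by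
    funext D
    exact congrFun f6 (mask D)
  obtain ⟨r, hr, h25, h24, hmin⟩ := exec_searchRoot hT hS e3 hw
  have g21 : σ₂.reg 21 = (boundary T S).card := by simp [hσ₂]
  rw [g21, hentry] at hmin
  rw [hentry] at h24
  have e4 : AtRow T k S (searchRoot.exec σ₂) := e3.congr
    (fun y hy => by fin_cases hy <;> exact exec_reg_of_keepsReg (by decide) σ₂)
    (fun a ha => by fin_cases ha <;> exact exec_arr_of_keepsArr (by decide) σ₂)
  have g19 : (searchRoot.exec σ₂).reg 19 = S.card :=
    (exec_reg_of_keepsReg (by decide) σ₂).trans (by simp [hσ₂, f19])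
  have g20 : (searchRoot.exec σ₂).reg 20 = mask S :=
    (exec_reg_of_keepsReg (by decide) σ₂).trans (by simp [hσ₂])
  have g21' : (searchRoot.exec σ₂).reg 21 = (boundary T S).card :=
    (exec_reg_of_keepsReg (by decide) σ₂).trans g21
  have g6 : (searchRoot.exec σ₂).arr 6 = σ.arr 6 :=
    (exec_arr_of_keepsArr (by decide) σ₂).trans f6
  have g7 : (searchRoot.exec σ₂).arr 7 = σ.arr 7 :=
    (exec_arr_of_keepsArr (by decide) σ₂).trans f7
  obtain ⟨h7, h6⟩ := exec_writeEntry e4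
  rw [g19, g20, g21', h24, g6] at h6
  rw [g20, h25, g7] at h7
  set σ₃ := writeEntry.exec (searchRoot.exec σ₂)
  refine ⟨⟨r, hr, by rw [h7, if_pos rfl], fun h1 => ?_, fun h2 => ?_, fun h3 => ?_⟩,
    fun m hm => ⟨by rw [h6, if_neg hm], by rw [h7, if_neg hm]⟩⟩
  · rw [tableEntry, h6, if_pos rfl, if_pos h1.le]
  · rw [tableEntry, h6, if_pos rfl, if_neg (by omega), if_pos h2.le]
  · have hval : ∀ r' ∈ S, rootValue T (tableEntry σ₃) S r' = rootValue T (tableEntry σ) S r' :=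
      fun r' hr' => rootValue_congr hr' fun D hD => by
        rw [tableEntry, h6, if_neg]
        · rfl
        · intro he
          rw [mask_injective he] at hD
          exact lt_irrefl _ hD
    have hS6 : tableEntry σ₃ S = if k ≤ (boundary T S).card then
        rootValue T (tableEntry σ) S r
        else S.card * (k + 4) + rootValue T (tableEntry σ) S r := by
      rw [tableEntry, h6, if_pos rfl, if_neg (by omega), if_neg (by omega)]
    refine ⟨fun hlt => ⟨fun r' hr' => ?_, ?_⟩, fun heq => ⟨?_, ?_⟩⟩
    · rw [hval r hr, hval r' hr']
      simpa [rootKey, hlt.not_ge] using hmin r' hr'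
    · rw [hS6, if_neg hlt.not_ge, hval r hr]
    · refine isBalancedSeparator_of_heavyCount_le hT hS heq hr fun r' hr' => ?_
      simpa [rootKey, heq.ge] using hmin r' hr'
    · rw [hS6, if_pos heq.ge, hval r hr]

theorem exec_processRow (hT : T.IsTree)
    (hS : S = ∅ ∨ IsSubtree T S ∧ (boundary T S).card ≤ k) {σ : Store} (h : AtRow T k S σ)
    {s : ℕ} (hs : σ.reg 18 = s) :
    (S.card = s + 1 → Solved T k (processRow.exec σ) S) ∧
      ∀ D : Finset (Fin n), (D = S → S.card ≠ s + 1) →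
        (processRow.exec σ).arr 6 (mask D) = σ.arr 6 (mask D) ∧
        (processRow.exec σ).arr 7 (mask D) = σ.arr 7 (mask D) := by
  rw [processRow, exec_seq, exec_sumVertices_finset (by decide) (by decide) (by decide)
    (by decide) rfl rfl h.tables.reg_zero S (fun _ => 1)]
  · rw [← card_eq_sum_ones]
    simp only [exec_ifLe, exec_skip, Expr.eval, Store.setReg_reg, Nat.reduceEqDiff, if_true,
      if_false, hs]
    by_cases hcard : S.card = s + 1
    · rw [if_neg (by omega), if_neg (by omega)]
      have hS' : IsSubtree T S ∧ (boundary T S).card ≤ k := hS.resolve_left fun he => by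
        rw [he, card_empty] at hcard
        omega
      obtain ⟨h1, h2⟩ := exec_solveRow hT hS'.1
        ((h.setReg (x := 19) (by decide) S.card).setReg (x := 13) (by decide) n) (by simp)
      exact ⟨fun _ => h1, fun D hD => h2 (mask D) fun he => hD (mask_injective he) hcard⟩
    · refine ⟨fun h => absurd h hcard, fun D _ => ?_⟩
      split_ifs
      · exact ⟨rfl, rfl⟩
      · exact ⟨rfl, rfl⟩
      · omega
  · intro x
    have := h.row x
    simp only [Expr.eval, Store.setReg_reg, Store.setReg_arr, Nat.reduceEqDiff, if_true, if_false,
      this]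
    split_ifs with hx <;> simp [hx]
  · intro x _
    rfl

theorem exec_fillTable (hT : T.IsTree) {N : ℕ} {σ : Store} (ht : HasTables T σ)
    (hk : σ.reg 1 = k) (hN : σ.reg 2 = N) (hF : IsFamily T k N σ) :
    ∀ S, IsSubtree T S → (boundary T S).card ≤ k → Solved T k (fillTable.exec σ) S := by
  have key := exec_forVertices_induct (x := 18) (σ := σ)
    (p := .seq (.assign 15 (.lit 0)) <|
      .loop (.reg 2) <| .seq processRow (.assign 15 (.add (.reg 15) (.reg 0))))
    (by decide) (by decide)
    (fun i τ => ∀ S, IsSubtree T S → (boundary T S).card ≤ k → S.card ≤ i → Solved T k τ S)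
    (by
      intro S hS _ hc
      have := card_pos.2 ((isSubtree_iff hT).1 hS).1
      omega) (by
    intro s hs τ hI hx hreg harr
    have g5 : τ.arr 5 = σ.arr 5 := harr 5 rfl
    have g2 : τ.reg 2 = N := (hreg 2 (by decide) rfl).trans hN
    have gt : HasTables T τ := ht.congr (hreg 0 (by decide) rfl) fun a ha => by
      fin_cases ha <;> exact harr _ rfl
    have g1 : τ.reg 1 = k := (hreg 1 (by decide) rfl).trans hk
    have := exec_loop_induct (e := .reg 2) (σ := τ.setReg 15 0)
      (p := .seq processRow (.assign 15 (.add (.reg 15) (.reg 0))))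
      (fun j τ' => τ'.reg 15 = j * n ∧
        (∀ S, IsSubtree T S → (boundary T S).card ≤ k → S.card ≤ s → Solved T k τ' S) ∧
        ∀ j' < j, (rowSet n σ j').card = s + 1 → Solved T k τ' (rowSet n σ j'))
      ⟨by simp, hI, by simp⟩ (by
      rintro j hj τ' ⟨h15, hJ1, hJ2⟩ hreg' harr'
      replace hj : j < N := by simpa [Expr.eval, g2] using hj
      have f5 : τ'.arr 5 = σ.arr 5 := (harr' 5 rfl).trans g5
      have ft : HasTables T τ' := gt.congr ((hreg' 0 rfl).trans (by simp)) fun a ha => by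
        fin_cases ha <;> exact harr' _ rfl
      have hrow : AtRow T k (rowSet n σ j) τ' :=
        ⟨ft, (hreg' 1 rfl).trans (by simpa using g1), by
          rw [h15, f5]; exact hF.indicator j hj⟩
      obtain ⟨h1, h2⟩ := exec_processRow hT (hF.sound j hj) hrow
        ((hreg' 18 rfl).trans (by simpa using hx))
      -- What was solved before remains solved: only the entries of the current set may change.
      have hkeep : ∀ S, S.card ≤ s + 1 → S ≠ rowSet n σ j → Solved T k τ' S →
          Solved T k (processRow.exec τ') S := by
        intro S hS hne hsol
        have h3 := h2 S fun he => absurd he hne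
        refine hsol.congr h3.2 h3.1 fun D hD => (h2 D ?_).1
        rintro rfl
        omega
      have f15 : (processRow.exec τ').reg 15 = τ'.reg 15 := exec_reg_of_keepsReg (by decide) τ'
      have f0 : (processRow.exec τ').reg 0 = n :=
        (exec_reg_of_keepsReg (by decide) τ').trans ft.reg_zero
      have hset : ∀ {S}, Solved T k (processRow.exec τ') S → Solved T k
          ((Cmd.seq processRow (.assign 15 (.add (.reg 15) (.reg 0)))).exec τ') S := fun h =>
        h.congr rfl rfl fun _ _ => rfl
      refine ⟨by simp [Expr.eval, f15, f0, h15, Nat.succ_mul], fun S hS hb hc => hset ?_,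
        fun j' hj' hc => hset ?_⟩
      · by_cases he : S = rowSet n σ j
        · have h3 := h2 S fun _ => by rw [← he]; omega
          refine (hJ1 S hS hb hc).congr h3.2 h3.1 fun D hD => (h2 D ?_).1
          rintro rfl
          rw [he] at hD
          exact absurd hD (lt_irrefl _)
        · exact hkeep S (by omega) he (hJ1 S hS hb hc)
      · by_cases he : rowSet n σ j' = rowSet n σ j
        · rw [he] at hc ⊢
          exact h1 hc
        · exact hkeep _ hc.le he (hJ2 j' (lt_of_le_of_ne (Nat.le_of_lt_succ hj') fun h => he
            (by rw [h])) hc))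
    have hN' : (Expr.reg 2).eval (τ.setReg 15 0) = N := by simpa [Expr.eval] using g2
    rw [hN'] at this
    obtain ⟨-, h1, h2⟩ := this
    intro S hS hb hc
    have hsol : Solved T k ((Cmd.loop (.reg 2)
        (.seq processRow (.assign 15 (.add (.reg 15) (.reg 0))))).exec (τ.setReg 15 0)) S := by
      rcases Nat.lt_or_ge s S.card with hlt | hle
      · obtain ⟨j, hj, rfl⟩ := hF.complete S hS hb
        exact h2 j hj (by omega)
      · exact h1 S hS hb hle
    exact hsol.congr rfl rfl fun _ _ => rfl)
  rw [ht.reg_zero] at key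
  exact fun S hS hb => key S hS hb (by simpa using card_le_univ S)

end HubProgram

/-! ### The output of the program -/

namespace HubProgram

open Cmd Expr

variable {n : ℕ} {T : SimpleGraph (Fin n)} {k : ℕ} {S : Finset (Fin n)}

theorem mask_singleton (x : Fin n) : mask {x} = 2 ^ (x : ℕ) := by
  simp [mask]

/-- Array `7` receives the entries of all single vertices. A component of a two-vertex subtree is a
single vertex that may have `k + 1` boundary vertices, and then it is not in the family. -/
def fillSingletons : Cmd := forVertices 13 <| .store 7 (.load 3 (.reg 13)) (.reg 13)

theorem exec_fillSingletons {σ : Store} (ht : HasTables T σ) :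
    (∀ x : Fin n, (fillSingletons.exec σ).arr 7 (mask {x}) = x) ∧
      ∀ S : Finset (Fin n), S.card ≠ 1 →
        (fillSingletons.exec σ).arr 7 (mask S) = σ.arr 7 (mask S) := by
  have := exec_forVertices_induct (x := 13) (σ := σ)
    (p := .store 7 (.load 3 (.reg 13)) (.reg 13)) (by decide) (by decide)
    (fun i τ => (∀ x : Fin n, (x : ℕ) < i → τ.arr 7 (mask {x}) = x) ∧
      ∀ S : Finset (Fin n), S.card ≠ 1 → τ.arr 7 (mask S) = σ.arr 7 (mask S)) (by simp) (by
      rintro i hi τ ⟨h1, h2⟩ hx hreg harr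
      rw [ht.reg_zero] at hi
      have h3 : τ.arr 3 i = mask {(⟨i, hi⟩ : Fin n)} := by
        rw [harr 3 rfl, mask_singleton]
        exact ht.pow ⟨i, hi⟩
      simp only [exec_store, Expr.eval, Store.setReg_arr, Store.setArr_arr, true_and, hx, h3]
      refine ⟨fun x hxi => ?_, fun S hS => ?_⟩
      · split_ifs with h
        · rw [singleton_injective (mask_injective h)]
        · refine h1 x (lt_of_le_of_ne (Nat.le_of_lt_succ hxi) fun he => h ?_)
          rw [show x = ⟨i, hi⟩ from Fin.ext he]
      · rw [if_neg, h2 S hS]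
        intro h
        rw [mask_injective h, card_singleton] at hS
        exact hS rfl)
  rw [ht.reg_zero] at this
  exact ⟨fun x => this.1 x x.2, this.2⟩

theorem solved_fillSingletons {σ : Store} (ht : HasTables T σ) (h : Solved T k σ S) :
    Solved T k (fillSingletons.exec σ) S := by
  obtain ⟨h1, h2⟩ := exec_fillSingletons ht
  have h6 : (fillSingletons.exec σ).arr 6 = σ.arr 6 := exec_arr_of_keepsArr (by decide) σ
  refine h.congr ?_ (congrFun h6 _) fun D _ => congrFun h6 _
  by_cases hc : S.card = 1
  · obtain ⟨x, rfl⟩ := card_eq_one.1 hc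
    obtain ⟨r, hr, h3, -⟩ := h
    rw [h1, h3, mem_singleton.1 hr]
  · exact h2 S hc

/-- The choices recorded in array `7`, extended arbitrarily to the sets without an entry. -/
noncomputable def rootOf (x₀ : Fin n) (τ : Store) (S : Finset (Fin n)) : Fin n :=
  open Classical in
  if h : ∃ r ∈ S, τ.arr 7 (mask S) = r then h.choose
  else if h : S.Nonempty then h.choose else x₀

theorem rootOf_mem {x₀ : Fin n} {τ : Store} (hS : S.Nonempty) : rootOf x₀ τ S ∈ S := by
  rw [rootOf]
  split_ifs with h
  exacts [h.choose_spec.1, hS.choose_spec]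

theorem rootOf_eq {x₀ : Fin n} {τ : Store} {r : Fin n} (hr : r ∈ S)
    (h : τ.arr 7 (mask S) = r) : rootOf x₀ τ S = r := by
  have hex : ∃ r ∈ S, τ.arr 7 (mask S) = r := ⟨r, hr, h⟩
  rw [rootOf, dif_pos hex]
  exact Fin.ext (hex.choose_spec.2.symm.trans h)

theorem rootValue_eq_splitB {root : Finset (Fin n) → Fin n} {β : Finset (Fin n) → ℕ} {r : Fin n}
    (h : ∀ D ∈ components T (S.erase r), (β D : ℝ) = k * tableB T k root D) :
    (rootValue T β S r : ℝ) = k * splitB T k root S r := by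
  rw [rootValue, splitB, Nat.cast_sum, mul_sum]
  exact sum_congr rfl h

/-- The array `6` holds the `k`-fold values of the table of the dynamic program that follows the
choices in array `7`. -/
theorem tableEntry_eq (hT : T.IsTree) (hk : 2 ≤ k) (x₀ : Fin n) {τ : Store}
    (h : ∀ S, IsSubtree T S → (boundary T S).card ≤ k → Solved T k τ S)
    (hS : IsSubtree T S) (hb : (boundary T S).card ≤ k) :
    (tableEntry τ S : ℝ) = k * tableB T k (rootOf x₀ τ) S := by
  have hk0 : (k : ℝ) ≠ 0 := by exact_mod_cast (by omega : k ≠ 0)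
  induction hm : S.card using Nat.strong_induction_on generalizing S with
  | _ m ih =>
    subst hm
    obtain ⟨r, hr, h7, h1, h2, h3⟩ := h S hS hb
    have hroot := rootOf_eq (x₀ := x₀) hr h7
    have hpos := card_pos.2 ⟨r, hr⟩
    have hval : ∀ r' ∈ S, (∀ D ∈ components T (S.erase r'), (boundary T D).card ≤ k) →
        (rootValue T (tableEntry τ) S r' : ℝ) = k * splitB T k (rootOf x₀ τ) S r' :=
      fun r' hr' hD => rootValue_eq_splitB fun D hD' =>
        ih _ (card_lt_of_mem_components T hr' hD') (isSubtree_of_mem_components hT hD')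
          (hD D hD') rfl
    rcases (by omega : S.card = 1 ∨ S.card = 2 ∨ 3 ≤ S.card) with hc | hc | hc
    · rw [tableB_of_card_eq_one hc, h1 hc, mul_one]
    · rw [tableB_of_card_eq_two hc, h2 hc]
      push_cast
      ring
    · rcases hb.lt_or_eq with hlt | heq
      · obtain ⟨hmin, hB⟩ := (h3 hc).1 hlt
        have hval' := fun r' hr' => hval r' hr' fun D hD => (card_boundary_le_succ hD).trans hlt
        have hinf : S.inf' ⟨r, hr⟩ (splitB T k (rootOf x₀ τ) S) =
            splitB T k (rootOf x₀ τ) S r := by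
          refine le_antisymm (inf'_le _ hr) (le_inf' _ _ fun r' hr' => ?_)
          have hle : (rootValue T (tableEntry τ) S r : ℝ) ≤ rootValue T (tableEntry τ) S r' := by
            exact_mod_cast hmin r' hr'
          rw [hval' r hr, hval' r' hr'] at hle
          exact le_of_mul_le_mul_left hle (by positivity)
        rw [tableB_of_lt T k _ S ⟨r, hr⟩ hc hlt, hinf, hB]
        push_cast
        rw [hval' r hr]
        field_simp
      · obtain ⟨hbal, hB⟩ := (h3 hc).2 heq
        rw [tableB_of_eq T k _ S (by rw [hroot]; exact hr) hc heq, hroot, hB]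
        refine hval r hr fun D hD => ?_
        have := card_boundary_le_of_balanced hT ((isSubtree_iff hT).1 hS).2 hbal hD
        omega

theorem isDPRun_rootOf (hT : T.IsTree) (hk : 2 ≤ k) (x₀ : Fin n) {τ : Store}
    (h : ∀ S, IsSubtree T S → (boundary T S).card ≤ k → Solved T k τ S) :
    IsDPRun T k (rootOf x₀ τ) := by
  intro S hS
  refine ⟨rootOf_mem ((isSubtree_iff hT).1 hS).1, fun hc => ⟨fun hlt => ?_, fun heq => ?_⟩⟩
  · obtain ⟨r, hr, h7, -, -, h3⟩ := h S hS hlt.le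
    rw [rootOf_eq hr h7]
    intro r' hr'
    have hval : ∀ r' ∈ S, (rootValue T (tableEntry τ) S r' : ℝ) =
        k * splitB T k (rootOf x₀ τ) S r' := fun r' hr' => rootValue_eq_splitB fun D hD =>
      tableEntry_eq hT hk x₀ h (isSubtree_of_mem_components hT hD)
        ((card_boundary_le_succ hD).trans hlt)
    have hle : (rootValue T (tableEntry τ) S r : ℝ) ≤ rootValue T (tableEntry τ) S r' := by
      exact_mod_cast ((h3 hc).1 hlt).1 r' hr'
    rw [hval r hr, hval r' hr'] at hle
    exact le_of_mul_le_mul_left hle (by exact_mod_cast (by omega : 0 < k))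
  · obtain ⟨r, hr, h7, -, -, h3⟩ := h S hS heq.le
    rw [rootOf_eq hr h7]
    exact ((h3 hc).2 heq).1

/-- One step of the output: the vertex removed from the current set (array `9`) becomes a hub of the
vertex in register `12`, and the current set becomes its component. -/
def hubStep : Cmd :=
  whenPos (.load 9 (.reg 12)) <|
    .seq (sumVertices 13 20 (.load 9 (.reg 13)) (.load 3 (.reg 13))) <|
    .seq (.assign 25 (.load 7 (.reg 20))) <|
    .seq (.store 1 (.add (.load 2 (.reg 12)) (.reg 25)) (.lit 1)) <|
    forVertices 13 <| .ifLe (.add (entry 4 12 25) (entry 4 25 13)) (entry 4 12 13)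
      (.store 9 (.reg 13) (.lit 0)) skip

/-- Follow, for every vertex, the choices of the dynamic program from the whole tree down to the
vertex. -/
def writeOutput : Cmd :=
  forVertices 12 <| .seq (forVertices 13 <| .store 9 (.reg 13) (.lit 1)) <|
    .loop (.reg 0) hubStep

/-- The current set is `S`. -/
def IsCurrent (S : Finset (Fin n)) (τ : Store) : Prop :=
  ∀ x : Fin n, τ.arr 9 x = if x ∈ S then 1 else 0

theorem exec_hubStep (hT : T.IsTree) (hS : PathConvex T S) {σ : Store} (ht : HasTables T σ)
    (hcur : IsCurrent S σ) {u r : Fin n} (hu : u ∈ S) (hu' : σ.reg 12 = u)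
    (hr : σ.arr 7 (mask S) = r) :
    IsCurrent (component T (S.erase r) u) (hubStep.exec σ) ∧
      ∀ m, (hubStep.exec σ).arr 1 m = if m = u * n + r then 1 else σ.arr 1 m := by
  rw [hubStep, exec_whenPos, if_pos (by simp [Expr.eval, hu', hcur u, hu]), exec_seq,
    exec_sumVertices_finset (by decide) (by decide) (by decide) (by decide) rfl rfl ht.reg_zero S
    (fun x => 2 ^ (x : ℕ))]
  · change IsCurrent _ (Cmd.exec _ ((σ.setReg 20 (mask S)).setReg 13 n)) ∧
      ∀ m, (Cmd.exec _ ((σ.setReg 20 (mask S)).setReg 13 n)).arr 1 m = _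
    simp only [exec_seq, exec_assign, exec_store, Expr.eval, Store.setReg_reg, Store.setReg_arr,
      Nat.reduceEqDiff, if_true, if_false, hr, hu', ht.row]
    set σ₁ := ((((σ.setReg 20 (mask S)).setReg 13 n).setReg 25 (r : ℕ)).setArr 1 (u * n + r) 1)
      with hσ₁
    have ht₁ : HasTables T σ₁ := ht.congr (by simp [hσ₁]) fun a ha => by
      funext m
      have h1 : a ≠ 1 := by rintro rfl; simp at ha
      simp [hσ₁, h1]
    have hcur₁ : IsCurrent S σ₁ := fun x => by simpa [hσ₁] using hcur x
    have h12 : σ₁.reg 12 = u := by simp [hσ₁, hu']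
    have h25 : σ₁.reg 25 = r := by simp [hσ₁]
    constructor
    · have := exec_forVertices_induct (x := 13) (σ := σ₁)
        (p := .ifLe (.add (entry 4 12 25) (entry 4 25 13)) (entry 4 12 13)
          (.store 9 (.reg 13) (.lit 0)) skip) (by decide) (by decide)
        (fun i τ => ∀ x : Fin n, τ.arr 9 x =
          if x ∈ S ∧ ((x : ℕ) < i → ¬ T.dist u r + T.dist r x ≤ T.dist u x) then 1 else 0)
        (by simpa [IsCurrent] using hcur₁) (by
        intro i hi τ hI hx hreg harr
        rw [ht₁.reg_zero] at hi
        have hτ : HasTables T τ := ht₁.congr (hreg 0 (by decide) rfl) fun a ha => by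
          fin_cases ha <;> exact harr _ rfl
        have g12 := (hreg 12 (by decide) rfl).trans h12
        have g25 := (hreg 25 (by decide) rfl).trans h25
        have d := hτ.dist
        have hd1 := d r ⟨i, hi⟩
        have hd2 := d u ⟨i, hi⟩
        simp only at hd1 hd2
        simp only [exec_ifLe, exec_store, exec_skip, Expr.eval, g12, g25, hx, hτ.row, d, hd1, hd2]
        intro x
        by_cases hxi : (x : ℕ) = i
        · obtain rfl : x = ⟨i, hi⟩ := Fin.ext hxi
          have := hI ⟨i, hi⟩
          simp only at this
          split_ifs with h1 h2 h2 <;> simp_all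
        · have h3 : (x : ℕ) < i + 1 ↔ (x : ℕ) < i := by omega
          have := hI x
          split_ifs with h1 h2 h2 <;> simp_all)
      rw [ht₁.reg_zero] at this
      intro x
      rw [this x]
      have h1 := hT.connected.dist_triangle (u := u) (v := r) (w := x)
      refine if_congr ?_ rfl rfl
      rw [component_erase_eq hT hS hu, mem_filter]
      refine and_congr_right fun _ => ?_
      have := x.2
      constructor
      · exact fun h he => h this he.le
      · exact fun h _ hle => h (le_antisymm hle h1)
    · intro m
      rw [exec_arr_of_keepsArr (by decide)]
      simp [hσ₁]
  · intro x
    have := hcur x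
    simp only [Expr.eval, Store.setReg_reg, Store.setReg_arr, if_true, this]
    split_ifs with hx <;> simp [hx]
  · intro x _
    simp [Expr.eval, ht.pow]

theorem dpLabeling_eq_insert {root : Finset (Fin n) → Fin n} (hr : root S ∈ S) {u : Fin n}
    (hu : u ∈ S) : dpLabeling T root S u =
      insert (root S) (dpLabeling T root (component T (S.erase (root S)) u) u) := by
  rw [dpLabeling_of_mem hr hu]
  split_ifs with h
  · rw [dpLabeling_of_notMem]
    rw [h]
    exact fun h' => notMem_erase _ _ (component_subset _ _ h')
  · rfl

/-- The subtrees that the labeling of the whole tree passes through: besides the subtrees with small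
boundary, only single vertices. -/
theorem component_small_boundary (hT : T.IsTree) (hk : 2 ≤ k) {root : Finset (Fin n) → Fin n}
    (hrun : IsDPRun T k root) (hS : IsSubtree T S)
    (hb : (boundary T S).card ≤ k ∨ S.card = 1) {u : Fin n} (hu : u ∈ S) (hne : u ≠ root S) :
    (boundary T (component T (S.erase (root S)) u)).card ≤ k ∨
      (component T (S.erase (root S)) u).card = 1 := by
  obtain ⟨hr, h⟩ := hrun S hS
  have hu' : u ∈ S.erase (root S) := mem_erase.2 ⟨hne, hu⟩
  have hD : component T (S.erase (root S)) u ∈ components T (S.erase (root S)) :=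
    mem_image_of_mem _ hu'
  have h1 := card_lt_of_mem_components T hr hD
  have h2 : 0 < (component T (S.erase (root S)) u).card := card_pos.2 ⟨u, mem_component_self hu'⟩
  by_cases hc : 3 ≤ S.card
  · replace hb := hb.resolve_right (by omega)
    left
    rcases hb.lt_or_eq with hlt | heq
    · exact (card_boundary_le_succ hD).trans hlt
    · have := card_boundary_le_of_balanced hT ((isSubtree_iff hT).1 hS).2 ((h hc).2 heq) hD
      omega
  · right
    omega

theorem exec_writeOutput (hT : T.IsTree) (hk : 2 ≤ k) {root : Finset (Fin n) → Fin n}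
    (hrun : IsDPRun T k root) {σ : Store} (ht : HasTables T σ) (h1 : ∀ m, σ.arr 1 m = 0)
    (h7 : ∀ S, IsSubtree T S → (boundary T S).card ≤ k ∨ S.card = 1 →
      σ.arr 7 (mask S) = root S) :
    outputLabeling n (writeOutput.exec σ) = dpLabeling T root univ := by
  have key := exec_forVertices_induct (x := 12) (σ := σ)
    (p := .seq (forVertices 13 <| .store 9 (.reg 13) (.lit 1)) <| .loop (.reg 0) hubStep)
    (by decide) (by decide)
    (fun i τ => ∀ u v : Fin n, τ.arr 1 (u * n + v) ≠ 0 ↔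
      (u : ℕ) < i ∧ v ∈ dpLabeling T root univ u) (by simp [h1]) (by
    intro i hi τ hI hx hreg harr
    rw [ht.reg_zero] at hi
    have htτ : HasTables T τ := ht.congr (hreg 0 (by decide) rfl) fun a ha => by
      fin_cases ha <;> exact harr _ rfl
    have h7τ : τ.arr 7 = σ.arr 7 := harr 7 rfl
    have hfill := exec_forVertices_induct (x := 13) (σ := τ) (p := .store 9 (.reg 13) (.lit 1))
      (by decide) (by decide) (fun j τ' => ∀ x < j, τ'.arr 9 x = 1) (by simp) (by
        intro j hj τ' h hx' _ _ x hxj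
        by_cases hxe : x = j
        · simp [Expr.eval, hxe, hx']
        · simpa [Expr.eval, hxe, hx'] using h x (by omega))
    rw [htτ.reg_zero] at hfill
    simp only [exec_seq]
    have ht₁ : HasTables T ((forVertices 13 (.store 9 (.reg 13) (.lit 1))).exec τ) :=
      htτ.exec (by decide)
    have f7 : ((forVertices 13 (.store 9 (.reg 13) (.lit 1))).exec τ).arr 7 = σ.arr 7 :=
      (exec_arr_of_keepsArr (by decide) τ).trans h7τ
    have f1 : ((forVertices 13 (.store 9 (.reg 13) (.lit 1))).exec τ).arr 1 = τ.arr 1 :=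
      exec_arr_of_keepsArr (by decide) τ
    have f12 : ((forVertices 13 (.store 9 (.reg 13) (.lit 1))).exec τ).reg 12 = i :=
      (exec_reg_of_keepsReg (by decide) τ).trans hx
    set τ₁ := (forVertices 13 (.store 9 (.reg 13) (.lit 1))).exec τ
    set u : Fin n := ⟨i, hi⟩ with hu
    have hloop := exec_loop_induct (e := .reg 0) (p := hubStep) (σ := τ₁)
      (fun j τ' => ∃ S, IsCurrent S τ' ∧ S.card + j ≤ n ∧ (S = ∅ ∨ u ∈ S ∧ IsSubtree T S ∧
          ((boundary T S).card ≤ k ∨ S.card = 1)) ∧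
        (∀ v, v ∈ dpLabeling T root univ u ↔
          τ'.arr 1 (u * n + v) ≠ 0 ∨ v ∈ dpLabeling T root S u) ∧
        ∀ u' v : Fin n, u' ≠ u → τ'.arr 1 (u' * n + v) = τ.arr 1 (u' * n + v))
      (by
        refine ⟨univ, fun x => by rw [hfill x x.2, if_pos (mem_univ x)], by simp,
          .inr ⟨mem_univ u, isSubtree_univ hT, .inl (by simp [boundary_univ])⟩, fun v => ?_,
          fun u' v _ => by rw [f1]⟩
        have : ¬ τ₁.arr 1 (u * n + v) ≠ 0 := by
          rw [f1, hI u v]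
          simp [hu]
        simp [this]) (by
      rintro j hj τ' ⟨S, hcur, hcard, hS, hout, hother⟩ hreg' harr'
      have htτ' : HasTables T τ' := ht₁.congr (hreg' 0 rfl) fun a ha => by
        fin_cases ha <;> exact harr' _ rfl
      have g12 : τ'.reg 12 = u := (hreg' 12 rfl).trans f12
      have g7 : τ'.arr 7 = σ.arr 7 := (harr' 7 rfl).trans f7
      rcases hS with rfl | ⟨huS, hsub, hb⟩
      · have : hubStep.exec τ' = τ' := by
          rw [hubStep, exec_whenPos, if_neg]
          simp [Expr.eval, g12, hcur u]
        rw [this]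
        have hj' : j < n := by simpa [Expr.eval, ht₁.reg_zero] using hj
        exact ⟨∅, hcur, by simpa using hj', .inl rfl, hout, hother⟩
      · have hr := (hrun S hsub).1
        have hc := ((isSubtree_iff hT).1 hsub).2
        obtain ⟨hcur', hout'⟩ := exec_hubStep hT hc htτ' hcur huS g12
          ((congrFun g7 _).trans (h7 S hsub hb))
        have hlt : (component T (S.erase (root S)) u).card < S.card :=
          (card_component_le T _ _).trans_lt (card_erase_lt_of_mem hr)
        refine ⟨_, hcur', by omega, ?_, fun v => ?_, fun u' v hne => ?_⟩
        · by_cases he : u = root S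
          · left
            refine eq_empty_of_forall_notMem fun x hx => ?_
            rw [component_erase_eq hT hc huS, mem_filter, ← he] at hx
            simp at hx
          · have hu' : u ∈ S.erase (root S) := mem_erase.2 ⟨he, huS⟩
            exact .inr ⟨mem_component_self hu', isSubtree_component hT hu',
              component_small_boundary hT hk hrun hsub hb huS he⟩
        · rw [hout v, hout', dpLabeling_eq_insert hr huS, mem_insert]
          by_cases hv : v = root S
          · simp [hv]
          · have : (v : ℕ) ≠ root S := fun h => hv (Fin.ext h)
            rw [if_neg (by omega)]
            simp [hv]
        · rw [hout', if_neg, hother u' v hne]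
          rw [entry_inj v.2 (root S).2]
          exact fun h => hne (Fin.ext h.1))
    have h0 : (Expr.reg 0).eval τ₁ = n := ht₁.reg_zero
    rw [h0] at hloop
    obtain ⟨S, -, hcard, -, hout, hother⟩ := hloop
    obtain rfl : S = ∅ := card_eq_zero.1 (by omega)
    intro u' v
    rw [Store.setReg_arr]
    by_cases hue : u' = u
    · rw [hue, hout v, dpLabeling_of_notMem (notMem_empty u)]
      simp [hu]
    · rw [hother u' v hue, hI u' v]
      have : (u' : ℕ) ≠ i := fun h => hue (Fin.ext h)
      refine and_congr_left fun _ => ?_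
      omega)
  rw [ht.reg_zero] at key
  funext u
  ext v
  rw [outputLabeling, mem_filter]
  exact (and_iff_right (mem_univ v)).trans ((key u v).trans (and_iff_right u.2))

/-! ### The complete program -/

/-- The part of the program that computes the tables and the number of rows. -/
def prepare : Cmd := .seq setup countRows

/-- The part of the program that uses the number of rows (register `2`) as a loop bound. -/
def solveAndWrite : Cmd :=
  .seq generate <| .seq fillTable <| .seq fillSingletons writeOutput

/-- The approximation scheme. -/
def program : Cmd := .seq prepare <| .seq (.assign 2 (.reg 10)) solveAndWrite

theorem exec_program (hT : T.IsTree) (hk : 2 ≤ k) :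
    ∃ root : Finset (Fin n) → Fin n, IsDPRun T k root ∧
      outputLabeling n (program.exec (inputStore T k)) = dpLabeling T root univ := by
  obtain ⟨x₀⟩ := hT.connected.nonempty
  simp only [program, prepare, solveAndWrite, exec_seq]
  have ht₁ := hasTables_setup hT k
  have f1 : (setup.exec (inputStore T k)).reg 1 = k := exec_reg_of_keepsReg (by decide) _
  have g1 : (setup.exec (inputStore T k)).arr 1 = (inputStore T k).arr 1 :=
    exec_arr_of_keepsArr (by decide) _
  set σ₁ := setup.exec (inputStore T k)
  have ht₂ : HasTables T (countRows.exec σ₁) := ht₁.exec (by decide)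
  have f10 := exec_countRows ht₁.reg_zero f1
  have f1' : (countRows.exec σ₁).reg 1 = k := (exec_reg_of_keepsReg (by decide) _).trans f1
  have g1' : (countRows.exec σ₁).arr 1 = (inputStore T k).arr 1 :=
    (exec_arr_of_keepsArr (by decide) _).trans g1
  set σ₂ := countRows.exec σ₁
  simp only [exec_assign, Expr.eval, f10]
  have ht₃ : HasTables T (σ₂.setReg 2 (familySize n k)) := ht₂.setReg (by decide) _
  have hrows := exec_generate ht₃
  rw [Store.setReg_reg, if_pos rfl] at hrows
  have hfam := isFamily_of_rowsUpTo hT hrows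
  have ht₄ : HasTables T (generate.exec (σ₂.setReg 2 (familySize n k))) := ht₃.exec (by decide)
  have k1 : (generate.exec (σ₂.setReg 2 (familySize n k))).reg 1 = k :=
    (exec_reg_of_keepsReg (by decide) _).trans (by simpa using f1')
  have k2 : (generate.exec (σ₂.setReg 2 (familySize n k))).reg 2 = familySize n k :=
    (exec_reg_of_keepsReg (by decide) _).trans (by simp)
  have g1'' : (generate.exec (σ₂.setReg 2 (familySize n k))).arr 1 = (inputStore T k).arr 1 :=
    (exec_arr_of_keepsArr (by decide) _).trans g1'
  set σ₃ := generate.exec (σ₂.setReg 2 (familySize n k))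
  have hsol := exec_fillTable hT ht₄ k1 k2 hfam
  have ht₅ : HasTables T (fillTable.exec σ₃) := ht₄.exec (by decide)
  have hsol' := fun S hS hb => solved_fillSingletons ht₅ (hsol S hS hb)
  have hsing := (exec_fillSingletons ht₅).1
  have ht₆ : HasTables T (fillSingletons.exec (fillTable.exec σ₃)) := ht₅.exec (by decide)
  have g1''' : (fillSingletons.exec (fillTable.exec σ₃)).arr 1 = (inputStore T k).arr 1 :=
    (exec_arr_of_keepsArr (by decide) _).trans ((exec_arr_of_keepsArr (by decide) _).trans g1'')
  set σ₄ := fillSingletons.exec (fillTable.exec σ₃)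
  have hrun := isDPRun_rootOf hT hk x₀ hsol'
  refine ⟨rootOf x₀ σ₄, hrun, exec_writeOutput hT hk hrun ht₆ (fun m => ?_) ?_⟩
  · rw [g1''']
    simp [inputStore]
  · rintro S hS (hb | hc)
    · obtain ⟨r, hr, h7, -⟩ := hsol' S hS hb
      rw [rootOf_eq hr h7, h7]
    · obtain ⟨x, rfl⟩ := card_eq_one.1 hc
      rw [rootOf_eq (mem_singleton_self x) (hsing x), hsing x]

set_option maxRecDepth 4000 in
theorem steps_program (hT : T.IsTree) (hk : 1 ≤ k) :
    program.steps (inputStore T k) ≤ max n 2 ^ (119 * k) := by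
  set M := max n 2
  have hM : 2 ≤ M := le_max_right _ _
  set K := M ^ k with hK
  have hMK : M ≤ K := Nat.le_self_pow (by omega) M
  have hK2 : 2 ≤ K := hM.trans hMK
  have hkK : k ≤ K := (Nat.lt_pow_self (by omega)).le
  have hK3 : K ≤ K ^ 3 := Nat.le_self_pow (by decide) K
  have hn : n ≤ K ^ 3 := (le_max_left n 2).trans (hMK.trans hK3)
  have h1 : prepare.steps (inputStore T k) ≤ K ^ 63 := by
    refine (steps_le_pow (c := prepare) (by decide) hK2 fun x hx => ?_).trans
      (Nat.pow_le_pow_right (by omega) (by decide))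
    interval_cases x
    exacts [hn, hkK.trans hK3, Nat.zero_le _]
  have ht := hasTables_setup hT k
  have f1 : (setup.exec (inputStore T k)).reg 1 = k := exec_reg_of_keepsReg (by decide) _
  have f10 := exec_countRows ht.reg_zero f1
  have h2 : solveAndWrite.steps ((Cmd.assign 2 (.reg 10)).exec (prepare.exec (inputStore T k))) ≤
      K ^ 117 := by
    refine (steps_le_pow (c := solveAndWrite) (by decide) hK2 fun x hx => ?_).trans
      (Nat.pow_le_pow_right (by omega) (by decide))
    have g : ∀ y < 2, (prepare.exec (inputStore T k)).reg y = (inputStore T k).reg y :=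
      fun y hy => by interval_cases y <;> exact exec_reg_of_keepsReg (by decide) _
    interval_cases x
    · rw [exec_assign, Store.setReg_reg, if_neg (by decide), g 0 (by decide)]
      exact hn
    · rw [exec_assign, Store.setReg_reg, if_neg (by decide), g 1 (by decide)]
      exact hkK.trans hK3
    · simp only [exec_assign, Expr.eval, Store.setReg_reg, if_true]
      simp only [prepare, exec_seq, f10]
      exact familySize_le hM (le_max_left n 2) k
  change prepare.steps _ + (2 + solveAndWrite.steps _) ≤ _
  rw [mul_comm, pow_mul, ← hK]
  have h3 : K ^ 63 ≤ K ^ 117 := Nat.pow_le_pow_right (by omega) (by decide)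
  have h4 : 2 ≤ K ^ 117 := hK2.trans (Nat.le_self_pow (by decide) K)
  have h5 : K ^ 119 = K ^ 117 * (K * K) := by ring
  have h6 : 4 ≤ K * K := Nat.mul_le_mul hK2 hK2
  have h7 := Nat.mul_le_mul_left (K ^ 117) h6
  omega

end HubProgram

theorem mainTheorem4 :
    -- The guarantee of the dynamic program, for all ways of breaking ties.
    (∀ (V : Type u) [Fintype V] [DecidableEq V] (T : SimpleGraph V), T.IsTree →
      ∀ t k : ℕ, 1 ≤ t → k = 4 * t → ∀ root : Finset V → V, IsDPRun T k root →
        (∀ S : Finset V, IsSubtree T S → (boundary T S).card ≤ k →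
          IsHubLabeling T S (dpLabeling T root S) ∧
          (labelCost S (dpLabeling T root S) : ℝ) ≤ tableB T k root S + budgetC T k S ∧
          tableB T k root S ≤ (1 + 4 / (k : ℝ)) * (optCost T S : ℝ)) ∧
        IsHubLabeling T Finset.univ (dpLabeling T root Finset.univ) ∧
        (labelCost Finset.univ (dpLabeling T root Finset.univ) : ℝ) ≤
          (1 + 4 / (k : ℝ)) * (optCost T Finset.univ : ℝ)) ∧
    -- One machine program carries it out in time `n ^ O(k)`, which is `n ^ O(1 / ε)`.
    (∃ (P : Cmd) (c : ℕ), ∀ (n : ℕ) (T : SimpleGraph (Fin n)), T.IsTree →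
      (∀ t k : ℕ, 1 ≤ t → k = 4 * t →
        (∃ root : Finset (Fin n) → Fin n, IsDPRun T k root ∧
          outputLabeling n (P.exec (inputStore T k)) = dpLabeling T root Finset.univ) ∧
        P.steps (inputStore T k) ≤ max n 2 ^ (c * k)) ∧
      (∀ (ε : ℝ) (k : ℕ), 0 < ε → ε < 1 → k = 4 * ⌈1 / ε⌉₊ →
        IsHubLabeling T Finset.univ (outputLabeling n (P.exec (inputStore T k))) ∧
        (labelCost Finset.univ (outputLabeling n (P.exec (inputStore T k))) : ℝ) ≤
          (1 + 4 / (k : ℝ)) * (optCost T Finset.univ : ℝ) ∧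
        (labelCost Finset.univ (outputLabeling n (P.exec (inputStore T k))) : ℝ) ≤
          (1 + ε) * (optCost T Finset.univ : ℝ) ∧
        (P.steps (inputStore T k) : ℝ) ≤ (max n 2 : ℝ) ^ ((c : ℝ) / ε))) := by
  refine ⟨?_, HubProgram.program, 952, ?_⟩
  · intro V _ _ T hT t k ht hk root hrun
    refine ⟨fun S hS hb => ⟨?_, labelCost_le hT ht hk hrun hS hb,
      tableB_le hT (by omega) hrun hS hb⟩, dp_guarantee_univ hT ht hk hrun⟩
    exact isHubLabeling_dpLabeling hT (fun S hS => (hrun S hS).1) hS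
  · intro n T hT
    refine ⟨fun t k ht hk => ⟨HubProgram.exec_program hT (by omega), ?_⟩, ?_⟩
    · exact (HubProgram.steps_program hT (by omega)).trans
        (Nat.pow_le_pow_right (by omega) (Nat.mul_le_mul_right k (by decide)))
    · intro ε k hε hε1 hk
      have hinv : 1 < 1 / ε := (one_lt_div hε).2 hε1
      have ht : 1 ≤ ⌈1 / ε⌉₊ := Nat.one_le_ceil_iff.2 (by linarith)
      have hceil : 1 / ε ≤ (⌈1 / ε⌉₊ : ℝ) := Nat.le_ceil _
      have hceil' : (⌈1 / ε⌉₊ : ℝ) < 1 / ε + 1 := Nat.ceil_lt_add_one (by linarith)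
      have hkR : (k : ℝ) = 4 * (⌈1 / ε⌉₊ : ℝ) := by exact_mod_cast hk
      obtain ⟨root, hrun, hout⟩ := HubProgram.exec_program hT (k := k) (by omega)
      rw [hout]
      obtain ⟨h1, h2⟩ := dp_guarantee_univ hT ht hk hrun
      refine ⟨h1, h2, h2.trans (mul_le_mul_of_nonneg_right ?_ (by positivity)), ?_⟩
      · have : 4 / (k : ℝ) ≤ ε := by
          rw [div_le_iff₀ (by linarith), hkR]
          have := mul_le_mul_of_nonneg_left hceil hε.le
          rw [mul_one_div_cancel hε.ne'] at this
          linarith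
        linarith
      · have hsteps : (HubProgram.program.steps (inputStore T k) : ℝ) ≤
            (max n 2 : ℝ) ^ (119 * k) := by
          exact_mod_cast HubProgram.steps_program hT (by omega)
        refine hsteps.trans ?_
        rw [← Real.rpow_natCast]
        refine Real.rpow_le_rpow_of_exponent_le (le_max_of_le_right (by norm_num)) ?_
        -- `k < 4 * (1 / ε + 1) ≤ 8 / ε`
        push_cast
        rw [hkR, div_eq_mul_one_div (952 : ℝ) ε]
        linarith
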